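/- Let $(M,\omega)$ be a symplectic manifold of dimension $2n\ge 4$ (Hausdorff, second countable, without boundary, not necessarily compact), with a Riemannian metric $g$ compatible with $\omega$, that is, $g(u,v)=\omega(u,Jv)$ for an almost complex structure $J$. Let $G$ be a Lie group with an $\mathrm{Ad}$-invariant inner product on its Lie algebra, let $\pi:P\to M$ be a smooth principal $G$-bundle, and let $A$ be a smooth connection on $P$, with curvature $F(A)\in\Omega^2(M,\mathrm{Ad}\,P)$ and exterior covariant derivative $d_A$ on $\Omega^*(M,\mathrm{Ad}\,P)$. Let $F=F_p+\Phi\,\omega$ be the Lefschetz decomposition of the curvature: $\Phi\in\Omega^0(M,\mathrm{Ad}\,P)$, and $F_p$ is primitive, $\Lambda F_p=0$, where $\Lambda$ is the adjoint of $\omega\wedge\cdot$. Let $*$ be the Hodge star of $g$ and of the orientation given by $\omega^n$, and let $\langle\alpha,\beta\rangle$ be the $L^2$ inner product with respect to the Riemannian volume. The connection $A$ is called a primitive Yang–Mills connection if it is a critical point of the functional $A\mapsto\|F_p(A)\|^2$, that is, if for every compact $K\subseteq M$ and every smooth $\eta\in\Omega^1(M,\mathrm{Ad}\,P)$ that vanishes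 outside $K$, $$\frac{d}{dt}\Big|_{t=0}\int_K |F_p(A+t\eta)|^2\,d\mathrm{vol}_g=0 .$$ (If $M$ is compact, this is the same as the condition with $K=M$ only.) Then: 1. $-*d_A*F_p=d_A^*F_p$, where $d_A^*$ is the formal adjoint of $d_A$: the form $-*d_A*F_p$ belongs to $\Omega^1(M,\mathrm{Ad}\,P)$, and $\langle d_A\eta,F_p\rangle=\langle\eta,-*d_A*F_p\rangle$ for every smooth $\eta\in\Omega^1(M,\mathrm{Ad}\,P)$ with compact support. 2. $A$ is a primitive Yang–Mills connection if and only if $d_A^*F_p=-*d_A*F_p=0$. -/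

import Mathlib

open scoped Manifold ContDiff Topology

noncomputable section

namespace PrimitiveYM

/-! ### Linear algebra on one tangent space `ℝᵐ` -/

section Pointwise

variable {m : ℕ} {F : Type*} [NormedAddCommGroup F] [NormedSpace ℝ F]

/-- The standard basis of `ℝᵐ`. -/
def stdVec (i : Fin m) : EuclideanSpace ℝ (Fin m) := EuclideanSpace.single i 1

/-- The Gram matrix `(b(eᵢ, eⱼ))` of a bilinear form. -/
def gram (b : EuclideanSpace ℝ (Fin m) →L[ℝ] EuclideanSpace ℝ (Fin m) →L[ℝ] ℝ) :
    Matrix (Fin m) (Fin m) ℝ :=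
  Matrix.of fun i j => b (stdVec i) (stdVec j)

/-- The reciprocal basis `eⁱ = ∑ⱼ gⁱʲ eⱼ`, so that `g(eⁱ, eⱼ) = δⁱⱼ` and
`∑ᵢ eᵢ ⊗ eⁱ` is the inverse metric. -/
def recip (b : EuclideanSpace ℝ (Fin m) →L[ℝ] EuclideanSpace ℝ (Fin m) →L[ℝ] ℝ) (i : Fin m) :
    EuclideanSpace ℝ (Fin m) :=
  ∑ j, (gram b)⁻¹ i j • stdVec j

/-- The inner product on `k`-forms with values in `F` which is induced by an inner product `b`
on `ℝᵐ` and an inner product `κ` on `F`: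
`⟨α, β⟩ = (1/k!) ∑ g^{i₁j₁} ⋯ g^{iₖjₖ} κ(α_{i₁…iₖ}, β_{j₁…jₖ})`. -/
def formInner (b : EuclideanSpace ℝ (Fin m) →L[ℝ] EuclideanSpace ℝ (Fin m) →L[ℝ] ℝ)
    (κ : F →L[ℝ] F →L[ℝ] ℝ) {k : ℕ}
    (α β : EuclideanSpace ℝ (Fin m) [⋀^Fin k]→L[ℝ] F) : ℝ :=
  ((k.factorial : ℝ))⁻¹ *
    ∑ I : Fin k → Fin m, κ (α fun a => stdVec (I a)) (β fun a => recip b (I a))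

/-- The dual Lefschetz operator `Λ` on `2`-forms, that is, the adjoint of `f ↦ f σ`:
`Λ F = ½ ∑ g^{ik} g^{jl} σ_{kl} F_{ij}`. -/
def contraction (b : EuclideanSpace ℝ (Fin m) →L[ℝ] EuclideanSpace ℝ (Fin m) →L[ℝ] ℝ)
    (σ : EuclideanSpace ℝ (Fin m) [⋀^Fin 2]→L[ℝ] ℝ)
    (α : EuclideanSpace ℝ (Fin m) [⋀^Fin 2]→L[ℝ] F) : F :=
  (2 : ℝ)⁻¹ • ∑ i, ∑ j, σ ![recip b i, recip b j] • α ![stdVec i, stdVec j]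

/-- The product `φ σ` of a scalar-valued form `σ` with a vector `φ`. -/
def formSmul {V : Type*} [NormedAddCommGroup V] [NormedSpace ℝ V] {k : ℕ}
    (σ : V [⋀^Fin k]→L[ℝ] ℝ) (φ : F) : V [⋀^Fin k]→L[ℝ] F :=
  (ContinuousLinearMap.toSpanSingleton ℝ φ).compContinuousAlternatingMap σ

/-- The primitive part `F_p = F - Φ σ`, `Φ = (1/n) Λ F`, of a `2`-form in dimension `2n`.
It is the unique form with `F = F_p + Φ σ` and `Λ F_p = 0`; see
`eq_primitivePart_iff`. -/
def primitivePart {n : ℕ}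
    (b : EuclideanSpace ℝ (Fin (2 * n)) →L[ℝ] EuclideanSpace ℝ (Fin (2 * n)) →L[ℝ] ℝ)
    (σ : EuclideanSpace ℝ (Fin (2 * n)) [⋀^Fin 2]→L[ℝ] ℝ)
    (α : EuclideanSpace ℝ (Fin (2 * n)) [⋀^Fin 2]→L[ℝ] F) :
    EuclideanSpace ℝ (Fin (2 * n)) [⋀^Fin 2]→L[ℝ] F :=
  α - formSmul σ ((n : ℝ)⁻¹ • contraction b σ α)

/-- `σ ∧ β` for a `2`-form `σ`:
`(σ ∧ β)(v₀, …) = ½ ∑_{i ≠ j} ± σ(vᵢ, vⱼ) β(v without vᵢ, vⱼ)`. -/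
def wedgeTwo {V : Type*} [NormedAddCommGroup V] [NormedSpace ℝ V]
    (σ : V [⋀^Fin 2]→L[ℝ] ℝ) {l : ℕ} (β : V [⋀^Fin l]→L[ℝ] ℝ) : V [⋀^Fin (l + 2)]→L[ℝ] ℝ :=
  let σlin : V →L[ℝ] V →L[ℝ] ℝ :=
    ((ContinuousAlternatingMap.ofSubsingletonLIE (𝕜 := ℝ) (E := V) (F := ℝ)
      (0 : Fin 1)).symm.toContinuousLinearEquiv : (V [⋀^Fin 1]→L[ℝ] ℝ) →L[ℝ] (V →L[ℝ] ℝ)) ∘L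
      σ.curryLeft
  (2 : ℝ)⁻¹ • ContinuousAlternatingMap.alternatizeUncurryFin
    ((ContinuousAlternatingMap.alternatizeUncurryFinCLM ℝ V ℝ) ∘L
      ((ContinuousLinearMap.smulRightL ℝ V (V [⋀^Fin l]→L[ℝ] ℝ)).flip β) ∘L σlin)

/-- The Liouville form `σⁿ / n!`.  For a metric compatible with `σ` this is the Riemannian volume
form for the orientation given by `σ`. -/
def liouville {V : Type*} [NormedAddCommGroup V] [NormedSpace ℝ V]
    (σ : V [⋀^Fin 2]→L[ℝ] ℝ) : (n : ℕ) → V [⋀^Fin (2 * n)]→L[ℝ] ℝ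
  | 0 => ContinuousAlternatingMap.constOfIsEmpty ℝ V (Fin 0) 1
  | k + 1 => ((k : ℝ) + 1)⁻¹ • wedgeTwo σ (liouville σ k)

/-- Insertion of vectors into the first slots: `(v₀, …) ↦ β(u₀, …, u_{k-1}, v₀, …)`. -/
def insertVecs {V : Type*} [NormedAddCommGroup V] [NormedSpace ℝ V] {l : ℕ} :
    {k : ℕ} → (Fin k → V) → V [⋀^Fin (l + k)]→L[ℝ] ℝ → V [⋀^Fin l]→L[ℝ] ℝ
  | 0, _, β => β
  | _ + 1, u, β => insertVecs (Fin.tail u) (β.curryLeft (u 0))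

/-- Renaming of the index set `Fin m` of an `m`-form along an equality `m = m'`. -/
def castDegree {V : Type*} [NormedAddCommGroup V] [NormedSpace ℝ V] {m m' : ℕ} (h : m = m')
    (β : V [⋀^Fin m]→L[ℝ] ℝ) : V [⋀^Fin m']→L[ℝ] ℝ :=
  h ▸ β

/-- The Hodge star `Λᵏ → Λˡ`, `k + l = m`, for the inner product `b` and the volume form `vol`:
`(*α)(v) = (1/k!) ∑ g^{i₁j₁} ⋯ g^{iₖjₖ} α_{i₁…iₖ} vol(e_{j₁}, …, e_{jₖ}, v)`; it satisfies
`α ∧ *β = ⟨α, β⟩ vol`. -/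
def hodgeStar (b : EuclideanSpace ℝ (Fin m) →L[ℝ] EuclideanSpace ℝ (Fin m) →L[ℝ] ℝ)
    (vol : EuclideanSpace ℝ (Fin m) [⋀^Fin m]→L[ℝ] ℝ) {k l : ℕ} (h : m = l + k)
    (α : EuclideanSpace ℝ (Fin m) [⋀^Fin k]→L[ℝ] F) :
    EuclideanSpace ℝ (Fin m) [⋀^Fin l]→L[ℝ] F :=
  ((k.factorial : ℝ))⁻¹ • ∑ I : Fin k → Fin m,
    formSmul (insertVecs (fun a => recip b (I a)) (castDegree h vol))
      (α fun a => stdVec (I a))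

end Pointwise

/-! #### The Lefschetz decomposition of a `2`-form -/

section Lefschetz

variable {m : ℕ} {F : Type*} [NormedAddCommGroup F] [NormedSpace ℝ F]
  {b : EuclideanSpace ℝ (Fin m) →L[ℝ] EuclideanSpace ℝ (Fin m) →L[ℝ] ℝ}

theorem sum_stdVec (y : EuclideanSpace ℝ (Fin m)) : ∑ k, y k • stdVec k = y := by
  ext i
  simp [stdVec, Pi.single_apply]

theorem isUnit_det_gram (hpos : ∀ v, v ≠ 0 → 0 < b v v) : IsUnit (gram b).det := by
  rw [isUnit_iff_ne_zero]
  intro h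
  obtain ⟨v, hv, hv'⟩ := Matrix.exists_mulVec_eq_zero_iff.2 h
  have h1 : b (∑ i, v i • stdVec i) (∑ i, v i • stdVec i) = v ⬝ᵥ (gram b).mulVec v := by
    simp only [map_sum, map_smul, sum_apply, smul_apply,
      smul_eq_mul, dotProduct, Matrix.mulVec, gram, Matrix.of_apply, Finset.mul_sum]
    rw [Finset.sum_comm]
    exact Finset.sum_congr rfl fun x _ => Finset.sum_congr rfl fun y _ => by ring
  have h2 : (∑ i, v i • (stdVec i : EuclideanSpace ℝ (Fin m))) ≠ 0 := by
    intro h0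
    apply hv
    have := sum_stdVec (WithLp.toLp 2 v)
    simp only at this
    rw [h0] at this
    funext i
    exact (congrArg (fun w : EuclideanSpace ℝ (Fin m) => w i) this).symm
  have := hpos _ h2
  rw [h1, hv'] at this
  simp at this

theorem recip_pairing (hpos : ∀ v, v ≠ 0 → 0 < b v v) (i j : Fin m) :
    b (recip b i) (stdVec j) = if i = j then 1 else 0 := by
  have h : ((gram b)⁻¹ * gram b) i j = (1 : Matrix (Fin m) (Fin m) ℝ) i j := by
    rw [Matrix.nonsing_inv_mul _ (isUnit_det_gram hpos)]
  simpa [recip, Matrix.mul_apply, gram, Matrix.one_apply] using h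

theorem sum_recip (hsymm : ∀ u v, b u v = b v u) (hpos : ∀ v, v ≠ 0 → 0 < b v v)
    (y : EuclideanSpace ℝ (Fin m)) : ∑ i, b (stdVec i) y • recip b i = y := by
  have hinj : ∀ z : EuclideanSpace ℝ (Fin m), (∀ j, b z (stdVec j) = 0) → z = 0 := by
    intro z hz
    by_contra hne
    have := hpos z hne
    have h0 : b z z = 0 := by
      have : b z (∑ k, z k • stdVec k) = 0 := by simp [hz]
      rwa [sum_stdVec] at this
    linarith
  rw [← sub_eq_zero]
  apply hinj
  intro j
  simp [recip_pairing hpos, hsymm (stdVec j) y]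

/-- `Λ (φ σ) = n φ` for a compatible inner product in dimension `2n`. -/
theorem contraction_formSmul {n : ℕ}
    {b : EuclideanSpace ℝ (Fin (2 * n)) →L[ℝ] EuclideanSpace ℝ (Fin (2 * n)) →L[ℝ] ℝ}
    (hsymm : ∀ u v, b u v = b v u) (hpos : ∀ v, v ≠ 0 → 0 < b v v)
    {σ : EuclideanSpace ℝ (Fin (2 * n)) [⋀^Fin 2]→L[ℝ] ℝ}
    {J : EuclideanSpace ℝ (Fin (2 * n)) →L[ℝ] EuclideanSpace ℝ (Fin (2 * n))}
    (hJ : ∀ v, J (J v) = -v) (hb : ∀ u v, b u v = σ ![u, J v]) (φ : F) :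
    contraction b σ (formSmul σ φ) = (n : ℝ) • φ := by
  have hσ : ∀ u v, σ ![u, v] = -b u (J v) := by
    intro u v
    have h := hb u (J (J (J v)))
    rw [hJ (J (J v)), hJ (J v), hJ v] at h
    rw [neg_neg, map_neg] at h
    exact h.symm
  have hswap : ∀ u v, σ ![u, v] = -σ ![v, u] := by
    intro u v
    have h := σ.map_swap ![v, u] (i := 0) (j := 1) (by decide)
    have e : ![v, u] ∘ (Equiv.swap (0 : Fin 2) 1) = ![u, v] := by
      funext i
      fin_cases i <;> simp
    rw [e] at h
    exact h
  have key : ∀ a c, ∑ i, σ ![recip b i, a] * σ ![stdVec i, c] = b a c := by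
    intro a c
    calc ∑ i, σ ![recip b i, a] * σ ![stdVec i, c]
        = b (∑ i, b (stdVec i) (J c) • recip b i) (J a) := by simp [hσ, mul_comm]
      _ = b a c := by
        rw [sum_recip hsymm hpos, hb a c, hswap, hσ, neg_neg]
  have h : ∑ i, ∑ j, σ ![recip b i, recip b j] * σ ![stdVec i, stdVec j] = 2 * (n : ℝ) := by
    rw [Finset.sum_comm]
    simp [key, recip_pairing hpos]
  have h' : contraction b σ (formSmul σ φ)
      = ((2 : ℝ)⁻¹ * ∑ i, ∑ j, σ ![recip b i, recip b j] * σ ![stdVec i, stdVec j]) • φ := by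
    have e : ∀ v, formSmul σ φ v = σ v • φ := fun v => rfl
    simp only [contraction, e, smul_smul, ← Finset.sum_smul]
  rw [h', h]
  congr 1
  ring

theorem contraction_sub {σ : EuclideanSpace ℝ (Fin m) [⋀^Fin 2]→L[ℝ] ℝ}
    (α β : EuclideanSpace ℝ (Fin m) [⋀^Fin 2]→L[ℝ] F) :
    contraction b σ (α - β) = contraction b σ α - contraction b σ β := by
  simp [contraction, smul_sub]

/-- For a compatible inner product, `primitivePart` is the primitive component of the Lefschetz
decomposition `α = α_p + Φ σ`. -/
theorem eq_primitivePart_iff {n : ℕ} (hn : n ≠ 0)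
    {b : EuclideanSpace ℝ (Fin (2 * n)) →L[ℝ] EuclideanSpace ℝ (Fin (2 * n)) →L[ℝ] ℝ}
    (hsymm : ∀ u v, b u v = b v u) (hpos : ∀ v, v ≠ 0 → 0 < b v v)
    {σ : EuclideanSpace ℝ (Fin (2 * n)) [⋀^Fin 2]→L[ℝ] ℝ}
    {J : EuclideanSpace ℝ (Fin (2 * n)) →L[ℝ] EuclideanSpace ℝ (Fin (2 * n))}
    (hJ : ∀ v, J (J v) = -v) (hb : ∀ u v, b u v = σ ![u, J v])
    (α β : EuclideanSpace ℝ (Fin (2 * n)) [⋀^Fin 2]→L[ℝ] F) :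
    β = primitivePart b σ α ↔ contraction b σ β = 0 ∧ ∃ φ : F, α = β + formSmul σ φ := by
  have hn' : (n : ℝ) ≠ 0 := by exact_mod_cast hn
  constructor
  · rintro rfl
    refine ⟨?_, (n : ℝ)⁻¹ • contraction b σ α, by simp [primitivePart]⟩
    rw [primitivePart, contraction_sub, contraction_formSmul hsymm hpos hJ hb, smul_smul,
      mul_inv_cancel₀ hn', one_smul, sub_self]
  · rintro ⟨h0, φ, rfl⟩
    have h1 := contraction_sub (b := b) (σ := σ) (β + formSmul σ φ) (formSmul σ φ)
    rw [add_sub_cancel_right, h0, contraction_formSmul hsymm hpos hJ hb] at h1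
    rw [primitivePart, sub_eq_zero.1 h1.symm, smul_smul, inv_mul_cancel₀ hn', one_smul,
      add_sub_cancel_right]

end Lefschetz

/-! ### Differential forms on manifolds

A manifold modelled on `E` has, in Mathlib, `TangentSpace 𝓘(ℝ, E) x = E` by definition, where the
identification is the one given by the preferred chart at `x`.  A `k`-form with values in `F` is
therefore a function `x ↦ (alternating k-linear map on TangentSpace x)` of type
`M → E [⋀^Fin k]→L[ℝ] F`. -/

section Forms

variable {E : Type*} [NormedAddCommGroup E] [NormedSpace ℝ E]
  {M : Type*} [TopologicalSpace M] [ChartedSpace E M]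
  {E' : Type*} [NormedAddCommGroup E'] [NormedSpace ℝ E']
  {M' : Type*} [TopologicalSpace M'] [ChartedSpace E' M']
  {F : Type*} [NormedAddCommGroup F] [NormedSpace ℝ F]

/-- The tangent map `T_x M → T_{f x} M'`. -/
def tmap (E E' : Type*) [NormedAddCommGroup E] [NormedSpace ℝ E]
    [NormedAddCommGroup E'] [NormedSpace ℝ E']
    {M : Type*} [TopologicalSpace M] [ChartedSpace E M]
    {M' : Type*} [TopologicalSpace M'] [ChartedSpace E' M']
    (f : M → M') (x : M) : E →L[ℝ] E' :=
  mfderiv 𝓘(ℝ, E) 𝓘(ℝ, E') f x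

/-- The pull-back `f^* β`. -/
def pullback (E : Type*) [NormedAddCommGroup E] [NormedSpace ℝ E] [ChartedSpace E M]
    (f : M → M') {k : ℕ} (β : M' → E' [⋀^Fin k]→L[ℝ] F) : M → E [⋀^Fin k]→L[ℝ] F :=
  fun x => (β (f x)).compContinuousLinearMap (tmap E E' f x)

/-- The form `β` in the coordinates of the chart around `x₀`: the pull-back of `β` by the inverse
of that chart. -/
def chartRep {k : ℕ} (β : M → E [⋀^Fin k]→L[ℝ] F) (x₀ : M) : E → E [⋀^Fin k]→L[ℝ] F :=
  pullback E (extChartAt 𝓘(ℝ, E) x₀).symm β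

/-- Smoothness of a differential form. -/
def IsSmoothForm {k : ℕ} (β : M → E [⋀^Fin k]→L[ℝ] F) : Prop :=
  ∀ x₀ : M, ContDiffOn ℝ ∞ (chartRep β x₀) (extChartAt 𝓘(ℝ, E) x₀).target

/-- The exterior derivative, computed in the chart around each point. -/
def extD {k : ℕ} (β : M → E [⋀^Fin k]→L[ℝ] F) : M → E [⋀^Fin (k + 1)]→L[ℝ] F :=
  fun x => (extDeriv (chartRep β x) (extChartAt 𝓘(ℝ, E) x x)).compContinuousLinearMap
    (tmap E E (extChartAt 𝓘(ℝ, E) x) x)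

/-- A linear map viewed as a `1`-form, and back. -/
def toOneForm (a : E →L[ℝ] F) : E [⋀^Fin 1]→L[ℝ] F :=
  ContinuousAlternatingMap.ofSubsingleton ℝ E F (0 : Fin 1) a

/-- A `1`-form at a point viewed as a linear map. -/
def ofOneForm (a : E [⋀^Fin 1]→L[ℝ] F) : E →L[ℝ] F :=
  (ContinuousAlternatingMap.ofSubsingleton ℝ E F (0 : Fin 1)).symm a

end Forms

/-! ### Symplectic structure, compatible metric, Riemannian volume -/

section Symplectic

variable {m : ℕ} {M : Type*} [TopologicalSpace M] [ChartedSpace (EuclideanSpace ℝ (Fin m)) M]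

/-- A symplectic form: a smooth closed nondegenerate `2`-form. -/
structure IsSymplectic (σ : M → EuclideanSpace ℝ (Fin m) [⋀^Fin 2]→L[ℝ] ℝ) : Prop where
  smooth : IsSmoothForm σ
  closed : ∀ x, extD σ x = 0
  nondegenerate : ∀ x u, (∀ v, σ x ![u, v] = 0) → u = 0

/-- A smooth Riemannian metric on `M`. -/
abbrev RiemMetric (m : ℕ) (M : Type*) [TopologicalSpace M]
    [ChartedSpace (EuclideanSpace ℝ (Fin m)) M] [IsManifold (𝓡 m) ∞ M] : Type _ :=
  Bundle.ContMDiffRiemannianMetric (𝓡 m) ∞ (EuclideanSpace ℝ (Fin m))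
    (fun x : M => TangentSpace (𝓡 m) x)

variable [IsManifold (𝓡 m) ∞ M]

/-- The inner product `g_x` on `T_x M`. -/
def metricAt (g : RiemMetric m M) (x : M) :
    EuclideanSpace ℝ (Fin m) →L[ℝ] EuclideanSpace ℝ (Fin m) →L[ℝ] ℝ :=
  g.inner x

/-- Compatibility: `g(u, v) = σ(u, J v)` for an almost complex structure `J`. -/
def IsCompatible (g : RiemMetric m M) (σ : M → EuclideanSpace ℝ (Fin m) [⋀^Fin 2]→L[ℝ] ℝ) : Prop :=
  ∃ J : M → EuclideanSpace ℝ (Fin m) →L[ℝ] EuclideanSpace ℝ (Fin m),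
    (∀ x v, J x (J x v) = -v) ∧ ∀ x u v, metricAt g x u v = σ x ![u, J x v]

/-- The Riemannian volume of the domain of the chart around `x₀`: Lebesgue measure in the
coordinates with density `√det(g_{ij})`. -/
def chartVolume [MeasurableSpace M] (g : RiemMetric m M) (x₀ : M) : MeasureTheory.Measure M :=
  let φ := extChartAt (𝓡 m) x₀
  MeasureTheory.Measure.map φ.symm
    ((MeasureTheory.volume.restrict φ.target).withDensity fun y =>
      ENNReal.ofReal (Real.sqrt (gram
        ((metricAt g (φ.symm y)).bilinearComp
          (tmap (EuclideanSpace ℝ (Fin m)) (EuclideanSpace ℝ (Fin m)) φ.symm y)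
          (tmap (EuclideanSpace ℝ (Fin m)) (EuclideanSpace ℝ (Fin m)) φ.symm y))).det))

/-- A smooth partition of unity on `M` subordinate to the chart domains. -/
def chartPartition (m : ℕ) (M : Type*) [TopologicalSpace M]
    [ChartedSpace (EuclideanSpace ℝ (Fin m)) M] [IsManifold (𝓡 m) ∞ M] [T2Space M]
    [SigmaCompactSpace M] : SmoothPartitionOfUnity M (𝓡 m) M Set.univ :=
  (SmoothPartitionOfUnity.exists_isSubordinate_chartAt_source (𝓡 m) M).choose

/-- The Riemannian volume measure, glued from the chart volumes by a partition of unity `ρ`: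
`∫ f dvol = ∑ᵢ ∫ ρᵢ f dvolᵢ`. -/
def riemannianVolume [T2Space M] [SigmaCompactSpace M] [MeasurableSpace M] (g : RiemMetric m M) :
    MeasureTheory.Measure M :=
  MeasureTheory.Measure.sum fun x₀ : M =>
    (chartVolume g x₀).withDensity fun x => ENNReal.ofReal (chartPartition m M x₀ x)

end Symplectic

/-! ### Principal bundles and connections -/

section Bundle

variable {E : Type*} [NormedAddCommGroup E] [NormedSpace ℝ E]
  {M : Type*} [TopologicalSpace M] [ChartedSpace E M]
  {𝔤 : Type*} [NormedAddCommGroup 𝔤] [NormedSpace ℝ 𝔤]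
  {G : Type*} [TopologicalSpace G] [ChartedSpace 𝔤 G] [Group G]
  {EP : Type*} [NormedAddCommGroup EP] [NormedSpace ℝ EP]
  {P : Type*} [TopologicalSpace P] [ChartedSpace EP P] [MulAction Gᵐᵒᵖ P]

/-- The right action `R_g : p ↦ p · g` on the total space. -/
def rightMul (g : G) (p : P) : P := MulOpposite.op g • p

/-- `π : P → M` is a smooth principal `G`-bundle: `G` acts smoothly from the right on `P`, and `P`
is locally `G`-equivariantly diffeomorphic over `M` to `U × G`. -/
structure IsPrincipalBundle (E 𝔤 EP : Type*) [NormedAddCommGroup E] [NormedSpace ℝ E]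
    [NormedAddCommGroup 𝔤] [NormedSpace ℝ 𝔤] [NormedAddCommGroup EP] [NormedSpace ℝ EP]
    {M : Type*} [TopologicalSpace M] [ChartedSpace E M]
    (G : Type*) [TopologicalSpace G] [ChartedSpace 𝔤 G] [Group G]
    {P : Type*} [TopologicalSpace P] [ChartedSpace EP P] [MulAction Gᵐᵒᵖ P]
    (π : P → M) : Prop where
  smooth_proj : ContMDiff 𝓘(ℝ, EP) 𝓘(ℝ, E) ∞ π
  smooth_action : ContMDiff (𝓘(ℝ, EP).prod 𝓘(ℝ, 𝔤)) 𝓘(ℝ, EP) ∞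
    (fun q : P × G => rightMul q.2 q.1)
  proj_action : ∀ (p : P) (g : G), π (rightMul g p) = π p
  locally_trivial : ∀ x : M, ∃ U : Set M, IsOpen U ∧ x ∈ U ∧
    ∃ Φ : OpenPartialHomeomorph P (M × G),
      Φ.source = π ⁻¹' U ∧ Φ.target = U ×ˢ Set.univ ∧
      ContMDiffOn 𝓘(ℝ, EP) (𝓘(ℝ, E).prod 𝓘(ℝ, 𝔤)) ∞ Φ Φ.source ∧
      ContMDiffOn (𝓘(ℝ, E).prod 𝓘(ℝ, 𝔤)) 𝓘(ℝ, EP) ∞ Φ.symm Φ.target ∧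
      (∀ p ∈ Φ.source, (Φ p).1 = π p) ∧
      ∀ p ∈ Φ.source, ∀ g : G, Φ (rightMul g p) = ((Φ p).1, (Φ p).2 * g)

/-- The adjoint representation of `G` on its Lie algebra `T_1 G = 𝔤`. -/
def Ad (g : G) : 𝔤 →L[ℝ] 𝔤 := tmap 𝔤 𝔤 (fun h : G => g * h * g⁻¹) 1

/-- An `Ad`-invariant inner product on the Lie algebra of `G`. -/
structure IsAdInvariantInner (G : Type*) [TopologicalSpace G] [ChartedSpace 𝔤 G] [Group G]
    (κ : 𝔤 →L[ℝ] 𝔤 →L[ℝ] ℝ) : Prop where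
  symm : ∀ ξ ζ, κ ξ ζ = κ ζ ξ
  pos : ∀ ξ, ξ ≠ 0 → 0 < κ ξ ξ
  invariant : ∀ (g : G) (ξ ζ : 𝔤), κ (Ad g ξ) (Ad g ζ) = κ ξ ζ

/-- The value at `p` of the fundamental vector field of `ξ ∈ 𝔤`. -/
def fundamental (G : Type*) [TopologicalSpace G] [ChartedSpace 𝔤 G] [Group G]
    (EP : Type*) [NormedAddCommGroup EP] [NormedSpace ℝ EP] [ChartedSpace EP P]
    [MulAction Gᵐᵒᵖ P] (p : P) (ξ : 𝔤) : EP :=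
  tmap 𝔤 EP (fun g : G => rightMul g p) 1 ξ

/-- A connection: a smooth `𝔤`-valued `1`-form on `P` which is equivariant and reproduces the
generators of the fundamental vector fields. -/
structure IsConnection (G : Type*) [TopologicalSpace G] [ChartedSpace 𝔤 G] [Group G]
    [MulAction Gᵐᵒᵖ P] (A : P → EP →L[ℝ] 𝔤) : Prop where
  smooth : IsSmoothForm fun p => toOneForm (A p)
  equivariant : ∀ (g : G) (p : P) (v : EP),
    A (rightMul g p) (tmap EP EP (rightMul g) p v) = Ad g⁻¹ (A p v)
  reproduces : ∀ (p : P) (ξ : 𝔤), A p (fundamental G EP p ξ) = ξ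

/-- `Ω^k(M, Ad P)`: sections of `Λ^k T^*M ⊗ Ad P`, where `Ad P = P ×_G 𝔤`, are the maps `α` which
assign to `p ∈ P` an alternating map `α p` on `T_{π p} M` with values in `𝔤` such that
`α (p · g) = Ad(g⁻¹) ∘ α p`, and whose pull-back to `P` is smooth. -/
structure IsAdForm (G : Type*) [TopologicalSpace G] [ChartedSpace 𝔤 G] [Group G]
    [MulAction Gᵐᵒᵖ P] (π : P → M) {k : ℕ} (α : P → E [⋀^Fin k]→L[ℝ] 𝔤) : Prop where
  smooth : IsSmoothForm (fun p => (α p).compContinuousLinearMap (tmap EP E π p))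
  equivariant : ∀ (g : G) (p : P),
    α (rightMul g p) = (Ad g⁻¹ : 𝔤 →L[ℝ] 𝔤).compContinuousAlternatingMap (α p)

/-- The horizontal lift `T_{π p} M → T_p P`: the `v` with `dπ v = u` and `A v = 0`. -/
def horizontalLift (π : P → M) (A : P → EP →L[ℝ] 𝔤) (p : P) : E →L[ℝ] EP :=
  ((tmap EP E π p).prod (A p)).inverse ∘L ContinuousLinearMap.inl ℝ E 𝔤

/-- The exterior covariant derivative `d_A : Ω^k(M, Ad P) → Ω^{k+1}(M, Ad P)`: the exterior
derivative on `P` evaluated on horizontal lifts. -/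
def covD (π : P → M) (A : P → EP →L[ℝ] 𝔤) {k : ℕ} (α : P → E [⋀^Fin k]→L[ℝ] 𝔤) :
    P → E [⋀^Fin (k + 1)]→L[ℝ] 𝔤 :=
  fun p => (extD (fun q => (α q).compContinuousLinearMap (tmap EP E π q)) p).compContinuousLinearMap
    (horizontalLift π A p)

/-- The curvature `F(A) ∈ Ω²(M, Ad P)`: the exterior derivative `dA` on `P` evaluated on horizontal
lifts. -/
def curvature (π : P → M) (A : P → EP →L[ℝ] 𝔤) : P → E [⋀^Fin 2]→L[ℝ] 𝔤 :=
  fun p => (extD (fun q => toOneForm (A q)) p).compContinuousLinearMap (horizontalLift π A p)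

/-- The connection `A + t η`, `η ∈ Ω¹(M, Ad P)`. -/
def vary (π : P → M) (A : P → EP →L[ℝ] 𝔤) (η : P → E [⋀^Fin 1]→L[ℝ] 𝔤) (t : ℝ) :
    P → EP →L[ℝ] 𝔤 :=
  fun p => A p + t • (ofOneForm (η p) ∘L tmap EP E π p)

open Classical in
/-- A function on `P` which is constant on the fibres, as a function on `M`. -/
def descend (π : P → M) (f : P → ℝ) (x : M) : ℝ :=
  if h : ∃ p, π p = x then f h.choose else 0

end Bundle

/-! ### The primitive Yang–Mills functional -/

section Functional

variable {n : ℕ}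
  {M : Type*} [TopologicalSpace M] [ChartedSpace (EuclideanSpace ℝ (Fin (2 * n))) M]
  [IsManifold (𝓡 (2 * n)) ∞ M]
  {𝔤 : Type*} [NormedAddCommGroup 𝔤] [NormedSpace ℝ 𝔤]
  {EP : Type*} [NormedAddCommGroup EP] [NormedSpace ℝ EP]
  {P : Type*} [TopologicalSpace P] [ChartedSpace EP P]

/-- The primitive part `F_p(A)` of the curvature. -/
def primitiveCurvature (σ : M → EuclideanSpace ℝ (Fin (2 * n)) [⋀^Fin 2]→L[ℝ] ℝ)
    (g : RiemMetric (2 * n) M) (π : P → M) (A : P → EP →L[ℝ] 𝔤) :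
    P → EuclideanSpace ℝ (Fin (2 * n)) [⋀^Fin 2]→L[ℝ] 𝔤 :=
  fun p => primitivePart (metricAt g (π p)) (σ (π p)) (curvature π A p)

/-- The `L²` inner product over `K ⊆ M` of forms with values in `Ad P`. -/
def l2Inner [T2Space M] [SigmaCompactSpace M] [MeasurableSpace M]
    (g : RiemMetric (2 * n) M) (κ : 𝔤 →L[ℝ] 𝔤 →L[ℝ] ℝ) (π : P → M) (K : Set M) {k : ℕ}
    (α β : P → EuclideanSpace ℝ (Fin (2 * n)) [⋀^Fin k]→L[ℝ] 𝔤) : ℝ :=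
  ∫ x in K, descend π (fun p => formInner (metricAt g (π p)) κ (α p) (β p)) x
    ∂(riemannianVolume g)

/-- The primitive Yang–Mills functional `‖F_p(A)‖²` over `K ⊆ M`. -/
def primitiveYangMills [T2Space M] [SigmaCompactSpace M] [MeasurableSpace M]
    (σ : M → EuclideanSpace ℝ (Fin (2 * n)) [⋀^Fin 2]→L[ℝ] ℝ)
    (g : RiemMetric (2 * n) M) (κ : 𝔤 →L[ℝ] 𝔤 →L[ℝ] ℝ) (π : P → M) (K : Set M)
    (A : P → EP →L[ℝ] 𝔤) : ℝ :=
  l2Inner g κ π K (primitiveCurvature σ g π A) (primitiveCurvature σ g π A)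

/-- `A` is a critical point of the primitive Yang–Mills functional: for every variation `η`
supported in a compact set `K`, the derivative at `t = 0` of the functional of `A + t η` over `K`
is zero.  For compact `M` one can take `K = M`; on a noncompact `M` the integral over `M` can be
infinite, and restricting to `K` drops a part of it which does not depend on `t`. -/
def IsPrimitiveYangMills [T2Space M] [SigmaCompactSpace M] [MeasurableSpace M]
    (G : Type*) [TopologicalSpace G] [ChartedSpace 𝔤 G] [Group G] [MulAction Gᵐᵒᵖ P]
    (σ : M → EuclideanSpace ℝ (Fin (2 * n)) [⋀^Fin 2]→L[ℝ] ℝ)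
    (g : RiemMetric (2 * n) M) (κ : 𝔤 →L[ℝ] 𝔤 →L[ℝ] ℝ) (π : P → M) (A : P → EP →L[ℝ] 𝔤) : Prop :=
  ∀ (η : P → EuclideanSpace ℝ (Fin (2 * n)) [⋀^Fin 1]→L[ℝ] 𝔤) (K : Set M),
    IsAdForm (EP := EP) G π η → IsCompact K → (∀ p, π p ∉ K → η p = 0) →
    HasDerivAt (fun t : ℝ => primitiveYangMills σ g κ π K (vary π A η t)) 0 0

/-- The Hodge star `Ω^k(M, Ad P) → Ω^l(M, Ad P)`, `k + l = 2n`, of `g` and the orientation given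
by `σ`. -/
def starAd (σ : M → EuclideanSpace ℝ (Fin (2 * n)) [⋀^Fin 2]→L[ℝ] ℝ)
    (g : RiemMetric (2 * n) M) (π : P → M) {k l : ℕ} (h : 2 * n = l + k)
    (α : P → EuclideanSpace ℝ (Fin (2 * n)) [⋀^Fin k]→L[ℝ] 𝔤) :
    P → EuclideanSpace ℝ (Fin (2 * n)) [⋀^Fin l]→L[ℝ] 𝔤 :=
  fun p => hodgeStar (metricAt g (π p)) (liouville (σ (π p)) n) h (α p)

/-- `- * d_A * α` for a `2`-form `α`. -/
def negStarDStar (hn : 2 ≤ n) (σ : M → EuclideanSpace ℝ (Fin (2 * n)) [⋀^Fin 2]→L[ℝ] ℝ)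
    (g : RiemMetric (2 * n) M) (π : P → M) (A : P → EP →L[ℝ] 𝔤)
    (α : P → EuclideanSpace ℝ (Fin (2 * n)) [⋀^Fin 2]→L[ℝ] 𝔤) :
    P → EuclideanSpace ℝ (Fin (2 * n)) [⋀^Fin 1]→L[ℝ] 𝔤 :=
  -starAd σ g π (k := 2 * n - 2 + 1) (l := 1) (by omega)
    (covD π A (starAd σ g π (k := 2) (l := 2 * n - 2) (by omega) α))

/-- `β = d_A^* α`, where `d_A^*` is the formal `L²` adjoint of `d_A`: `β ∈ Ω^k(M, Ad P)` and
`⟨d_A η, α⟩ = ⟨η, β⟩` for all `η ∈ Ω^k(M, Ad P)` with compact support. -/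
def IsAdjointDerivative [T2Space M] [SigmaCompactSpace M] [MeasurableSpace M]
    (G : Type*) [TopologicalSpace G] [ChartedSpace 𝔤 G] [Group G] [MulAction Gᵐᵒᵖ P]
    (g : RiemMetric (2 * n) M) (κ : 𝔤 →L[ℝ] 𝔤 →L[ℝ] ℝ) (π : P → M) (A : P → EP →L[ℝ] 𝔤) {k : ℕ}
    (α : P → EuclideanSpace ℝ (Fin (2 * n)) [⋀^Fin (k + 1)]→L[ℝ] 𝔤)
    (β : P → EuclideanSpace ℝ (Fin (2 * n)) [⋀^Fin k]→L[ℝ] 𝔤) : Prop :=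
  IsAdForm (EP := EP) G π β ∧
  ∀ (η : P → EuclideanSpace ℝ (Fin (2 * n)) [⋀^Fin k]→L[ℝ] 𝔤) (K : Set M),
    IsAdForm (EP := EP) G π η → IsCompact K → (∀ p, π p ∉ K → η p = 0) →
    l2Inner g κ π Set.univ (covD π A η) α = l2Inner g κ π Set.univ η β

end Functional

end PrimitiveYM

end

open PrimitiveYM

/-!
Forms with values in `Ad P` are equivariant families on `P`, and the connection provides the
horizontal lift, which turns them into forms on `P` and back; smoothness is tested in charts by
means of it (`smoothFormAt_lift_iff`).

Integration by parts rests on the divergence identity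
`d κ(η ∧ *α) = (⟨d_A η, α⟩ - ⟨η, -*d_A*α⟩) vol` for a `1`-form `η` and a `2`-form `α`
with values in `Ad P` (`extD_greenForm`). The left side is the exterior derivative of an honest
form on `M`, because `κ(η ∧ *α)` is invariant on `P`
(`extD_descendForm`). The Leibniz rule (`extD_wedgeOne`) splits it into `κ(d_A η ∧ *α)` and
`κ(η ∧ d_A*α)`; the first is `⟨d_A η, α⟩ vol` (`wedgePair_hodgeStar`), and the second is
`-⟨η, *d_A*α⟩ vol`, as the dimension is even (`wedgeOne_eq_hodgeStar`). For a compatible metric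
`ωⁿ / n!` is the Riemannian volume form (`isVolumeForm_liouville`), as one sees in a unitary frame.

If `η` has compact support, then Stokes' theorem (`integral_topRatio_extD`) makes the integral of
the left side vanish. It is reduced by a partition of unity to a form in one chart, where the
Riemannian volume is given by the density `√det(g_{ij})` (`restrict_riemannianVolume`). Hence
`⟨d_A η, α⟩ = ⟨η, -*d_A*α⟩` (`l2Inner_covD`), which for `α = F_p` is the first claim.

For the second claim, the curvature of `A + t η` is a polynomial in `t` with linear term `d_A η`
(`exists_curvature_vary`). Since the Lefschetz decomposition is orthogonal
(`formInner_primitivePart`), the first variation of `‖F_p‖²` is `2 ⟨d_A η, F_p⟩`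
(`hasDerivAt_primitiveYangMills`), that is, `2 ⟨η, -*d_A*F_p⟩`. It vanishes for all `η` with
compact support if and only if `-*d_A*F_p = 0` (`eq_zero_of_forall_l2Inner_eq_zero`).
-/

set_option linter.unusedSectionVars false

noncomputable section

namespace PrimitiveYM

/-! ### Dual frames and inner products -/

section Frames
variable {V : Type*} [NormedAddCommGroup V] [NormedSpace ℝ V]

/-- `u` and `w` are dual frames for `b`: every `y` is `∑ b(uᵢ, y) wᵢ`. If there are as many vectors
as the dimension, the case `u = w` is that of an orthonormal basis. -/
def IsFrame {ι : Type*} [Fintype ι] (b : V →L[ℝ] V →L[ℝ] ℝ) (u w : ι → V) : Prop :=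
  ∀ y, ∑ i, b (u i) y • w i = y

/-- `b` is an inner product: symmetric and positive definite. -/
structure IsInner (b : V →L[ℝ] V →L[ℝ] ℝ) : Prop where
  symm : ∀ u v, b u v = b v u
  pos : ∀ v, v ≠ 0 → 0 < b v v

theorem IsInner.ext {b : V →L[ℝ] V →L[ℝ] ℝ} (hb : IsInner b) {x y : V}
    (h : ∀ z, b x z = b y z) : x = y := by
  rw [← sub_eq_zero]
  by_contra hne
  have := hb.pos _ hne
  simp [h] at this

/-- The pull-back of a bilinear form by a linear map. -/
abbrev pullInner {V' : Type*} [NormedAddCommGroup V'] [NormedSpace ℝ V']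
    (b : V →L[ℝ] V →L[ℝ] ℝ) (L : V' →L[ℝ] V) : V' →L[ℝ] V' →L[ℝ] ℝ :=
  b.bilinearComp L L

variable {ι ι' : Type*} [Fintype ι] [Fintype ι'] {b : V →L[ℝ] V →L[ℝ] ℝ}

theorem IsFrame.swap (hb : IsInner b) {u w : ι → V} (h : IsFrame b u w) : IsFrame b w u := by
  intro y
  apply hb.ext
  intro z
  have := congrArg (fun t => b y t) (h z)
  simp only [map_sum, map_smul, smul_eq_mul] at this
  rw [← this]
  simp only [map_sum, map_smul, FunLike.coe_sum, Finset.sum_apply, FunLike.coe_smul,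
    Pi.smul_apply, smul_eq_mul]
  exact Finset.sum_congr rfl fun i _ => by rw [hb.symm (w i) y]; ring

/-- The tensor `∑ uᵢ ⊗ wᵢ` of a pair of dual frames does not depend on the frames. -/
theorem IsFrame.sum_multilinear_eq (hb : IsInner b) {u w : ι → V} {u' w' : ι' → V}
    (h : IsFrame b u w) (h' : IsFrame b u' w') {k : ℕ}
    {F F' H : Type*} [AddCommGroup F] [Module ℝ F] [AddCommGroup F'] [Module ℝ F']
    [AddCommGroup H] [Module ℝ H]
    (B : F →ₗ[ℝ] F' →ₗ[ℝ] H) (α : MultilinearMap ℝ (fun _ : Fin k => V) F)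
    (β : MultilinearMap ℝ (fun _ : Fin k => V) F') :
    ∑ I : Fin k → ι, B (α fun a => u (I a)) (β fun a => w (I a)) =
      ∑ I : Fin k → ι', B (α fun a => u' (I a)) (β fun a => w' (I a)) := by
  classical
  have hβ : ∀ J : Fin k → ι', β (fun a => w' (J a)) =
      ∑ I : Fin k → ι, (∏ a, b (w' (J a)) (u (I a))) • β fun a => w (I a) := by
    intro J
    have : (fun a => w' (J a)) = fun a => ∑ i, b (w' (J a)) (u i) • w i := by
      funext a
      simp only [hb.symm (w' (J a))]
      exact (h _).symm
    rw [this, β.map_sum]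
    exact Finset.sum_congr rfl fun I _ => β.map_smul_univ _ _
  have hα : ∀ I : Fin k → ι, α (fun a => u (I a)) =
      ∑ J : Fin k → ι', (∏ a, b (w' (J a)) (u (I a))) • α fun a => u' (J a) := by
    intro J
    have : (fun a => u (J a)) = fun a => ∑ i, b (w' i) (u (J a)) • u' i := by
      funext a
      exact ((h'.swap hb) _).symm
    rw [this, α.map_sum]
    exact Finset.sum_congr rfl fun I _ => α.map_smul_univ _ _
  simp only [hβ, hα, map_sum, map_smul, LinearMap.sum_apply, LinearMap.smul_apply]
  rw [Finset.sum_comm]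

theorem IsFrame.map (L : V ≃L[ℝ] V) {u w : ι → V}
    (h : IsFrame (pullInner b (L : V →L[ℝ] V)) u w) :
    IsFrame b (fun i => L (u i)) (fun i => L (w i)) := by
  intro y
  have := congrArg L (h (L.symm y))
  simpa using this

theorem IsInner.comp {V' : Type*} [NormedAddCommGroup V'] [NormedSpace ℝ V']
    (hb : IsInner b) (L : V' ≃L[ℝ] V) :
    IsInner (pullInner b (L : V' →L[ℝ] V)) where
  symm u v := by simpa using hb.symm _ _
  pos v hv := by simpa using hb.pos (L v) (by simpa using hv)

end Frames

/-! ### The pointwise operations in terms of frames -/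

section Std
variable {m : ℕ} {F : Type*} [NormedAddCommGroup F] [NormedSpace ℝ F]
  {b : EuclideanSpace ℝ (Fin m) →L[ℝ] EuclideanSpace ℝ (Fin m) →L[ℝ] ℝ}

local notation "𝔼" => EuclideanSpace ℝ (Fin m)

theorem isFrame_recip (hb : IsInner b) : IsFrame b stdVec (recip b) :=
  sum_recip hb.symm hb.pos

theorem castDegree_apply {V : Type*} [NormedAddCommGroup V] [NormedSpace ℝ V] {m m' : ℕ}
    (h : m = m') (β : V [⋀^Fin m]→L[ℝ] ℝ) (v : Fin m' → V) :
    castDegree h β v = β (fun i => v (Fin.cast h i)) := by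
  subst h; rfl

theorem insertVecs_apply {V : Type*} [NormedAddCommGroup V] [NormedSpace ℝ V] {l : ℕ} :
    ∀ {k : ℕ} (u : Fin k → V) (β : V [⋀^Fin (l + k)]→L[ℝ] ℝ) (v : Fin l → V),
      insertVecs u β v = β (fun i => Fin.append u v (Fin.cast (Nat.add_comm l k) i))
  | 0, u, β, v => by
    rw [insertVecs]
    congr 1
    funext i
    rw [Fin.append_left_nil u v rfl]
    simp
  | k + 1, u, β, v => by
    rw [insertVecs, insertVecs_apply (Fin.tail u), ContinuousAlternatingMap.curryLeft_apply_apply]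
    congr 1
    funext i
    conv_rhs => rw [← Fin.cons_self_tail u, Fin.append_cons]
    refine Fin.cases ?_ (fun j => ?_) i
    · simp [Fin.cast]
    · simp only [Matrix.cons_val_succ, Function.comp_apply]
      exact (Fin.cons_succ (α := fun _ => V) _ _ _).symm

/-- `u ↦ β(u, v)` as a multilinear map. -/
def insertMultilinear {V : Type*} [NormedAddCommGroup V] [NormedSpace ℝ V] {l k : ℕ}
    (β : V [⋀^Fin (l + k)]→L[ℝ] ℝ) (v : Fin l → V) : MultilinearMap ℝ (fun _ : Fin k => V) ℝ where
  toFun u := MultilinearMap.currySum (MultilinearMap.domDomCongr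
    ((finCongr (Nat.add_comm l k)).trans finSumFinEquiv.symm) β.toMultilinearMap) u v
  map_update_add' u i x y := by rw [MultilinearMap.map_update_add]; rfl
  map_update_smul' u i c x := by rw [MultilinearMap.map_update_smul]; rfl

theorem insertMultilinear_apply {V : Type*} [NormedAddCommGroup V] [NormedSpace ℝ V] {l k : ℕ}
    (β : V [⋀^Fin (l + k)]→L[ℝ] ℝ) (v : Fin l → V) (u : Fin k → V) :
    insertMultilinear β v u = insertVecs u β v := by
  rw [insertVecs_apply]
  change β _ = β _
  congr 1
  funext i
  simp only [Equiv.trans_apply, finCongr_apply]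
  generalize Fin.cast (Nat.add_comm l k) i = j
  refine Fin.addCases (fun j => ?_) (fun j => ?_) j <;> simp

theorem formSmul_apply {V : Type*} [NormedAddCommGroup V] [NormedSpace ℝ V] {k : ℕ}
    (σ : V [⋀^Fin k]→L[ℝ] ℝ) (φ : F) (v : Fin k → V) : formSmul σ φ v = σ v • φ := rfl

/-- The inner product of forms can be computed in any pair of dual frames. -/
theorem formInner_eq_frame (hb : IsInner b) {ι : Type*} [Fintype ι] {u w : ι → 𝔼}
    (h : IsFrame b u w) (κ : F →L[ℝ] F →L[ℝ] ℝ) {k : ℕ} (α β : 𝔼 [⋀^Fin k]→L[ℝ] F) :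
    formInner b κ α β = ((k.factorial : ℝ))⁻¹ *
      ∑ I : Fin k → ι, κ (α fun a => u (I a)) (β fun a => w (I a)) := by
  rw [formInner]
  congr 1
  exact (isFrame_recip hb).sum_multilinear_eq hb h
    ((ContinuousLinearMap.coeLM ℝ) ∘ₗ (κ : F →ₗ[ℝ] F →L[ℝ] ℝ)) α.toMultilinearMap
    β.toMultilinearMap

/-- The Hodge star can be computed in any pair of dual frames. -/
theorem hodgeStar_eq_frame (hb : IsInner b) {ι : Type*} [Fintype ι] {u w : ι → 𝔼}
    (h : IsFrame b u w) (vol : 𝔼 [⋀^Fin m]→L[ℝ] ℝ) {k l : ℕ} (hm : m = l + k)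
    (α : 𝔼 [⋀^Fin k]→L[ℝ] F) (v : Fin l → 𝔼) :
    hodgeStar b vol hm α v = ((k.factorial : ℝ))⁻¹ •
      ∑ I : Fin k → ι, insertVecs (fun a => w (I a)) (castDegree hm vol) v •
        (α fun a => u (I a)) := by
  rw [hodgeStar, ContinuousAlternatingMap.smul_apply, ContinuousAlternatingMap.sum_apply]
  congr 1
  have := (isFrame_recip hb).sum_multilinear_eq hb h (LinearMap.lsmul ℝ F).flip
    α.toMultilinearMap (insertMultilinear (castDegree hm vol) v)
  simp only [insertMultilinear_apply] at this
  exact this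

/-- The contraction with `σ` can be computed in any pair of dual frames. -/
theorem contraction_eq_frame (hb : IsInner b) {ι : Type*} [Fintype ι] {u w : ι → 𝔼}
    (h : IsFrame b u w) (σ : 𝔼 [⋀^Fin 2]→L[ℝ] ℝ) (α : 𝔼 [⋀^Fin 2]→L[ℝ] F) :
    contraction b σ α = (2 : ℝ)⁻¹ • ∑ I : Fin 2 → ι,
      σ (fun a => w (I a)) • α (fun a => u (I a)) := by
  rw [contraction]
  congr 1
  have := (isFrame_recip hb).sum_multilinear_eq hb h (LinearMap.lsmul ℝ F).flip
    α.toMultilinearMap σ.toMultilinearMap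
  refine Eq.trans ?_ this
  rw [← (finTwoArrowEquiv (Fin m)).symm.sum_comp, Fintype.sum_prod_type]
  refine Finset.sum_congr rfl fun i _ => Finset.sum_congr rfl fun j _ => ?_
  change _ = σ _ • α _
  congr 2 <;> funext a <;> fin_cases a <;> rfl

theorem formInner_comp (L : 𝔼 ≃L[ℝ] 𝔼) (hb : IsInner b) (κ : F →L[ℝ] F →L[ℝ] ℝ) {k : ℕ}
    (α β : 𝔼 [⋀^Fin k]→L[ℝ] F) :
    formInner (pullInner b (L : 𝔼 →L[ℝ] 𝔼)) κ
      (α.compContinuousLinearMap (L : 𝔼 →L[ℝ] 𝔼)) (β.compContinuousLinearMap (L : 𝔼 →L[ℝ] 𝔼)) =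
      formInner b κ α β := by
  rw [formInner_eq_frame hb ((isFrame_recip (hb.comp L)).map L), formInner]
  rfl

theorem hodgeStar_comp (L : 𝔼 ≃L[ℝ] 𝔼) (hb : IsInner b) (vol : 𝔼 [⋀^Fin m]→L[ℝ] ℝ)
    {k l : ℕ} (hm : m = l + k) (α : 𝔼 [⋀^Fin k]→L[ℝ] F) :
    hodgeStar (pullInner b (L : 𝔼 →L[ℝ] 𝔼))
      (vol.compContinuousLinearMap (L : 𝔼 →L[ℝ] 𝔼)) hm (α.compContinuousLinearMap (L : 𝔼 →L[ℝ] 𝔼)) =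
    (hodgeStar b vol hm α).compContinuousLinearMap (L : 𝔼 →L[ℝ] 𝔼) := by
  ext v
  rw [ContinuousAlternatingMap.compContinuousLinearMap_apply,
    hodgeStar_eq_frame hb ((isFrame_recip (hb.comp L)).map L),
    hodgeStar_eq_frame (hb.comp L) (isFrame_recip (hb.comp L))]
  congr 1
  refine Finset.sum_congr rfl fun I _ => ?_
  congr 1
  simp only [insertVecs_apply, castDegree_apply,
    ContinuousAlternatingMap.compContinuousLinearMap_apply]
  congr 1
  funext i
  simp only [Function.comp_apply]
  generalize Fin.cast _ (Fin.cast _ i) = j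
  refine Fin.addCases (fun j => ?_) (fun j => ?_) j <;> simp

theorem contraction_comp (L : 𝔼 ≃L[ℝ] 𝔼) (hb : IsInner b) (σ : 𝔼 [⋀^Fin 2]→L[ℝ] ℝ)
    (α : 𝔼 [⋀^Fin 2]→L[ℝ] F) :
    contraction (pullInner b (L : 𝔼 →L[ℝ] 𝔼))
      (σ.compContinuousLinearMap (L : 𝔼 →L[ℝ] 𝔼)) (α.compContinuousLinearMap (L : 𝔼 →L[ℝ] 𝔼)) =
      contraction b σ α := by
  rw [contraction_eq_frame hb ((isFrame_recip (hb.comp L)).map L),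
    contraction_eq_frame (hb.comp L) (isFrame_recip (hb.comp L))]
  rfl

theorem wedgeTwo_apply {V : Type*} [NormedAddCommGroup V] [NormedSpace ℝ V]
    (σ : V [⋀^Fin 2]→L[ℝ] ℝ) {l : ℕ} (β : V [⋀^Fin l]→L[ℝ] ℝ) (v : Fin (l + 2) → V) :
    wedgeTwo σ β v = (2 : ℝ)⁻¹ * ∑ i : Fin (l + 2), (-1) ^ (i : ℕ) *
      ∑ j : Fin (l + 1), (-1) ^ (j : ℕ) * (σ ![v i, i.removeNth v j] *
        β (j.removeNth (i.removeNth v))) := by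
  rw [wedgeTwo, ContinuousAlternatingMap.smul_apply, smul_eq_mul,
    ContinuousAlternatingMap.alternatizeUncurryFin_apply]
  congr 1
  refine Finset.sum_congr rfl fun i _ => ?_
  rw [zsmul_eq_mul]
  push_cast
  congr 1
  refine (ContinuousAlternatingMap.alternatizeUncurryFin_apply _ _).trans ?_
  refine Finset.sum_congr rfl fun j _ => ?_
  rw [zsmul_eq_mul]
  push_cast
  congr 1
  change σ _ * _ = _
  congr 2
  funext a
  fin_cases a <;> rfl

theorem wedgeTwo_comp {V V' : Type*} [NormedAddCommGroup V] [NormedSpace ℝ V]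
    [NormedAddCommGroup V'] [NormedSpace ℝ V']
    (σ : V [⋀^Fin 2]→L[ℝ] ℝ) {l : ℕ} (β : V [⋀^Fin l]→L[ℝ] ℝ) (L : V' →L[ℝ] V) :
    wedgeTwo (σ.compContinuousLinearMap L) (β.compContinuousLinearMap L) =
      (wedgeTwo σ β).compContinuousLinearMap L := by
  ext v
  simp only [wedgeTwo_apply, ContinuousAlternatingMap.compContinuousLinearMap_apply]
  congr 1
  refine Finset.sum_congr rfl fun i _ => ?_
  congr 1
  refine Finset.sum_congr rfl fun j _ => ?_
  congr 3
  funext a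
  fin_cases a <;> rfl

theorem liouville_comp {V V' : Type*} [NormedAddCommGroup V] [NormedSpace ℝ V]
    [NormedAddCommGroup V'] [NormedSpace ℝ V']
    (σ : V [⋀^Fin 2]→L[ℝ] ℝ) (L : V' →L[ℝ] V) (n : ℕ) :
    liouville (σ.compContinuousLinearMap L) n = (liouville σ n).compContinuousLinearMap L := by
  induction n with
  | zero => rfl
  | succ k ih => rw [liouville, ih, wedgeTwo_comp]; rfl

theorem primitivePart_comp {n : ℕ}
    {b : EuclideanSpace ℝ (Fin (2 * n)) →L[ℝ] EuclideanSpace ℝ (Fin (2 * n)) →L[ℝ] ℝ}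
    (hb : IsInner b) (σ : EuclideanSpace ℝ (Fin (2 * n)) [⋀^Fin 2]→L[ℝ] ℝ)
    (α : EuclideanSpace ℝ (Fin (2 * n)) [⋀^Fin 2]→L[ℝ] F)
    (L : EuclideanSpace ℝ (Fin (2 * n)) ≃L[ℝ] EuclideanSpace ℝ (Fin (2 * n))) :
    primitivePart (pullInner b L.toContinuousLinearMap)
      (σ.compContinuousLinearMap L.toContinuousLinearMap)
      (α.compContinuousLinearMap L.toContinuousLinearMap) =
    (primitivePart b σ α).compContinuousLinearMap L.toContinuousLinearMap := by
  rw [primitivePart, contraction_comp L hb]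
  rfl

end Std

/-! ### Wedge products and forms of top degree -/

section Wedge
variable {V : Type*} [NormedAddCommGroup V] [NormedSpace ℝ V]
  {F : Type*} [NormedAddCommGroup F] [NormedSpace ℝ F]

open ContinuousAlternatingMap (alternatizeUncurryFin alternatizeUncurryFinCLM
  alternatizeUncurryFin_apply ofSubsingletonLIE
  alternatizeUncurryFin_alternatizeUncurryFinCLM_comp_of_symmetric
  curryLeft_apply_apply toAlternatingMap_injective)

/-- A `2`-form as a bilinear map. -/
def lin2 (ν : V [⋀^Fin 2]→L[ℝ] F) : V →L[ℝ] V →L[ℝ] F :=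
  ((ofSubsingletonLIE (𝕜 := ℝ) (E := V) (F := F) (0 : Fin 1)).symm.toContinuousLinearEquiv :
    (V [⋀^Fin 1]→L[ℝ] F) →L[ℝ] (V →L[ℝ] F)) ∘L ν.curryLeft

theorem lin2_apply (ν : V [⋀^Fin 2]→L[ℝ] F) (x y : V) : lin2 ν x y = ν ![x, y] := by
  change ν _ = _
  congr 1
  funext i
  fin_cases i <;> rfl

theorem twoForm_swap (ν : V [⋀^Fin 2]→L[ℝ] F) (x y : V) : ν ![x, y] = -ν ![y, x] := by
  have h : ν _ = -ν _ := ν.toAlternatingMap.map_swap ![y, x] (i := 0) (j := 1) (by decide)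
  rw [← h]
  congr 1
  funext i
  fin_cases i <;> simp

/-- The linear map `ξ ↦ (β ↦ κ(ξ, β))`. -/
def pairForm (κ : F →L[ℝ] F →L[ℝ] ℝ) (l : ℕ) :
    F →L[ℝ] (V [⋀^Fin l]→L[ℝ] F) →L[ℝ] (V [⋀^Fin l]→L[ℝ] ℝ) :=
  (ContinuousLinearMap.compContinuousAlternatingMapCLM ℝ V F ℝ (Fin l)) ∘L κ

/-- `κ(a ∧ β)` for a `1`-form `a`. -/
def wedgeOne (κ : F →L[ℝ] F →L[ℝ] ℝ) {l : ℕ} (a : V →L[ℝ] F) (β : V [⋀^Fin l]→L[ℝ] F) :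
    V [⋀^Fin (l + 1)]→L[ℝ] ℝ :=
  alternatizeUncurryFin ((pairForm κ l).flip β ∘L a)

theorem wedgeOne_apply (κ : F →L[ℝ] F →L[ℝ] ℝ) {l : ℕ} (a : V →L[ℝ] F) (β : V [⋀^Fin l]→L[ℝ] F)
    (v : Fin (l + 1) → V) :
    wedgeOne κ a β v = ∑ i : Fin (l + 1), (-1) ^ (i : ℕ) * κ (a (v i)) (β (i.removeNth v)) := by
  rw [wedgeOne, alternatizeUncurryFin_apply]
  refine Finset.sum_congr rfl fun i _ => ?_
  rw [zsmul_eq_mul]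
  push_cast
  rfl

/-- Alternatization of a bilinear map with values in `l`-forms. -/
def alt2 {l : ℕ} (f : V →L[ℝ] V →L[ℝ] V [⋀^Fin l]→L[ℝ] ℝ) : V [⋀^Fin (l + 2)]→L[ℝ] ℝ :=
  alternatizeUncurryFin (alternatizeUncurryFinCLM ℝ V ℝ ∘L f)

theorem alt2_apply {l : ℕ} (f : V →L[ℝ] V →L[ℝ] V [⋀^Fin l]→L[ℝ] ℝ) (v : Fin (l + 2) → V) :
    alt2 f v = ∑ i : Fin (l + 2), (-1) ^ (i : ℕ) * ∑ j : Fin (l + 1), (-1) ^ (j : ℕ) *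
      f (v i) (i.removeNth v j) (j.removeNth (i.removeNth v)) := by
  rw [alt2, alternatizeUncurryFin_apply]
  refine Finset.sum_congr rfl fun i _ => ?_
  rw [zsmul_eq_mul]
  push_cast
  congr 1
  refine (alternatizeUncurryFin_apply _ _).trans ?_
  refine Finset.sum_congr rfl fun j _ => ?_
  rw [zsmul_eq_mul]
  push_cast
  rfl

set_option maxSynthPendingDepth 6 in
theorem alt2_add {l : ℕ} (f g : V →L[ℝ] V →L[ℝ] V [⋀^Fin l]→L[ℝ] ℝ) :
    alt2 (f + g) = alt2 f + alt2 g := by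
  ext v
  simp [alt2_apply, mul_add, Finset.sum_add_distrib]

set_option maxSynthPendingDepth 6 in
/-- The alternatization of a bilinear map which is symmetric is zero, hence the alternatization
changes its sign under exchange of the two arguments. -/
theorem alt2_flip {l : ℕ} (f : V →L[ℝ] V →L[ℝ] V [⋀^Fin l]→L[ℝ] ℝ) :
    alt2 f.flip = -alt2 f := by
  have h : alt2 (f + f.flip) = 0 :=
    alternatizeUncurryFin_alternatizeUncurryFinCLM_comp_of_symmetric fun x y => by
      simp [add_comm]
  rw [alt2_add] at h
  exact eq_neg_of_add_eq_zero_right h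

/-- `κ(ν ∧ β)` for a `2`-form `ν`. -/
def wedgePair (κ : F →L[ℝ] F →L[ℝ] ℝ) {l : ℕ} (ν : V [⋀^Fin 2]→L[ℝ] F)
    (β : V [⋀^Fin l]→L[ℝ] F) : V [⋀^Fin (l + 2)]→L[ℝ] ℝ :=
  (2 : ℝ)⁻¹ • alt2 (((pairForm κ l).flip β).postcomp V ∘L lin2 ν)

theorem wedgePair_apply (κ : F →L[ℝ] F →L[ℝ] ℝ) {l : ℕ} (ν : V [⋀^Fin 2]→L[ℝ] F)
    (β : V [⋀^Fin l]→L[ℝ] F) (v : Fin (l + 2) → V) :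
    wedgePair κ ν β v = (2 : ℝ)⁻¹ * ∑ i : Fin (l + 2), (-1) ^ (i : ℕ) *
      ∑ j : Fin (l + 1), (-1) ^ (j : ℕ) *
        κ (ν ![v i, i.removeNth v j]) (β (j.removeNth (i.removeNth v))) := by
  rw [wedgePair, ContinuousAlternatingMap.smul_apply, smul_eq_mul, alt2_apply]
  simp only [← lin2_apply]
  rfl

theorem eq_zero_of_finrank_lt [FiniteDimensional ℝ V] {k : ℕ} (f : V [⋀^Fin k]→L[ℝ] F)
    (h : Module.finrank ℝ V < k) : f = 0 := by
  ext v
  refine f.toAlternatingMap.map_linearDependent v fun hv => ?_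
  have := hv.fintype_card_le_finrank
  simp at this
  omega

theorem removeNth_succ_cons {V : Type*} {l : ℕ} (x : V) (v : Fin (l + 1) → V) (a : Fin (l + 1)) :
    (Fin.succ a).removeNth (Fin.cons x v : Fin (l + 2) → V) =
      (Fin.cons x (a.removeNth v) : Fin (l + 1) → V) := by
  funext t
  refine Fin.cases ?_ (fun t => ?_) t
  · simp [Fin.removeNth]
  · simp [Fin.removeNth]

/-- The contraction of `φ ∧ γ` with `x`. -/
theorem wedge_real_cons {l : ℕ} (φ : V →L[ℝ] ℝ) (γ : V [⋀^Fin (l + 1)]→L[ℝ] ℝ) (x : V)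
    (v : Fin (l + 1) → V) :
    alternatizeUncurryFin (φ.smulRight γ) (Fin.cons x v : Fin (l + 2) → V) =
      φ x * γ v - ∑ a : Fin (l + 1), (-1) ^ (a : ℕ) *
        (φ (v a) * γ (Fin.cons x (a.removeNth v) : Fin (l + 1) → V)) := by
  rw [alternatizeUncurryFin_apply, Fin.sum_univ_succ, sub_eq_add_neg, ← Finset.sum_neg_distrib]
  congr 1
  · simp
  · refine Finset.sum_congr rfl fun a _ => ?_
    rw [removeNth_succ_cons, zsmul_eq_mul]
    simp [pow_succ]

/-- The identity `φ ∧ ι_x W = φ(x) W` for a form `W` of top degree: contract `φ ∧ W`, which is zero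
for reasons of degree, with `x`. -/
theorem sum_wedge_top [FiniteDimensional ℝ V] {l : ℕ} (hV : Module.finrank ℝ V = l + 1)
    (W : V [⋀^Fin (l + 1)]→L[ℝ] ℝ) (φ : V →L[ℝ] ℝ) (x : V) (v : Fin (l + 1) → V) :
    ∑ a : Fin (l + 1), (-1) ^ (a : ℕ) *
      (φ (v a) * W (Fin.cons x (a.removeNth v) : Fin (l + 1) → V)) = φ x * W v := by
  have h := wedge_real_cons φ W x v
  rw [eq_zero_of_finrank_lt (alternatizeUncurryFin (φ.smulRight W)) (by omega)] at h
  simp only [ContinuousAlternatingMap.coe_zero, Pi.zero_apply] at h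
  linarith

/-- The identity `B ∧ ι_y ι_x W = (B(x, y) - B(y, x)) W` for a form `W` of top degree and a bilinear
form `B`, antisymmetrized without a factor `1/2`. -/
theorem sum_sum_wedge_top [FiniteDimensional ℝ V] {l : ℕ} (hV : Module.finrank ℝ V = l + 2)
    (W : V [⋀^Fin (l + 2)]→L[ℝ] ℝ) (B : V →L[ℝ] V →L[ℝ] ℝ) (x y : V) (v : Fin (l + 2) → V) :
    ∑ i : Fin (l + 2), (-1) ^ (i : ℕ) * ∑ j : Fin (l + 1), (-1) ^ (j : ℕ) *
      (B (v i) (i.removeNth v j) *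
        W (Fin.cons x (Fin.cons y (j.removeNth (i.removeNth v)) : Fin (l + 1) → V))) =
      (B x y - B y x) * W v := by
  -- the wedge product of a covector with `W(x, ·)` is again of top degree
  have h1 : ∀ ψ : V →L[ℝ] ℝ, alternatizeUncurryFin (ψ.smulRight (W.curryLeft x)) = ψ x • W := by
    intro ψ
    ext u
    rw [alternatizeUncurryFin_apply, ContinuousAlternatingMap.smul_apply, smul_eq_mul,
      ← sum_wedge_top hV W ψ x u]
    refine Finset.sum_congr rfl fun a _ => ?_
    rw [zsmul_eq_mul]
    push_cast
    rfl
  have h2 : ∀ i : Fin (l + 2), ∑ j : Fin (l + 1), (-1) ^ (j : ℕ) *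
      (B (v i) (i.removeNth v j) *
        W (Fin.cons x (Fin.cons y (j.removeNth (i.removeNth v)) : Fin (l + 1) → V))) =
      B (v i) y * W (Fin.cons x (i.removeNth v)) - B (v i) x * W (Fin.cons y (i.removeNth v)) := by
    intro i
    have h := wedge_real_cons (B (v i)) (W.curryLeft x) y (i.removeNth v)
    rw [h1] at h
    have e : (B (v i) x • W) (Fin.cons y (i.removeNth v)) =
      B (v i) x * W (Fin.cons y (i.removeNth v)) := rfl
    rw [e] at h
    have e2 : ∀ t : Fin (l + 1) → V, W.curryLeft x t = W (Fin.cons x t) := fun t => rfl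
    simp only [e2] at h
    linarith
  simp only [h2, mul_sub, Finset.sum_sub_distrib]
  have h3 := sum_wedge_top hV W (B.flip y) x v
  have h4 := sum_wedge_top hV W (B.flip x) y v
  simp only [ContinuousLinearMap.flip_apply] at h3 h4
  rw [h3, h4]
  ring

end Wedge

/-! ### Wedge products with the Hodge star -/

section HodgeWedge
variable {m : ℕ} {F : Type*} [NormedAddCommGroup F] [NormedSpace ℝ F]
  {b : EuclideanSpace ℝ (Fin m) →L[ℝ] EuclideanSpace ℝ (Fin m) →L[ℝ] ℝ}

local notation "𝔼" => EuclideanSpace ℝ (Fin m)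

open ContinuousAlternatingMap (alternatizeUncurryFin alternatizeUncurryFinCLM
  alternatizeUncurryFin_apply ofSubsingletonLIE
  alternatizeUncurryFin_alternatizeUncurryFinCLM_comp_of_symmetric
  curryLeft_apply_apply toAlternatingMap_injective)

/-- `κ(ν ∧ *α) = ⟨α, ν⟩ vol` for `2`-forms. -/
theorem wedgePair_hodgeStar {l : ℕ} (hm : m = l + 2) (κ : F →L[ℝ] F →L[ℝ] ℝ)
    (hκ : ∀ ξ ζ, κ ξ ζ = κ ζ ξ)
    (vol : 𝔼 [⋀^Fin m]→L[ℝ] ℝ) (ν α : 𝔼 [⋀^Fin 2]→L[ℝ] F) :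
    wedgePair κ ν (hodgeStar b vol hm α) = formInner b κ α ν • castDegree hm vol := by
  have hV : Module.finrank ℝ 𝔼 = l + 2 := by simp [hm]
  ext v
  rw [wedgePair_apply, ContinuousAlternatingMap.smul_apply, smul_eq_mul]
  have h1 : ∀ (ξ : F) (t : Fin l → 𝔼), κ ξ (hodgeStar b vol hm α t) =
      (2 : ℝ)⁻¹ * ∑ I : Fin 2 → Fin m, κ ξ (α fun a => stdVec (I a)) *
        castDegree hm vol (Fin.cons (recip b (I 0)) (Fin.cons (recip b (I 1)) t :
          Fin (l + 1) → 𝔼)) := by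
    intro ξ t
    rw [hodgeStar, ContinuousAlternatingMap.smul_apply, ContinuousAlternatingMap.sum_apply,
      map_smul, map_sum, smul_eq_mul]
    congr 1
    refine Finset.sum_congr rfl fun I _ => ?_
    rw [formSmul_apply, map_smul, smul_eq_mul, mul_comm]
    rfl
  simp only [h1]
  have h2 : ∀ I : Fin 2 → Fin m, ∑ i : Fin (l + 2), (-1) ^ (i : ℕ) *
      ∑ j : Fin (l + 1), (-1) ^ (j : ℕ) *
        (κ (ν ![v i, i.removeNth v j]) (α fun a => stdVec (I a)) *
          castDegree hm vol (Fin.cons (recip b (I 0)) (Fin.cons (recip b (I 1))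
            (j.removeNth (i.removeNth v)) : Fin (l + 1) → 𝔼))) =
      2 * κ (α fun a => stdVec (I a)) (ν fun a => recip b (I a)) * castDegree hm vol v := by
    intro I
    have h := sum_sum_wedge_top hV (castDegree hm vol)
      ((κ.flip (α fun a => stdVec (I a))).postcomp 𝔼 ∘L lin2 ν) (recip b (I 0)) (recip b (I 1)) v
    have e : ∀ x y : 𝔼, ((κ.flip (α fun a => stdVec (I a))).postcomp 𝔼 ∘L lin2 ν) x y =
        κ (ν ![x, y]) (α fun a => stdVec (I a)) := by
      intro x y
      rw [← lin2_apply]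
      rfl
    simp only [e] at h
    rw [h]
    have e1 : ![recip b (I 0), recip b (I 1)] = fun a => recip b (I a) := by
      funext a
      fin_cases a <;> rfl
    rw [twoForm_swap ν (recip b (I 1)), e1, map_neg, _root_.neg_apply, hκ (ν _)]
    ring
  calc _ = (2 : ℝ)⁻¹ * ((2 : ℝ)⁻¹ * ∑ I : Fin 2 → Fin m, ∑ i : Fin (l + 2), (-1) ^ (i : ℕ) *
      ∑ j : Fin (l + 1), (-1) ^ (j : ℕ) *
        (κ (ν ![v i, i.removeNth v j]) (α fun a => stdVec (I a)) *
          castDegree hm vol (Fin.cons (recip b (I 0)) (Fin.cons (recip b (I 1))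
            (j.removeNth (i.removeNth v)) : Fin (l + 1) → 𝔼)))) := by
        congr 1
        rw [Finset.mul_sum]
        simp only [Finset.mul_sum]
        rw [Finset.sum_comm]
        rw [Finset.sum_comm]
        conv_rhs => rw [Finset.sum_comm]
        refine Finset.sum_congr rfl fun i _ => ?_
        conv_rhs => rw [Finset.sum_comm]
        refine Finset.sum_congr rfl fun j _ => Finset.sum_congr rfl fun I _ => ?_
        ring
    _ = _ := by
        simp only [h2]
        rw [formInner, ← Finset.sum_mul]
        simp only [mul_assoc, ← Finset.mul_sum]
        simp [Nat.factorial]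

/-- Two forms of top degree which agree on a frame are equal. -/
theorem ext_frame {l : ℕ} (hl : m = l)
    {v w : Fin l → 𝔼} (hv : IsFrame b v w) {f g : 𝔼 [⋀^Fin l]→L[ℝ] ℝ}
    (h : f w = g w) : f = g := by
  have hspan : ⊤ ≤ Submodule.span ℝ (Set.range w) := by
    intro y _
    rw [← hv y]
    exact Submodule.sum_mem _ fun i _ => Submodule.smul_mem _ _ (Submodule.subset_span ⟨i, rfl⟩)
  have hlin : LinearIndependent ℝ w := linearIndependent_of_top_le_span_of_card_eq_finrank hspan
    (by simp [hl])
  let B := Module.Basis.mk hlin hspan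
  have : f.toAlternatingMap = g.toAlternatingMap := by
    rw [f.toAlternatingMap.eq_smul_basis_det B, g.toAlternatingMap.eq_smul_basis_det B]
    have hB : (B : Fin l → 𝔼) = w := Module.Basis.coe_mk _ _
    rw [hB]
    congr 1
  exact toAlternatingMap_injective this

/-- The value of the Hodge star of an `l`-form in dimension `l + 1` on a vector of an orthonormal
frame. -/
theorem hodgeStar_frame (hb : IsInner b) {l : ℕ} (hm : m = 1 + l) {v : Fin (l + 1) → 𝔼}
    (hv : IsFrame b v v) (vol : 𝔼 [⋀^Fin m]→L[ℝ] ℝ) (γ : 𝔼 [⋀^Fin l]→L[ℝ] F) (j : Fin (l + 1)) :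
    hodgeStar b vol hm γ ![v j] = ((-1) ^ l * ((-1) ^ (j : ℕ) *
      castDegree (hm.trans (Nat.add_comm 1 l)) vol v)) • γ (j.removeNth v) := by
  classical
  set W := castDegree (hm.trans (Nat.add_comm 1 l)) vol with hW
  have h0 : ∀ u : Fin l → 𝔼, insertVecs u (castDegree hm vol) ![v j] =
      (-1) ^ l * W.curryLeft (v j) u := by
    intro u
    have h := W.map_insertNth (Fin.last l) (v j) u
    rw [zsmul_eq_mul] at h
    push_cast at h
    rw [curryLeft_apply_apply]
    have h' : (-1 : ℝ) ^ l * W (Matrix.vecCons (v j) u) = W ((Fin.last l).insertNth (v j) u) := by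
      rw [h]
    rw [h', insertVecs_apply, hW, castDegree_apply, castDegree_apply]
    congr 1
    funext i
    rw [Fin.insertNth_last']
    exact congrFun (Fin.append_right_eq_snoc u ![v j]) _
  have h1 : W.curryLeft (v j) (j.removeNth v) = (-1) ^ (j : ℕ) * W v := by
    have h := W.neg_one_pow_smul_map_insertNth j (v j) (j.removeNth v)
    rw [Fin.insertNth_self_removeNth, zsmul_eq_mul] at h
    push_cast at h
    exact h.symm
  rw [hodgeStar_eq_frame hb hv]
  simp only [h0, mul_smul, ← Finset.smul_sum]
  have key : ∑ I : Fin l → Fin (l + 1),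
      W.curryLeft (v j) (fun a => v (I a)) • γ (fun a => v (I a)) =
      (l.factorial : ℝ) • (W.curryLeft (v j) (j.removeNth v) • γ (j.removeNth v)) := by
    have hs : ∑ τ : Equiv.Perm (Fin l),
        W.curryLeft (v j) (fun a => v (j.succAbove (τ a))) • γ (fun a => v (j.succAbove (τ a))) =
        ∑ I : Fin l → Fin (l + 1),
          W.curryLeft (v j) (fun a => v (I a)) • γ (fun a => v (I a)) := by
      refine Finset.sum_of_injOn (fun τ a => j.succAbove (τ a)) ?_ (by simp) ?_ (by simp)
      · intro τ _ τ' _ h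
        ext a
        have := congrFun h a
        simpa using congrArg Fin.val (Fin.succAbove_right_injective this)
      · intro I _ hI
        by_cases hinj : Function.Injective I
        · by_cases hj : ∃ a, I a = j
          · obtain ⟨a, ha⟩ := hj
            have : W.curryLeft (v j) (fun a => v (I a)) = 0 := by
              rw [curryLeft_apply_apply]
              refine W.map_eq_zero_of_eq _ (i := 0) (j := a.succ) ?_ (Fin.succ_ne_zero a).symm
              simp [ha]
            rw [this, zero_smul]
          · exfalso
            push Not at hj
            choose t ht using fun a => Fin.exists_succAbove_eq (hj a)
            have htinj : Function.Injective t := fun a a' h => hinj (by rw [← ht, ← ht, h])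
            apply hI
            refine ⟨Equiv.ofBijective t (Finite.injective_iff_bijective.1 htinj), by simp, ?_⟩
            funext a
            exact ht a
        · have : γ (fun a => v (I a)) = 0 := by
            refine γ.map_eq_zero_of_not_injective _ fun h => hinj ?_
            intro a a' haa
            exact h (by simp [haa])
          rw [this, smul_zero]
    rw [← hs]
    have : ∀ τ : Equiv.Perm (Fin l),
        W.curryLeft (v j) (fun a => v (j.succAbove (τ a))) • γ (fun a => v (j.succAbove (τ a))) =
        W.curryLeft (v j) (j.removeNth v) • γ (j.removeNth v) := by
      intro τ
      have e1 : W.curryLeft (v j) _ = _ • W.curryLeft (v j) _ :=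
        (W.curryLeft (v j)).toAlternatingMap.map_perm (j.removeNth v) τ
      have e2 : γ _ = _ • γ _ := γ.toAlternatingMap.map_perm (j.removeNth v) τ
      have e3 : (j.removeNth v ∘ τ) = fun a => v (j.succAbove (τ a)) := rfl
      rw [e3] at e1 e2
      rw [e1, e2]
      rcases Int.units_eq_one_or (Equiv.Perm.sign τ) with h | h <;> simp [h]
    simp only [this]
    simp [Fintype.card_perm, Nat.cast_smul_eq_nsmul]
  rw [key, h1]
  simp only [smul_smul]
  congr 1
  have : (l.factorial : ℝ) ≠ 0 := by positivity
  field_simp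

/-- `κ(a ∧ γ) = -⟨a, *γ⟩ vol` for a `1`-form `a` and a form `γ` of complementary degree, in even
dimensions. -/
theorem wedgeOne_eq_hodgeStar (hb : IsInner b) {l : ℕ} (hm : m = 1 + l) (hl : Odd l)
    {v : Fin (l + 1) → 𝔼} (hv : IsFrame b v v) (vol : 𝔼 [⋀^Fin m]→L[ℝ] ℝ)
    (hvol : castDegree (hm.trans (Nat.add_comm 1 l)) vol v ^ 2 = 1)
    (κ : F →L[ℝ] F →L[ℝ] ℝ) (a : 𝔼 [⋀^Fin 1]→L[ℝ] F) (γ : 𝔼 [⋀^Fin l]→L[ℝ] F) :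
    wedgeOne κ (ofOneForm a) γ =
      (-formInner b κ a (hodgeStar b vol hm γ)) •
        castDegree (hm.trans (Nat.add_comm 1 l)) vol := by
  refine ext_frame (hm.trans (Nat.add_comm 1 l)) hv ?_
  rw [ContinuousAlternatingMap.smul_apply, smul_eq_mul, wedgeOne_apply, formInner_eq_frame hb hv]
  have e : ∀ I : Fin 1 → Fin (l + 1), (fun t => v (I t)) = ![v (I 0)] := by
    intro I
    funext t
    fin_cases t
    rfl
  simp only [e, hodgeStar_frame hb hm hv]
  have hsum : ∀ f : (Fin 1 → Fin (l + 1)) → ℝ, ∑ I, f I = ∑ i, f fun _ => i := fun f =>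
    ((Equiv.funUnique (Fin 1) (Fin (l + 1))).symm.sum_comp f).symm
  rw [hsum]
  simp only [map_smul, smul_eq_mul, hl.neg_one_pow]
  rw [Nat.factorial_one, Nat.cast_one, inv_one, one_mul, ← Finset.sum_neg_distrib,
    Finset.sum_mul]
  refine Finset.sum_congr rfl fun i _ => ?_
  have e1 : ofOneForm a (v i) = a ![v i] := by
    change a _ = _
    congr 1
    funext t
    fin_cases t
    rfl
  rw [e1]
  linear_combination (-(-1) ^ (i : ℕ) * κ (a ![v i]) (γ (i.removeNth v))) * hvol

end HodgeWedge

/-! ### The Liouville form -/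

section Liouville
variable {V : Type*} [NormedAddCommGroup V] [NormedSpace ℝ V]

/-- The sequence `a₀, c₀, a₁, c₁, …`. -/
def interleave {k : ℕ} (a c : Fin k → V) (i : Fin (2 * k)) : V :=
  if (i : ℕ) % 2 = 0 then a ⟨i / 2, by omega⟩ else c ⟨i / 2, by omega⟩

/-- `σᵏ / k!` takes the value `εᵏ` on a sequence of `k` pairs with `σ(aᵢ, cⱼ) = ε δᵢⱼ`. -/
theorem liouville_interleave (σ : V [⋀^Fin 2]→L[ℝ] ℝ) (ε : ℝ) :
    ∀ {k : ℕ} (a c : Fin k → V), (∀ i j, σ ![a i, a j] = 0) → (∀ i j, σ ![c i, c j] = 0) →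
      (∀ i j, σ ![a i, c j] = if i = j then ε else 0) →
      liouville σ k (interleave a c) = ε ^ k
  | 0, a, c, _, _, _ => by simp [liouville]
  | k + 1, a, c, haa, hcc, hac => by
    have hca : ∀ i j, σ ![c i, a j] = if i = j then -ε else 0 := by
      intro i j
      rw [twoForm_swap, hac]
      by_cases h : i = j <;> simp [h, eq_comm]
    set v : Fin (2 * k + 2) → V := interleave a c with hv
    -- every index has exactly one partner, and removing a pair leaves a sequence of pairs
    have key : ∀ i : Fin (2 * k + 2), (-1 : ℝ) ^ (i : ℕ) * ∑ j : Fin (2 * k + 1),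
        (-1) ^ (j : ℕ) * (σ ![v i, i.removeNth v j] *
          liouville σ k (j.removeNth (i.removeNth v))) = ε ^ (k + 1) := by
      intro i
      set r : Fin (k + 1) := ⟨i / 2, by omega⟩ with hr
      set j₀ : Fin (2 * k + 1) := ⟨2 * (i / 2), by omega⟩ with hj₀
      have hval : ∀ j : Fin (2 * k + 1), ((i.succAbove j : Fin (2 * k + 2)) : ℕ) =
          if (j : ℕ) < i then (j : ℕ) else j + 1 := by
        intro j
        simp only [Fin.succAbove, Fin.lt_def, Fin.val_castSucc]
        split_ifs <;> simp
      have hrest : j₀.removeNth (i.removeNth v) =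
          interleave (a ∘ r.succAbove) (c ∘ r.succAbove) := by
        funext t
        have ht : ((i.succAbove (j₀.succAbove t) : Fin (2 * k + 2)) : ℕ) =
            if (t : ℕ) < 2 * (i / 2) then (t : ℕ) else t + 2 := by
          have h1 : ((j₀.succAbove t : Fin (2 * k + 1)) : ℕ) =
              if (t : ℕ) < 2 * (i / 2) then (t : ℕ) else t + 1 := by
            simp only [Fin.succAbove, Fin.lt_def, Fin.val_castSucc, hj₀]
            split_ifs <;> simp
          rw [hval, h1]
          split_ifs <;> omega
        have hr' : ∀ (s : Fin k), ((r.succAbove s : Fin (k + 1)) : ℕ) =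
            if (s : ℕ) < i / 2 then (s : ℕ) else s + 1 := by
          intro s
          simp only [Fin.succAbove, Fin.lt_def, Fin.val_castSucc, hr]
          split_ifs <;> simp
        simp only [Fin.removeNth, hv, interleave, Function.comp_apply]
        have hpar : ((i.succAbove (j₀.succAbove t) : Fin (2 * k + 2)) : ℕ) % 2 = (t : ℕ) % 2 := by
          rw [ht]
          split_ifs <;> omega
        rw [hpar]
        have hidx : ∀ h h', (⟨((i.succAbove (j₀.succAbove t) : Fin (2 * k + 2)) : ℕ) / 2, h⟩ :
            Fin (k + 1)) = r.succAbove ⟨(t : ℕ) / 2, h'⟩ := by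
          intro h h'
          apply Fin.ext
          simp only [hr', ht]
          split_ifs <;> omega
        rw [hidx _ (by omega)]
      have hσ : ∀ j : Fin (2 * k + 1), σ ![v i, i.removeNth v j] =
          if j = j₀ then (if (i : ℕ) % 2 = 0 then ε else -ε) else 0 := by
        intro j
        have hjv := hval j
        simp only [Fin.removeNth, hv, interleave]
        have hjj : (j = j₀) ↔ (j : ℕ) = 2 * (i / 2) := by rw [Fin.ext_iff]
        by_cases hi : (i : ℕ) % 2 = 0
        · by_cases hj : ((i.succAbove j : Fin (2 * k + 2)) : ℕ) % 2 = 0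
          · simp only [hi, hj, if_true, haa]
            rw [if_neg]
            rw [hjj]
            intro h
            rw [hjv] at hj
            split_ifs at hj <;> omega
          · simp only [hi, hj, if_true, if_false, hac, Fin.mk.injEq, hjj]
            congr 1
            rw [eq_iff_iff]
            rw [hjv] at hj ⊢
            split_ifs at hj ⊢ <;> omega
        · by_cases hj : ((i.succAbove j : Fin (2 * k + 2)) : ℕ) % 2 = 0
          · simp only [hi, hj, if_true, if_false, hca, Fin.mk.injEq, hjj]
            congr 1
            rw [eq_iff_iff]
            rw [hjv] at hj ⊢
            split_ifs at hj ⊢ <;> omega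
          · simp only [hi, hj, if_false, hcc]
            rw [if_neg]
            rw [hjj]
            intro h
            rw [hjv] at hj
            split_ifs at hj <;> omega
      have ih := liouville_interleave σ ε (a ∘ r.succAbove) (c ∘ r.succAbove)
        (fun _ _ => haa _ _) (fun _ _ => hcc _ _) (fun s t => by
          rw [Function.comp_apply, Function.comp_apply, hac]
          simp)
      rw [Finset.sum_eq_single j₀ (fun j _ hj => by rw [hσ, if_neg hj]; simp) (by simp), hσ,
        if_pos rfl, hrest, ih]
      have hj2 : (-1 : ℝ) ^ (j₀ : ℕ) = 1 := by
        simp only [hj₀, pow_mul]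
        norm_num
      rw [hj2]
      by_cases hi : (i : ℕ) % 2 = 0
      · rw [if_pos hi, (Nat.even_iff.2 hi).neg_one_pow]
        ring
      · rw [if_neg hi, (Nat.odd_iff.2 (by omega)).neg_one_pow]
        ring
    have h1 : liouville σ (k + 1) (interleave a c) =
        ((k : ℝ) + 1)⁻¹ * wedgeTwo σ (liouville σ k) v := rfl
    rw [h1, wedgeTwo_apply]
    simp only [key]
    simp only [Finset.sum_const, Finset.card_univ, Fintype.card_fin, nsmul_eq_mul]
    push_cast
    have : (k : ℝ) + 1 ≠ 0 := by positivity
    field_simp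
end Liouville

/-! ### Unitary frames of a compatible metric -/

section Unitary
variable {V : Type*} [NormedAddCommGroup V] [NormedSpace ℝ V]

/-- `b` is compatible with `σ`: `b(u, v) = σ(u, J v)` for a complex structure `J`. -/
structure IsUnitaryTriple (b : V →L[ℝ] V →L[ℝ] ℝ) (σ : V [⋀^Fin 2]→L[ℝ] ℝ) (J : V →L[ℝ] V) :
    Prop where
  inner : IsInner b
  sq : ∀ v, J (J v) = -v
  compat : ∀ u v, b u v = σ ![u, J v]

variable {b : V →L[ℝ] V →L[ℝ] ℝ} {σ : V [⋀^Fin 2]→L[ℝ] ℝ} {J : V →L[ℝ] V}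

namespace IsUnitaryTriple

theorem sigma_eq (h : IsUnitaryTriple b σ J) (u v : V) : σ ![u, v] = -b u (J v) := by
  rw [h.compat, h.sq]
  have e : ∀ w, σ ![u, w] = lin2 σ u w := fun w => (lin2_apply _ _ _).symm
  rw [e, e, map_neg, neg_neg]

theorem isometry (h : IsUnitaryTriple b σ J) (u v : V) : b (J u) (J v) = b u v := by
  have h1 := h.sigma_eq (J u) v
  rw [twoForm_swap, ← h.compat, h.inner.symm v u] at h1
  linarith

theorem skew (h : IsUnitaryTriple b σ J) (u v : V) : b (J u) v = -b u (J v) := by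
  have := h.isometry u (J v)
  rw [h.sq, map_neg] at this
  linarith

theorem apply_self (h : IsUnitaryTriple b σ J) (u : V) : b u (J u) = 0 := by
  have h1 := h.skew u u
  rw [h.inner.symm] at h1
  linarith

/-- Vectors which are orthonormal for the Hermitian form of `b` and `J`, constructed one by one:
there is a further vector orthogonal to the complex span of the given ones as long as the dimension
allows it. -/
theorem exists_unitary [FiniteDimensional ℝ V] (h : IsUnitaryTriple b σ J) :
    ∀ k : ℕ, 2 * k ≤ Module.finrank ℝ V → ∃ a : Fin k → V,
      (∀ i j, b (a i) (a j) = if i = j then 1 else 0) ∧ ∀ i j, b (a i) (J (a j)) = 0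
  | 0, _ => ⟨fun i => i.elim0, fun i => i.elim0, fun i => i.elim0⟩
  | k + 1, hk => by
    obtain ⟨a, h1, h2⟩ := exists_unitary h k (by omega)
    -- a vector orthogonal to all `aᵢ` and `J aᵢ`
    let T : V →ₗ[ℝ] (Fin k ⊕ Fin k → ℝ) := LinearMap.pi (Sum.elim
      (fun i => (b (a i) : V →ₗ[ℝ] ℝ)) (fun i => (b (J (a i)) : V →ₗ[ℝ] ℝ)))
    have hT : LinearMap.ker T ≠ ⊥ := by
      apply LinearMap.ker_ne_bot_of_finrank_lt
      simp
      omega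
    obtain ⟨w, hw, hw0⟩ := (Submodule.ne_bot_iff _).1 hT
    have hwa : ∀ i, b (a i) w = 0 := fun i => congrFun (LinearMap.mem_ker.1 hw) (Sum.inl i)
    have hwJ : ∀ i, b (J (a i)) w = 0 := fun i => congrFun (LinearMap.mem_ker.1 hw) (Sum.inr i)
    have hpos := h.inner.pos w hw0
    set s : ℝ := (Real.sqrt (b w w))⁻¹ with hs
    have hs2 : s * (s * b w w) = 1 := by
      have := Real.mul_self_sqrt hpos.le
      have h0 : Real.sqrt (b w w) ≠ 0 := (Real.sqrt_pos.2 hpos).ne'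
      rw [hs]
      field_simp
      nlinarith
    refine ⟨Fin.cons (s • w) a, fun i j => ?_, fun i j => ?_⟩
    · refine Fin.cases ?_ (fun i => ?_) i <;> refine Fin.cases ?_ (fun j => ?_) j
      · simp [hs2]
      · simp [h.inner.symm w, hwa, (Fin.succ_ne_zero _).symm]
      · simp [hwa]
      · simp [h1]
    · refine Fin.cases ?_ (fun i => ?_) i <;> refine Fin.cases ?_ (fun j => ?_) j
      · simp [h.apply_self]
      · simp [h.inner.symm w, hwJ]
      · have := h.skew (a i) w
        rw [hwJ] at this
        simp [neg_eq_zero.1 this.symm]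
      · simp [h2]

end IsUnitaryTriple

/-- An orthonormal sequence of full length is dual to itself. -/
theorem isFrame_of_orthonormal [FiniteDimensional ℝ V] {l : ℕ}
    (hl : Module.finrank ℝ V = l) {v : Fin l → V}
    (hv : ∀ i j, b (v i) (v j) = if i = j then 1 else 0) : IsFrame b v v := by
  have hlin : LinearIndependent ℝ v := by
    rw [Fintype.linearIndependent_iff]
    intro c hc i
    have := congrArg (b (v i)) hc
    simpa [hv] using this
  have hspan : Submodule.span ℝ (Set.range v) = ⊤ :=
    hlin.span_eq_top_of_card_eq_finrank' (by simp [hl])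
  intro y
  obtain ⟨c, rfl⟩ := (Submodule.mem_span_range_iff_exists_fun ℝ).1
    (hspan ▸ Submodule.mem_top (x := y))
  refine Finset.sum_congr rfl fun i _ => ?_
  simp [hv]

/-- A frame `a₁, J a₁, …, aₙ, J aₙ` with unitary `aᵢ` is orthonormal, and the Liouville form takes
the value `±1` on it: up to sign, the Liouville form is the Riemannian volume form. -/
theorem IsUnitaryTriple.exists_frame [FiniteDimensional ℝ V] (h : IsUnitaryTriple b σ J) {n : ℕ}
    (hn : Module.finrank ℝ V = 2 * n) :
    ∃ v : Fin (2 * n) → V, (∀ i j, b (v i) (v j) = if i = j then 1 else 0) ∧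
      liouville σ n v ^ 2 = 1 := by
  obtain ⟨a, h1, h2⟩ := h.exists_unitary n hn.ge
  have h3 : ∀ i j, b (J (a i)) (a j) = 0 := fun i j => by rw [h.inner.symm, h2]
  refine ⟨interleave a (fun i => J (a i)), fun i j => ?_, ?_⟩
  · simp only [interleave]
    split_ifs with p q e e q e e <;>
      simp only [h1, h2, h3, h.isometry, Fin.mk.injEq] <;>
      first
        | rfl
        | (rw [if_pos]; rw [Fin.ext_iff] at e; omega)
        | (rw [if_neg]; rw [Fin.ext_iff] at e; omega)
        | (exfalso; rw [Fin.ext_iff] at e; omega)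
  · rw [liouville_interleave σ 1]
    · simp
    · intro i j
      rw [h.sigma_eq, h2, neg_zero]
    · intro i j
      rw [h.sigma_eq, h.sq, map_neg, h3]
      simp
    · intro i j
      rw [← h.compat, h1]

/-- If a top-degree form takes the values `±1` on orthonormal frames then its square on any
sequence of vectors is the Gram determinant. -/
theorem sq_eq_det_gram [FiniteDimensional ℝ V] (hb : IsInner b) {l : ℕ}
    (hl : Module.finrank ℝ V = l) {v : Fin l → V}
    (hv : ∀ i j, b (v i) (v j) = if i = j then 1 else 0) {W : V [⋀^Fin l]→L[ℝ] ℝ}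
    (hW : W v ^ 2 = 1) (u : Fin l → V) :
    W u ^ 2 = (Matrix.of fun i j => b (u i) (u j)).det := by
  have hf := isFrame_of_orthonormal hl hv
  have hspan : ⊤ ≤ Submodule.span ℝ (Set.range v) := by
    intro y _
    rw [← hf y]
    exact Submodule.sum_mem _ fun i _ => Submodule.smul_mem _ _ (Submodule.subset_span ⟨i, rfl⟩)
  have hlin : LinearIndependent ℝ v := linearIndependent_of_top_le_span_of_card_eq_finrank hspan
    (by simp [hl])
  let B := Module.Basis.mk hlin hspan
  have hB : (B : Fin l → V) = v := Module.Basis.coe_mk _ _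
  have hrepr : ∀ y k, B.repr y k = b (v k) y := by
    intro y k
    have e : ∀ x, B.repr (v x) k = if x = k then 1 else 0 := fun x => by
      rw [show v x = B x by rw [hB], B.repr_self, Finsupp.single_apply]
    conv_lhs => rw [← hf y]
    simp [e]
  have h1 : W u = W v * (B.toMatrix u).det := by
    have := congrArg (fun f => f u) (W.toAlternatingMap.eq_smul_basis_det B)
    rw [hB] at this
    exact this
  have h2 : (Matrix.of fun i j => b (u i) (u j)) = (B.toMatrix u).transpose * B.toMatrix u := by
    ext i j
    rw [Matrix.mul_apply, Matrix.of_apply]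
    simp only [Matrix.transpose_apply, Module.Basis.toMatrix_apply, hrepr]
    conv_lhs => rw [← hf (u j)]
    simp only [map_sum, map_smul, smul_eq_mul]
    exact Finset.sum_congr rfl fun k _ => by rw [hb.symm (u i), mul_comm]
  rw [h2, Matrix.det_mul, Matrix.det_transpose, h1, mul_pow, hW]
  ring

end Unitary

/-! ### The inner product on forms -/

section FormInner
variable {m : ℕ} {F : Type*} [NormedAddCommGroup F] [NormedSpace ℝ F]
  {b : EuclideanSpace ℝ (Fin m) →L[ℝ] EuclideanSpace ℝ (Fin m) →L[ℝ] ℝ}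

local notation "𝔼" => EuclideanSpace ℝ (Fin m)

theorem formInner_comm (hb : IsInner b) {κ : F →L[ℝ] F →L[ℝ] ℝ} (hκ : ∀ ξ ζ, κ ξ ζ = κ ζ ξ) {k : ℕ}
    (α β : 𝔼 [⋀^Fin k]→L[ℝ] F) : formInner b κ α β = formInner b κ β α := by
  rw [formInner_eq_frame hb ((isFrame_recip hb).swap hb), formInner]
  congr 1
  exact Finset.sum_congr rfl fun I _ => hκ _ _

theorem formInner_add_left (κ : F →L[ℝ] F →L[ℝ] ℝ) {k : ℕ} (α α' β : 𝔼 [⋀^Fin k]→L[ℝ] F) :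
    formInner b κ (α + α') β = formInner b κ α β + formInner b κ α' β := by
  simp [formInner, Finset.sum_add_distrib, mul_add]

theorem formInner_add_right (κ : F →L[ℝ] F →L[ℝ] ℝ) {k : ℕ} (α β β' : 𝔼 [⋀^Fin k]→L[ℝ] F) :
    formInner b κ α (β + β') = formInner b κ α β + formInner b κ α β' := by
  simp [formInner, Finset.sum_add_distrib, mul_add]

theorem formInner_smul_left (κ : F →L[ℝ] F →L[ℝ] ℝ) {k : ℕ} (c : ℝ) (α β : 𝔼 [⋀^Fin k]→L[ℝ] F) :
    formInner b κ (c • α) β = c * formInner b κ α β := by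
  simp only [formInner, ContinuousAlternatingMap.smul_apply, map_smul, _root_.smul_apply,
    smul_eq_mul, ← Finset.mul_sum]
  ring

theorem formInner_smul_right (κ : F →L[ℝ] F →L[ℝ] ℝ) {k : ℕ} (c : ℝ) (α β : 𝔼 [⋀^Fin k]→L[ℝ] F) :
    formInner b κ α (c • β) = c * formInner b κ α β := by
  simp only [formInner, ContinuousAlternatingMap.smul_apply, map_smul,
    smul_eq_mul, ← Finset.mul_sum]
  ring

/-- The inner product on `1`-forms is positive definite. -/
theorem formInner_one_nonneg_and_definite (hb : IsInner b) {v : Fin m → 𝔼} (hv : IsFrame b v v)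
    {κ : F →L[ℝ] F →L[ℝ] ℝ} (hpos : ∀ ξ, ξ ≠ 0 → 0 < κ ξ ξ) (α : 𝔼 [⋀^Fin 1]→L[ℝ] F) :
    0 ≤ formInner b κ α α ∧ (formInner b κ α α = 0 → α = 0) := by
  have hnn : ∀ ξ, 0 ≤ κ ξ ξ := fun ξ => by
    by_cases h : ξ = 0
    · simp [h]
    · exact (hpos ξ h).le
  rw [formInner_eq_frame hb hv]
  simp only [Nat.factorial_one, Nat.cast_one, inv_one, one_mul]
  refine ⟨Finset.sum_nonneg fun I _ => hnn _, fun h => ?_⟩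
  rw [Finset.sum_eq_zero_iff_of_nonneg fun I _ => hnn _] at h
  have h0 : ∀ i, α ![v i] = 0 := by
    intro i
    by_contra hne
    have h1 := h (fun _ => i) (Finset.mem_univ _)
    have e : (fun _ : Fin 1 => v i) = ![v i] := by
      funext a
      fin_cases a
      rfl
    rw [e] at h1
    exact (hpos _ hne).ne' h1
  ext u
  have e : ∀ y, α ![y] = ofOneForm α y := by
    intro y
    change α _ = α _
    congr 1
    funext t
    fin_cases t
    rfl
  have eu : u = ![u 0] := by
    funext a
    fin_cases a
    rfl
  rw [eu, e, ← hv (u 0), map_sum]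
  refine Finset.sum_eq_zero fun i _ => ?_
  rw [map_smul, ← e, h0, smul_zero]

/-- `⟨φ σ, β⟩ = κ(φ, Λ β)`. -/
theorem formInner_formSmul (κ : F →L[ℝ] F →L[ℝ] ℝ) (hb : IsInner b)
    (σ : 𝔼 [⋀^Fin 2]→L[ℝ] ℝ) (φ : F) (β : 𝔼 [⋀^Fin 2]→L[ℝ] F) :
    formInner b κ (formSmul σ φ) β = κ φ (contraction b σ β) := by
  rw [contraction_eq_frame hb ((isFrame_recip hb).swap hb), formInner, map_smul, map_sum,
    smul_eq_mul]
  congr 1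
  refine Finset.sum_congr rfl fun I _ => ?_
  rw [formSmul_apply, map_smul, map_smul]
  rfl

theorem contraction_add {σ : 𝔼 [⋀^Fin 2]→L[ℝ] ℝ} (α β : 𝔼 [⋀^Fin 2]→L[ℝ] F) :
    contraction b σ (α + β) = contraction b σ α + contraction b σ β := by
  simp [contraction, smul_add, Finset.sum_add_distrib]

theorem contraction_smul {σ : 𝔼 [⋀^Fin 2]→L[ℝ] ℝ} (c : ℝ) (α : 𝔼 [⋀^Fin 2]→L[ℝ] F) :
    contraction b σ (c • α) = c • contraction b σ α := by
  simp only [contraction, ContinuousAlternatingMap.smul_apply, smul_comm _ c, ← Finset.smul_sum]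

end FormInner

/-! ### The Leibniz rule -/

section Leibniz
variable {V : Type*} [NormedAddCommGroup V] [NormedSpace ℝ V]
  {F : Type*} [NormedAddCommGroup F] [NormedSpace ℝ F]

set_option maxSynthPendingDepth 6 in
/-- `wedgeOne` before alternatization, as a bounded bilinear map. -/
def wedgeBilin (κ : F →L[ℝ] F →L[ℝ] ℝ) (l : ℕ) :
    (V [⋀^Fin l]→L[ℝ] F) →L[ℝ] (V →L[ℝ] F) →L[ℝ] (V →L[ℝ] (V [⋀^Fin l]→L[ℝ] ℝ)) :=
  (ContinuousLinearMap.compL ℝ V F (V [⋀^Fin l]→L[ℝ] ℝ)) ∘L (pairForm κ l).flip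

/-- `ofOneForm` as a continuous linear map. -/
def ofOneFormCLM : (V [⋀^Fin 1]→L[ℝ] F) →L[ℝ] (V →L[ℝ] F) :=
  ((ContinuousAlternatingMap.ofSubsingletonLIE (𝕜 := ℝ) (E := V) (F := F)
      (0 : Fin 1)).symm.toContinuousLinearEquiv : (V [⋀^Fin 1]→L[ℝ] F) →L[ℝ] (V →L[ℝ] F))

theorem ofOneForm_apply (a : V [⋀^Fin 1]→L[ℝ] F) (x : V) : ofOneForm a x = a ![x] := by
  change a _ = _
  congr 1
  funext i
  fin_cases i
  rfl

set_option maxSynthPendingDepth 6 in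
/-- The Leibniz rule `d κ(a ∧ β) = κ(da ∧ β) - κ(a ∧ dβ)` for a `1`-form `a`. -/
theorem extDeriv_wedgeOne (κ : F →L[ℝ] F →L[ℝ] ℝ) {l : ℕ} {a : V → V [⋀^Fin 1]→L[ℝ] F}
    {β : V → V [⋀^Fin l]→L[ℝ] F} {x : V} (ha : DifferentiableAt ℝ a x)
    (hβ : DifferentiableAt ℝ β x) :
    extDeriv (fun y => wedgeOne κ (ofOneForm (a y)) (β y)) x =
      wedgePair κ (extDeriv a x) (β x) - wedgeOne κ (ofOneForm (a x)) (extDeriv β x) := by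
  set a' := fderiv ℝ a x with ha'
  set β' := fderiv ℝ β x with hβ'
  have h1 : HasFDerivAt (fun y => ofOneForm (a y)) (ofOneFormCLM ∘L a') x :=
    (ofOneFormCLM (V := V) (F := F)).hasFDerivAt.comp x ha.hasFDerivAt
  have h2 := (wedgeBilin κ l).hasFDerivAt_of_bilinear hβ.hasFDerivAt h1
  have h3 := ((ContinuousAlternatingMap.alternatizeUncurryFinCLM ℝ V ℝ).hasFDerivAt
    (x := wedgeBilin κ l (β x) (ofOneForm (a x)))).comp x h2
  set f1 : V →L[ℝ] V →L[ℝ] V [⋀^Fin l]→L[ℝ] ℝ :=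
    wedgeBilin κ l (β x) ∘L (ofOneFormCLM ∘L a') with hf1
  set f2 : V →L[ℝ] V →L[ℝ] V [⋀^Fin l]→L[ℝ] ℝ :=
    (wedgeBilin κ l).flip (ofOneForm (a x)) ∘L β' with hf2
  have h4 : extDeriv (fun y => wedgeOne κ (ofOneForm (a y)) (β y)) x = alt2 f1 + alt2 f2 := by
    rw [← alt2_add]
    exact congrArg ContinuousAlternatingMap.alternatizeUncurryFin h3.fderiv
  have h5 : wedgePair κ (extDeriv a x) (β x) = alt2 f1 := by
    have e : ((pairForm κ l).flip (β x)).postcomp V ∘L lin2 (extDeriv a x) =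
        f1 + (-1 : ℝ) • f1.flip := by
      ext w v t
      have : lin2 (extDeriv a x) w v = a' w ![v] - a' v ![w] := by
        rw [lin2_apply, extDeriv, ContinuousAlternatingMap.alternatizeUncurryFin_apply,
          Fin.sum_univ_two]
        have e1 : (0 : Fin 2).removeNth ![w, v] = ![v] := by
          funext i; fin_cases i; rfl
        have e2 : (1 : Fin 2).removeNth ![w, v] = ![w] := by
          funext i; fin_cases i; rfl
        rw [e1, e2]
        simp [sub_eq_add_neg, ha']
      change κ (lin2 (extDeriv a x) w v) _ =
        κ (ofOneForm (a' w) v) _ + (-1 : ℝ) * κ (ofOneForm (a' v) w) _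
      rw [this, ofOneForm_apply, ofOneForm_apply, map_sub]
      rw [_root_.sub_apply]
      ring
    have e2 : alt2 ((-1 : ℝ) • f1.flip) = alt2 f1 := by
      have : (-1 : ℝ) • f1.flip = ((-1 : ℝ) • f1).flip := rfl
      rw [this, alt2_flip]
      ext v
      simp [alt2_apply]
    rw [wedgePair, e, alt2_add, e2, ← two_smul ℝ, smul_smul]
    norm_num
  have h6 : wedgeOne κ (ofOneForm (a x)) (extDeriv β x) = alt2 f2.flip := by
    ext v
    rw [wedgeOne_apply, alt2_apply]
    refine Finset.sum_congr rfl fun i _ => ?_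
    congr 1
    rw [extDeriv, ContinuousAlternatingMap.alternatizeUncurryFin_apply, map_sum]
    refine Finset.sum_congr rfl fun j _ => ?_
    rw [map_zsmul, zsmul_eq_mul]
    push_cast
    rfl
  rw [h4, h5, h6, alt2_flip, sub_neg_eq_add]

/-- A family of alternating maps of finite-dimensional spaces is smooth if its values on all
sequences of vectors are. -/
theorem contDiffAt_alternating [FiniteDimensional ℝ V] [FiniteDimensional ℝ F]
    {X : Type*} [NormedAddCommGroup X] [NormedSpace ℝ X] {k : ℕ} {r : WithTop ℕ∞}
    {f : X → V [⋀^Fin k]→L[ℝ] F} {x : X}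
    (h : ∀ v : Fin k → V, ContDiffAt ℝ r (fun y => f y v) x) : ContDiffAt ℝ r f x := by
  let B := Module.finBasis ℝ V
  let ev : (V [⋀^Fin k]→L[ℝ] F) →ₗ[ℝ] ((Fin k → Fin (Module.finrank ℝ V)) → F) :=
    { toFun := fun α I => α fun a => B (I a)
      map_add' := fun _ _ => rfl
      map_smul' := fun _ _ => rfl }
  have hinj : Function.Injective ev := by
    intro α β hαβ
    apply ContinuousAlternatingMap.toAlternatingMap_injective
    apply AlternatingMap.coe_multilinearMap_injective
    exact Module.Basis.ext_multilinear (fun _ => B) fun I => congrFun hαβ I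
  obtain ⟨g, hg⟩ := ev.exists_leftInverse_of_injective (LinearMap.ker_eq_bot.2 hinj)
  have hfg : f = fun y => g.toContinuousLinearMap (ev (f y)) := by
    funext y
    exact (LinearMap.congr_fun hg (f y)).symm
  rw [hfg]
  refine g.toContinuousLinearMap.contDiff.contDiffAt.comp x (contDiffAt_pi.2 fun I => ?_)
  exact h _

end Leibniz

/-! ### Smooth dependence of the pointwise operations -/

section Smoothness
variable {X : Type*} [NormedAddCommGroup X] [NormedSpace ℝ X] {r : WithTop ℕ∞} {x : X}
  {V : Type*} [NormedAddCommGroup V] [NormedSpace ℝ V]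
  {F : Type*} [NormedAddCommGroup F] [NormedSpace ℝ F]

theorem contDiffAt_alternating_apply_const {k : ℕ} {f : X → V [⋀^Fin k]→L[ℝ] F}
    (hf : ContDiffAt ℝ r f x) (v : Fin k → V) : ContDiffAt ℝ r (fun y => f y v) x :=
  (ContinuousAlternatingMap.apply ℝ V F v).contDiff.contDiffAt.comp x hf

theorem contDiffAt_alternating_apply [FiniteDimensional ℝ V] {k : ℕ}
    {f : X → V [⋀^Fin k]→L[ℝ] F} {v : X → Fin k → V} (hf : ContDiffAt ℝ r f x)
    (hv : ∀ a, ContDiffAt ℝ r (fun y => v y a) x) : ContDiffAt ℝ r (fun y => f y (v y)) x := by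
  let B := Module.finBasis ℝ V
  have h : (fun y => f y (v y)) = fun y => ∑ J : Fin k → Fin (Module.finrank ℝ V),
      (∏ a, (B.coord (J a)).toContinuousLinearMap (v y a)) • f y fun a => B (J a) := by
    funext y
    have : v y = fun a => ∑ j, (B.coord j).toContinuousLinearMap (v y a) • B j := by
      funext a
      exact (B.sum_repr (v y a)).symm
    conv_lhs => rw [this, ContinuousAlternatingMap.map_sum]
    exact Finset.sum_congr rfl fun J _ => (f y).map_smul_univ _ _
  rw [h]
  refine ContDiffAt.sum fun J _ => ContDiffAt.smul (contDiffAt_prod fun a _ => ?_)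
    (contDiffAt_alternating_apply_const hf _)
  exact (ContinuousLinearMap.contDiff _).contDiffAt.comp x (hv a)

theorem contDiffAt_compContinuousLinearMap [FiniteDimensional ℝ V] [FiniteDimensional ℝ F]
    {V' : Type*} [NormedAddCommGroup V'] [NormedSpace ℝ V'] [FiniteDimensional ℝ V'] {k : ℕ}
    {f : X → V [⋀^Fin k]→L[ℝ] F} {L : X → V' →L[ℝ] V} (hf : ContDiffAt ℝ r f x)
    (hL : ContDiffAt ℝ r L x) :
    ContDiffAt ℝ r (fun y => (f y).compContinuousLinearMap (L y)) x :=
  contDiffAt_alternating fun v => contDiffAt_alternating_apply (v := fun y a => L y (v a)) hf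
    fun _ => hL.clm_apply contDiffAt_const

theorem contDiffAt_det {ι : Type*} [Fintype ι] [DecidableEq ι] {A : X → Matrix ι ι ℝ}
    (hA : ∀ i j, ContDiffAt ℝ r (fun y => A y i j) x) : ContDiffAt ℝ r (fun y => (A y).det) x := by
  simp only [Matrix.det_apply]
  refine ContDiffAt.sum fun s _ => ContDiffAt.const_smul _ (contDiffAt_prod fun i _ => hA _ _)

theorem contDiffAt_inv {ι : Type*} [Fintype ι] [DecidableEq ι] {A : X → Matrix ι ι ℝ}
    (hA : ∀ i j, ContDiffAt ℝ r (fun y => A y i j) x) (h0 : (A x).det ≠ 0) (i j : ι) :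
    ContDiffAt ℝ r (fun y => (A y)⁻¹ i j) x := by
  simp only [Matrix.inv_def, Ring.inverse_eq_inv', Matrix.smul_apply, smul_eq_mul,
    Matrix.adjugate_apply]
  refine ((contDiffAt_det hA).inv h0).mul (contDiffAt_det fun i' j' => ?_)
  simp only [Matrix.updateRow_apply]
  split_ifs
  · exact contDiffAt_const
  · exact hA _ _

variable {m : ℕ}
local notation "𝔼" => EuclideanSpace ℝ (Fin m)
variable {b : X → EuclideanSpace ℝ (Fin m) →L[ℝ] EuclideanSpace ℝ (Fin m) →L[ℝ] ℝ}

theorem contDiffAt_gram (hb : ContDiffAt ℝ r b x) (i j : Fin m) :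
    ContDiffAt ℝ r (fun y => gram (b y) i j) x :=
  (hb.clm_apply contDiffAt_const).clm_apply contDiffAt_const

theorem contDiffAt_recip (hb : ContDiffAt ℝ r b x) (hx : IsInner (b x)) (i : Fin m) :
    ContDiffAt ℝ r (fun y => recip (b y) i) x :=
  ContDiffAt.sum fun j _ => (contDiffAt_inv (contDiffAt_gram hb)
    (isUnit_det_gram hx.pos).ne_zero i j).smul contDiffAt_const

theorem contDiffAt_formInner (hb : ContDiffAt ℝ r b x) (hx : IsInner (b x))
    (κ : F →L[ℝ] F →L[ℝ] ℝ) {k : ℕ} {α β : X → 𝔼 [⋀^Fin k]→L[ℝ] F}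
    (hα : ContDiffAt ℝ r α x) (hβ : ContDiffAt ℝ r β x) :
    ContDiffAt ℝ r (fun y => formInner (b y) κ (α y) (β y)) x := by
  refine contDiffAt_const.mul (ContDiffAt.sum fun I _ => ?_)
  exact (κ.contDiff.contDiffAt.comp x (contDiffAt_alternating_apply_const hα _)).clm_apply
    (contDiffAt_alternating_apply hβ fun a => contDiffAt_recip hb hx _)

theorem contDiffAt_contraction (hb : ContDiffAt ℝ r b x) (hx : IsInner (b x))
    {σ : X → 𝔼 [⋀^Fin 2]→L[ℝ] ℝ} {α : X → 𝔼 [⋀^Fin 2]→L[ℝ] F}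
    (hσ : ContDiffAt ℝ r σ x) (hα : ContDiffAt ℝ r α x) :
    ContDiffAt ℝ r (fun y => contraction (b y) (σ y) (α y)) x := by
  refine ContDiffAt.const_smul _ (ContDiffAt.sum fun i _ => ContDiffAt.sum fun j _ => ?_)
  refine (contDiffAt_alternating_apply hσ fun a => ?_).smul
    (contDiffAt_alternating_apply_const hα _)
  fin_cases a
  · exact contDiffAt_recip hb hx i
  · exact contDiffAt_recip hb hx j

theorem contDiffAt_formSmul [FiniteDimensional ℝ V] [FiniteDimensional ℝ F] {k : ℕ}
    {σ : X → V [⋀^Fin k]→L[ℝ] ℝ} {φ : X → F} (hσ : ContDiffAt ℝ r σ x) (hφ : ContDiffAt ℝ r φ x) :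
    ContDiffAt ℝ r (fun y => formSmul (σ y) (φ y)) x :=
  contDiffAt_alternating fun _ => (contDiffAt_alternating_apply_const hσ _).smul hφ

theorem contDiffAt_primitivePart [FiniteDimensional ℝ F] {n : ℕ}
    {b : X → EuclideanSpace ℝ (Fin (2 * n)) →L[ℝ] EuclideanSpace ℝ (Fin (2 * n)) →L[ℝ] ℝ}
    (hb : ContDiffAt ℝ r b x) (hx : IsInner (b x))
    {σ : X → EuclideanSpace ℝ (Fin (2 * n)) [⋀^Fin 2]→L[ℝ] ℝ}
    {α : X → EuclideanSpace ℝ (Fin (2 * n)) [⋀^Fin 2]→L[ℝ] F}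
    (hσ : ContDiffAt ℝ r σ x) (hα : ContDiffAt ℝ r α x) :
    ContDiffAt ℝ r (fun y => primitivePart (b y) (σ y) (α y)) x :=
  hα.sub (contDiffAt_formSmul hσ (ContDiffAt.const_smul _ (contDiffAt_contraction hb hx hσ hα)))

theorem contDiffAt_wedgeTwo [FiniteDimensional ℝ V] {σ : X → V [⋀^Fin 2]→L[ℝ] ℝ} {l : ℕ}
    {β : X → V [⋀^Fin l]→L[ℝ] ℝ} (hσ : ContDiffAt ℝ r σ x) (hβ : ContDiffAt ℝ r β x) :
    ContDiffAt ℝ r (fun y => wedgeTwo (σ y) (β y)) x := by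
  refine contDiffAt_alternating fun v => ?_
  simp only [wedgeTwo_apply]
  exact contDiffAt_const.mul (ContDiffAt.sum fun i _ => contDiffAt_const.mul
    (ContDiffAt.sum fun j _ => contDiffAt_const.mul
      ((contDiffAt_alternating_apply_const hσ _).mul (contDiffAt_alternating_apply_const hβ _))))

theorem contDiffAt_liouville [FiniteDimensional ℝ V] {σ : X → V [⋀^Fin 2]→L[ℝ] ℝ}
    (hσ : ContDiffAt ℝ r σ x) (k : ℕ) : ContDiffAt ℝ r (fun y => liouville (σ y) k) x := by
  induction k with
  | zero => exact contDiffAt_const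
  | succ k ih => exact (contDiffAt_wedgeTwo hσ ih).const_smul (((k : ℝ) + 1)⁻¹)

theorem contDiffAt_hodgeStar [FiniteDimensional ℝ F] (hb : ContDiffAt ℝ r b x)
    (hx : IsInner (b x)) {vol : X → 𝔼 [⋀^Fin m]→L[ℝ] ℝ} (hvol : ContDiffAt ℝ r vol x)
    {k l : ℕ} (h : m = l + k) {α : X → 𝔼 [⋀^Fin k]→L[ℝ] F} (hα : ContDiffAt ℝ r α x) :
    ContDiffAt ℝ r (fun y => hodgeStar (b y) (vol y) h (α y)) x := by
  refine contDiffAt_alternating fun v => ?_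
  simp only [hodgeStar, ContinuousAlternatingMap.smul_apply, ContinuousAlternatingMap.sum_apply,
    formSmul_apply, insertVecs_apply, castDegree_apply]
  refine ContDiffAt.const_smul _ (ContDiffAt.sum fun I _ => ContDiffAt.smul ?_
    (contDiffAt_alternating_apply_const hα _))
  refine contDiffAt_alternating_apply hvol fun a => ?_
  generalize Fin.cast _ (Fin.cast _ a) = j
  refine Fin.addCases (fun j => ?_) (fun j => ?_) j
  · simp only [Fin.append_left]
    exact contDiffAt_recip hb hx _
  · simp only [Fin.append_right]
    exact contDiffAt_const

theorem contDiffAt_wedgeOne [FiniteDimensional ℝ V] (κ : F →L[ℝ] F →L[ℝ] ℝ) {l : ℕ}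
    {a : X → V [⋀^Fin 1]→L[ℝ] F} {β : X → V [⋀^Fin l]→L[ℝ] F} (ha : ContDiffAt ℝ r a x)
    (hβ : ContDiffAt ℝ r β x) :
    ContDiffAt ℝ r (fun y => wedgeOne κ (ofOneForm (a y)) (β y)) x := by
  refine contDiffAt_alternating fun v => ?_
  simp only [wedgeOne_apply, ofOneForm_apply]
  exact ContDiffAt.sum fun i _ => contDiffAt_const.mul
    ((κ.contDiff.contDiffAt.comp x (contDiffAt_alternating_apply_const ha _)).clm_apply
      (contDiffAt_alternating_apply_const hβ _))

theorem contDiffAt_extDeriv {k : ℕ} {β : X → X [⋀^Fin k]→L[ℝ] F} (hβ : ContDiffAt ℝ ∞ β x) :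
    ContDiffAt ℝ ∞ (extDeriv β) x := by
  change ContDiffAt ℝ ∞ (fun y =>
    ContinuousAlternatingMap.alternatizeUncurryFinCLM ℝ X F (fderiv ℝ β y)) x
  exact (ContinuousLinearMap.contDiff _).contDiffAt.comp x (hβ.fderiv_right (m := ∞) (by simp))

end Smoothness

/-! ### Differential forms on manifolds -/

section Tangent
variable {E : Type*} [NormedAddCommGroup E] [NormedSpace ℝ E]
  {M : Type*} [TopologicalSpace M] [ChartedSpace E M]
  {E' : Type*} [NormedAddCommGroup E'] [NormedSpace ℝ E']
  {M' : Type*} [TopologicalSpace M'] [ChartedSpace E' M']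
  {E'' : Type*} [NormedAddCommGroup E''] [NormedSpace ℝ E'']
  {M'' : Type*} [TopologicalSpace M''] [ChartedSpace E'' M'']
  {F : Type*} [NormedAddCommGroup F] [NormedSpace ℝ F]

theorem tmap_comp {f : M → M'} {h : M' → M''} {x : M}
    (hh : MDifferentiableAt 𝓘(ℝ, E') 𝓘(ℝ, E'') h (f x))
    (hf : MDifferentiableAt 𝓘(ℝ, E) 𝓘(ℝ, E') f x) :
    tmap E E'' (h ∘ f) x = tmap E' E'' h (f x) ∘L tmap E E' f x :=
  mfderiv_comp x hh hf

theorem tmap_congr {f h : M → M'} {x : M} (hfh : f =ᶠ[𝓝 x] h) : tmap E E' f x = tmap E E' h x :=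
  hfh.mfderiv_eq

theorem tmap_eq_fderiv (f : E → E') (x : E) : tmap E E' f x = fderiv ℝ f x := mfderiv_eq_fderiv

theorem tmap_id (x : M) : tmap E E (fun y : M => y) x = ContinuousLinearMap.id ℝ E := mfderiv_id

theorem tmap_const (c : M') (x : M) : tmap E E' (fun _ : M => c) x = 0 := mfderiv_const

variable [IsManifold 𝓘(ℝ, E) ∞ M] [IsManifold 𝓘(ℝ, E') ∞ M']

theorem contMDiffAt_chart {x y : M} (hy : y ∈ (extChartAt 𝓘(ℝ, E) x).source) :
    ContMDiffAt 𝓘(ℝ, E) 𝓘(ℝ, E) ∞ (extChartAt 𝓘(ℝ, E) x) y :=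
  contMDiffAt_extChartAt' (by simpa using hy)

theorem contMDiffAt_chart_symm {x : M} {z : E} (hz : z ∈ (extChartAt 𝓘(ℝ, E) x).target) :
    ContMDiffAt 𝓘(ℝ, E) 𝓘(ℝ, E) ∞ (extChartAt 𝓘(ℝ, E) x).symm z :=
  (contMDiffOn_extChartAt_symm x).contMDiffAt ((isOpen_extChartAt_target x).mem_nhds hz)

theorem mdiff_chart {x y : M} (hy : y ∈ (extChartAt 𝓘(ℝ, E) x).source) :
    MDifferentiableAt 𝓘(ℝ, E) 𝓘(ℝ, E) (extChartAt 𝓘(ℝ, E) x) y :=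
  (contMDiffAt_chart hy).mdifferentiableAt (by simp)

theorem mdiff_chart_symm {x : M} {z : E} (hz : z ∈ (extChartAt 𝓘(ℝ, E) x).target) :
    MDifferentiableAt 𝓘(ℝ, E) 𝓘(ℝ, E) (extChartAt 𝓘(ℝ, E) x).symm z :=
  (contMDiffAt_chart_symm hz).mdifferentiableAt (by simp)

theorem tmap_chart_comp_symm {x : M} {z : E} (hz : z ∈ (extChartAt 𝓘(ℝ, E) x).target) :
    tmap E E (extChartAt 𝓘(ℝ, E) x) ((extChartAt 𝓘(ℝ, E) x).symm z) ∘L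
      tmap E E (extChartAt 𝓘(ℝ, E) x).symm z = ContinuousLinearMap.id ℝ E := by
  rw [← tmap_comp (mdiff_chart ((extChartAt 𝓘(ℝ, E) x).map_target hz)) (mdiff_chart_symm hz),
    ← tmap_id z]
  refine tmap_congr ?_
  filter_upwards [(isOpen_extChartAt_target x).mem_nhds hz] with w hw
  exact (extChartAt 𝓘(ℝ, E) x).right_inv hw

theorem tmap_symm_comp_chart {x y : M} (hy : y ∈ (extChartAt 𝓘(ℝ, E) x).source) :
    tmap E E (extChartAt 𝓘(ℝ, E) x).symm (extChartAt 𝓘(ℝ, E) x y) ∘L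
      tmap E E (extChartAt 𝓘(ℝ, E) x) y = ContinuousLinearMap.id ℝ E := by
  rw [← tmap_comp (mdiff_chart_symm ((extChartAt 𝓘(ℝ, E) x).map_source hy)) (mdiff_chart hy),
    ← tmap_id y]
  refine tmap_congr ?_
  filter_upwards [(isOpen_extChartAt_source x).mem_nhds hy] with w hw
  exact (extChartAt 𝓘(ℝ, E) x).left_inv hw

/-- The tangent map of a chart, as an isomorphism. -/
def chartEquiv {x : M} {z : E} (hz : z ∈ (extChartAt 𝓘(ℝ, E) x).target) : E ≃L[ℝ] E :=
  ContinuousLinearEquiv.equivOfInverse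
    (tmap E E (extChartAt 𝓘(ℝ, E) x).symm z)
    (tmap E E (extChartAt 𝓘(ℝ, E) x) ((extChartAt 𝓘(ℝ, E) x).symm z))
    (fun v => DFunLike.congr_fun (tmap_chart_comp_symm hz) v)
    (fun v => by
      have := tmap_symm_comp_chart ((extChartAt 𝓘(ℝ, E) x).map_target hz)
      rw [(extChartAt 𝓘(ℝ, E) x).right_inv hz] at this
      exact DFunLike.congr_fun this v)

/-- The coordinate expression of a map in the charts around `x` and `y`. -/
def localMap (E E' : Type*) [NormedAddCommGroup E] [NormedSpace ℝ E]
    [NormedAddCommGroup E'] [NormedSpace ℝ E'] [ChartedSpace E M] [ChartedSpace E' M']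
    (f : M → M') (x : M) (y : M') : E → E' :=
  extChartAt 𝓘(ℝ, E') y ∘ f ∘ (extChartAt 𝓘(ℝ, E) x).symm

theorem contDiffAt_localMap {f : M → M'} {x : M} {y : M'} {z : E}
    (hz : z ∈ (extChartAt 𝓘(ℝ, E) x).target)
    (hf : ContMDiffAt 𝓘(ℝ, E) 𝓘(ℝ, E') ∞ f ((extChartAt 𝓘(ℝ, E) x).symm z))
    (hy : f ((extChartAt 𝓘(ℝ, E) x).symm z) ∈ (extChartAt 𝓘(ℝ, E') y).source) :
    ContDiffAt ℝ ∞ (localMap E E' f x y) z :=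
  ((contMDiffAt_chart hy).comp z (hf.comp z (contMDiffAt_chart_symm hz))).contDiffAt

/-- In coordinates, a pull-back of forms is a pull-back by the coordinate expression. -/
theorem chartRep_pullback_apply {f : M → M'} {x : M} {y : M'} {z : E}
    (hz : z ∈ (extChartAt 𝓘(ℝ, E) x).target)
    (hf : ContMDiffAt 𝓘(ℝ, E) 𝓘(ℝ, E') 1 f ((extChartAt 𝓘(ℝ, E) x).symm z))
    (hy : f ((extChartAt 𝓘(ℝ, E) x).symm z) ∈ (extChartAt 𝓘(ℝ, E') y).source) {k : ℕ}
    (β : M' → E' [⋀^Fin k]→L[ℝ] F) :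
    chartRep (pullback E f β) x z =
      (chartRep β y (localMap E E' f x y z)).compContinuousLinearMap
        (fderiv ℝ (localMap E E' f x y) z) := by
  have hf' := hf.mdifferentiableAt (by simp)
  have hfs : MDifferentiableAt 𝓘(ℝ, E) 𝓘(ℝ, E') (f ∘ (extChartAt 𝓘(ℝ, E) x).symm) z :=
    hf'.comp z (mdiff_chart_symm hz)
  have hl : MDifferentiableAt 𝓘(ℝ, E) 𝓘(ℝ, E') (localMap E E' f x y) z :=
    (mdiff_chart hy).comp z hfs
  have hs : MDifferentiableAt 𝓘(ℝ, E') 𝓘(ℝ, E') (extChartAt 𝓘(ℝ, E') y).symm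
      (localMap E E' f x y z) := mdiff_chart_symm ((extChartAt 𝓘(ℝ, E') y).map_source hy)
  have e1 : tmap E E' (f ∘ (extChartAt 𝓘(ℝ, E) x).symm) z =
      tmap E E' ((extChartAt 𝓘(ℝ, E') y).symm ∘ localMap E E' f x y) z := by
    refine tmap_congr ?_
    filter_upwards [hfs.continuousAt.preimage_mem_nhds
      ((isOpen_extChartAt_source y).mem_nhds hy)] with w hw
    exact ((extChartAt 𝓘(ℝ, E') y).left_inv hw).symm
  have e2 : (extChartAt 𝓘(ℝ, E') y).symm (localMap E E' f x y z) =
      f ((extChartAt 𝓘(ℝ, E) x).symm z) := (extChartAt 𝓘(ℝ, E') y).left_inv hy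
  rw [tmap_comp hf' (mdiff_chart_symm hz), tmap_comp hs hl, tmap_eq_fderiv (localMap E E' f x y)]
    at e1
  simp only [chartRep, pullback, e2]
  ext v
  have : ∀ u, tmap E E' f ((extChartAt 𝓘(ℝ, E) x).symm z)
      (tmap E E (extChartAt 𝓘(ℝ, E) x).symm z u) = _ := fun u => DFunLike.congr_fun e1 u
  change β _ (fun i => tmap E E' f ((extChartAt 𝓘(ℝ, E) x).symm z)
      (tmap E E (extChartAt 𝓘(ℝ, E) x).symm z (v i))) = _
  simp only [this]
  rfl

theorem eventually_target {x x₀ : M} (hx : x ∈ (extChartAt 𝓘(ℝ, E) x₀).source) :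
    ∀ᶠ z in 𝓝 (extChartAt 𝓘(ℝ, E) x₀ x), z ∈ (extChartAt 𝓘(ℝ, E) x₀).target :=
  (isOpen_extChartAt_target x₀).mem_nhds ((extChartAt 𝓘(ℝ, E) x₀).map_source hx)

theorem tendsto_chart_symm {x x₀ : M} (hx : x ∈ (extChartAt 𝓘(ℝ, E) x₀).source) :
    Filter.Tendsto (extChartAt 𝓘(ℝ, E) x₀).symm (𝓝 (extChartAt 𝓘(ℝ, E) x₀ x)) (𝓝 x) := by
  have h := (contMDiffAt_chart_symm ((extChartAt 𝓘(ℝ, E) x₀).map_source hx)).continuousAt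
  rw [ContinuousAt, (extChartAt 𝓘(ℝ, E) x₀).left_inv hx] at h
  exact h

theorem chartRep_pullback_eventuallyEq {f : M → M'} {x x₀ : M} {y : M'}
    (hx : x ∈ (extChartAt 𝓘(ℝ, E) x₀).source) (hf : ContMDiffAt 𝓘(ℝ, E) 𝓘(ℝ, E') ∞ f x)
    (hy : f x ∈ (extChartAt 𝓘(ℝ, E') y).source) {k : ℕ} (β : M' → E' [⋀^Fin k]→L[ℝ] F) :
    chartRep (pullback E f β) x₀ =ᶠ[𝓝 (extChartAt 𝓘(ℝ, E) x₀ x)] fun z =>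
      (chartRep β y (localMap E E' f x₀ y z)).compContinuousLinearMap
        (fderiv ℝ (localMap E E' f x₀ y) z) := by
  have h1 : ∀ᶠ w in 𝓝 x, ContMDiffAt 𝓘(ℝ, E) 𝓘(ℝ, E') 1 f w :=
    contMDiffAt_iff_contMDiffAt_nhds (by simp) |>.1 (hf.of_le (by simp))
  have h2 : ∀ᶠ w in 𝓝 x, f w ∈ (extChartAt 𝓘(ℝ, E') y).source :=
    hf.continuousAt.preimage_mem_nhds ((isOpen_extChartAt_source y).mem_nhds hy)
  filter_upwards [eventually_target hx, (tendsto_chart_symm hx).eventually h1,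
    (tendsto_chart_symm hx).eventually h2] with z hz h1z h2z
  exact chartRep_pullback_apply hz h1z h2z β

/-- Smoothness of a differential form at a point. -/
def SmoothFormAt {k : ℕ} (β : M → E [⋀^Fin k]→L[ℝ] F) (x : M) : Prop :=
  ContDiffAt ℝ ∞ (chartRep β x) (extChartAt 𝓘(ℝ, E) x x)

omit [IsManifold 𝓘(ℝ, E) ∞ M] in
theorem chartRep_self {k : ℕ} (β : E → E [⋀^Fin k]→L[ℝ] F) (x : E) : chartRep β x = β := by
  funext z
  have : tmap E E (extChartAt 𝓘(ℝ, E) x).symm z = ContinuousLinearMap.id ℝ E := by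
    rw [tmap_eq_fderiv]; exact fderiv_id
  rw [chartRep, pullback, this]
  rfl

theorem smoothFormAt_self_iff {k : ℕ} {β : E → E [⋀^Fin k]→L[ℝ] F} {x : E} :
    SmoothFormAt β x ↔ ContDiffAt ℝ ∞ β x := by
  rw [SmoothFormAt, chartRep_self]; rfl

theorem extD_self {k : ℕ} (β : E → E [⋀^Fin k]→L[ℝ] F) (x : E) : extD β x = extDeriv β x := by
  have : tmap E E (extChartAt 𝓘(ℝ, E) x) x = ContinuousLinearMap.id ℝ E := by
    rw [tmap_eq_fderiv]; exact fderiv_id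
  rw [extD, chartRep_self, this]
  rfl

theorem SmoothFormAt.pullback [FiniteDimensional ℝ E] [FiniteDimensional ℝ E']
    [FiniteDimensional ℝ F] {f : M → M'} {x : M} {k : ℕ} {β : M' → E' [⋀^Fin k]→L[ℝ] F}
    (hβ : SmoothFormAt β (f x)) (hf : ContMDiffAt 𝓘(ℝ, E) 𝓘(ℝ, E') ∞ f x) :
    SmoothFormAt (PrimitiveYM.pullback E f β) x := by
  have hx := mem_extChartAt_source (I := 𝓘(ℝ, E)) x
  have hy := mem_extChartAt_source (I := 𝓘(ℝ, E')) (f x)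
  refine ContDiffAt.congr_of_eventuallyEq ?_ (chartRep_pullback_eventuallyEq hx hf hy β)
  have hl : ContDiffAt ℝ ∞ (localMap E E' f x (f x)) (extChartAt 𝓘(ℝ, E) x x) := by
    apply contDiffAt_localMap
    · exact mem_extChartAt_target x
    · rwa [extChartAt_to_inv]
    · rwa [extChartAt_to_inv]
  refine contDiffAt_compContinuousLinearMap (ContDiffAt.comp _ ?_ hl)
    (hl.fderiv_right (m := ∞) (by simp))
  have e0 : localMap E E' f x (f x) (extChartAt 𝓘(ℝ, E) x x) =
      extChartAt 𝓘(ℝ, E') (f x) (f x) := by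
    simp only [localMap, Function.comp_apply, extChartAt_to_inv]
  rw [e0]
  exact hβ

theorem minSmoothness_le_top : minSmoothness ℝ 2 ≤ (∞ : WithTop ℕ∞) := by
  rw [minSmoothness_of_isRCLikeNormedField]
  exact WithTop.coe_le_coe.2 (le_top : (2 : ℕ∞) ≤ ⊤)

/-- The exterior derivative commutes with pull-backs. -/
theorem extD_pullback {f : M → M'} {x : M} {k : ℕ} {β : M' → E' [⋀^Fin k]→L[ℝ] F}
    (hβ : SmoothFormAt β (f x)) (hf : ContMDiffAt 𝓘(ℝ, E) 𝓘(ℝ, E') ∞ f x) :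
    extD (PrimitiveYM.pullback E f β) x =
      (extD β (f x)).compContinuousLinearMap (tmap E E' f x) := by
  have hx := mem_extChartAt_source (I := 𝓘(ℝ, E)) x
  have hy := mem_extChartAt_source (I := 𝓘(ℝ, E')) (f x)
  have hl : ContDiffAt ℝ ∞ (localMap E E' f x (f x)) (extChartAt 𝓘(ℝ, E) x x) := by
    apply contDiffAt_localMap
    · exact mem_extChartAt_target x
    · rwa [extChartAt_to_inv]
    · rwa [extChartAt_to_inv]
  have e0 : localMap E E' f x (f x) (extChartAt 𝓘(ℝ, E) x x) =
      extChartAt 𝓘(ℝ, E') (f x) (f x) := by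
    simp only [localMap, Function.comp_apply, extChartAt_to_inv]
  have hβ' : DifferentiableAt ℝ (chartRep β (f x))
      (localMap E E' f x (f x) (extChartAt 𝓘(ℝ, E) x x)) := by
    rw [e0]; exact ContDiffAt.differentiableAt hβ (by simp)
  have h1 : localMap E E' f x (f x) ∘ extChartAt 𝓘(ℝ, E) x =ᶠ[𝓝 x]
      extChartAt 𝓘(ℝ, E') (f x) ∘ f := by
    filter_upwards [(isOpen_extChartAt_source x).mem_nhds hx] with w hw
    simp only [localMap, Function.comp_apply, (extChartAt 𝓘(ℝ, E) x).left_inv hw]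
  have h2 := tmap_congr (E := E) (E' := E') h1
  rw [tmap_comp (hl.differentiableAt (by simp)).mdifferentiableAt (mdiff_chart hx),
    tmap_comp (mdiff_chart hy) (hf.mdifferentiableAt (by simp)), tmap_eq_fderiv] at h2
  rw [extD, (chartRep_pullback_eventuallyEq hx hf hy β).extDeriv_eq,
    extDeriv_pullback hβ' hl minSmoothness_le_top, extD, e0]
  ext v
  have : ∀ u, fderiv ℝ (localMap E E' f x (f x)) (extChartAt 𝓘(ℝ, E) x x)
    (tmap E E (extChartAt 𝓘(ℝ, E) x) x u) = _ := fun u => DFunLike.congr_fun h2 u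
  change extDeriv _ _ (fun i => fderiv ℝ (localMap E E' f x (f x)) (extChartAt 𝓘(ℝ, E) x x)
    (tmap E E (extChartAt 𝓘(ℝ, E) x) x (v i))) = _
  simp only [this]
  rfl

section FD
variable [FiniteDimensional ℝ E] [FiniteDimensional ℝ F] {k : ℕ} {β : M → E [⋀^Fin k]→L[ℝ] F}

/-- Smoothness at a point can be tested in any chart. -/
theorem SmoothFormAt.contDiffAt_chartRep {x : M} {z : E}
    (hz : z ∈ (extChartAt 𝓘(ℝ, E) x).target)
    (hβ : SmoothFormAt β ((extChartAt 𝓘(ℝ, E) x).symm z)) : ContDiffAt ℝ ∞ (chartRep β x) z :=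
  smoothFormAt_self_iff.1 (hβ.pullback (contMDiffAt_chart_symm hz))

theorem isSmoothForm_iff : IsSmoothForm β ↔ ∀ x, SmoothFormAt β x :=
  ⟨fun h x => (h x).contDiffAt ((isOpen_extChartAt_target x).mem_nhds (mem_extChartAt_target x)),
    fun h _ _ hz => ((h _).contDiffAt_chartRep hz).contDiffWithinAt⟩

/-- The exterior derivative of a form on `M`, defined at each point through the chart around that
point, can be computed in any chart. -/
theorem extDeriv_chartRep {x : M} {z : E} (hz : z ∈ (extChartAt 𝓘(ℝ, E) x).target)
    (hβ : SmoothFormAt β ((extChartAt 𝓘(ℝ, E) x).symm z)) :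
    extDeriv (chartRep β x) z = chartRep (extD β) x z := by
  rw [← extD_self]
  exact extD_pullback hβ (contMDiffAt_chart_symm hz)

theorem IsSmoothForm.extD (hβ : IsSmoothForm β) : IsSmoothForm (extD β) := by
  rw [isSmoothForm_iff] at hβ ⊢
  intro x
  refine ContDiffAt.congr_of_eventuallyEq (contDiffAt_extDeriv (hβ x)) ?_
  filter_upwards [eventually_target (mem_extChartAt_source (I := 𝓘(ℝ, E)) x)] with z hz
  exact (extDeriv_chartRep hz (hβ _)).symm

end FD

section Operations
variable {k : ℕ} {α β : M → E [⋀^Fin k]→L[ℝ] F} {x : M}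

theorem SmoothFormAt.congr (hβ : SmoothFormAt β x) (h : α =ᶠ[𝓝 x] β) : SmoothFormAt α x := by
  refine ContDiffAt.congr_of_eventuallyEq hβ ?_
  filter_upwards [(tendsto_chart_symm (mem_extChartAt_source (I := 𝓘(ℝ, E)) x)).eventually h]
    with z hz
  simp only [chartRep, PrimitiveYM.pullback, hz]

theorem extD_congr (h : α =ᶠ[𝓝 x] β) : extD α x = extD β x := by
  have : chartRep α x =ᶠ[𝓝 (extChartAt 𝓘(ℝ, E) x x)] chartRep β x := by
    filter_upwards [(tendsto_chart_symm (mem_extChartAt_source (I := 𝓘(ℝ, E)) x)).eventually h]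
      with z hz
    simp only [chartRep, PrimitiveYM.pullback, hz]
  rw [extD, this.extDeriv_eq, extD]

theorem SmoothFormAt.add (hα : SmoothFormAt α x) (hβ : SmoothFormAt β x) :
    SmoothFormAt (α + β) x := ContDiffAt.add hα hβ

theorem SmoothFormAt.const_smul (c : ℝ) (hβ : SmoothFormAt β x) : SmoothFormAt (c • β) x :=
  ContDiffAt.const_smul c hβ

theorem SmoothFormAt.zero : SmoothFormAt (0 : M → E [⋀^Fin k]→L[ℝ] F) x :=
  contDiffAt_const (c := (0 : E [⋀^Fin k]→L[ℝ] F))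

theorem SmoothFormAt.smul {f : M → ℝ} (hf : ContMDiffAt 𝓘(ℝ, E) 𝓘(ℝ, ℝ) ∞ f x)
    (hβ : SmoothFormAt β x) : SmoothFormAt (fun y => f y • β y) x := by
  have h1 : ContDiffAt ℝ ∞ (f ∘ (extChartAt 𝓘(ℝ, E) x).symm) (extChartAt 𝓘(ℝ, E) x x) := by
    refine ContMDiffAt.contDiffAt (ContMDiffAt.comp _ ?_ (contMDiffAt_chart_symm
      (mem_extChartAt_target x)))
    rwa [extChartAt_to_inv]
  exact ContDiffAt.smul h1 hβ

theorem extD_add (hα : SmoothFormAt α x) (hβ : SmoothFormAt β x) :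
    extD (α + β) x = extD α x + extD β x := by
  have : chartRep (α + β) x = chartRep α x + chartRep β x := rfl
  rw [extD, this, extDeriv_add (hα.differentiableAt (by simp)) (hβ.differentiableAt (by simp))]
  rfl

theorem extD_const_smul (c : ℝ) : extD (c • β) x = c • extD β x := by
  have : chartRep (c • β) x = c • chartRep β x := rfl
  rw [extD, this, extDeriv_smul]
  rfl

theorem extD_zero : extD (0 : M → E [⋀^Fin k]→L[ℝ] F) x = 0 := by
  have : chartRep (0 : M → E [⋀^Fin k]→L[ℝ] F) x = fun _ => 0 := rfl
  rw [extD, this]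
  simp only [extDeriv, fderiv_fun_const, Pi.zero_apply]
  exact map_zero (ContinuousAlternatingMap.compContinuousLinearMapCLM (tmap E E _ x) ∘L
    ContinuousAlternatingMap.alternatizeUncurryFinCLM ℝ E F)

theorem extD_postcomp {F' : Type*} [NormedAddCommGroup F'] [NormedSpace ℝ F']
    (L : F →L[ℝ] F') (hβ : SmoothFormAt β x) :
    extD (fun y => L.compContinuousAlternatingMap (β y)) x =
      L.compContinuousAlternatingMap (extD β x) := by
  have h :=
    (ContinuousLinearMap.compContinuousAlternatingMapCLM ℝ E F F' (Fin k) L).hasFDerivAt.comp _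
      (hβ.differentiableAt (by simp)).hasFDerivAt
  have e : chartRep (fun y => L.compContinuousAlternatingMap (β y)) x =
    fun y => L.compContinuousAlternatingMap (chartRep β x y) := rfl
  rw [extD, e, extDeriv]
  erw [h.fderiv]
  ext v
  change ContinuousAlternatingMap.alternatizeUncurryFin _ _ = L (extDeriv _ _ _)
  rw [extDeriv, ContinuousAlternatingMap.alternatizeUncurryFin_apply,
    ContinuousAlternatingMap.alternatizeUncurryFin_apply, map_sum]
  refine Finset.sum_congr rfl fun i _ => ?_
  rw [map_zsmul]
  rfl

theorem wedgeOne_comp {V V' : Type*} [NormedAddCommGroup V] [NormedSpace ℝ V]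
    [NormedAddCommGroup V'] [NormedSpace ℝ V'] (κ : F →L[ℝ] F →L[ℝ] ℝ) {l : ℕ}
    (a : V [⋀^Fin 1]→L[ℝ] F) (γ : V [⋀^Fin l]→L[ℝ] F) (L : V' →L[ℝ] V) :
    (wedgeOne κ (ofOneForm a) γ).compContinuousLinearMap L =
      wedgeOne κ (ofOneForm (a.compContinuousLinearMap L)) (γ.compContinuousLinearMap L) := by
  ext v
  change wedgeOne κ (ofOneForm a) γ (fun i => L (v i)) = _
  rw [wedgeOne_apply, wedgeOne_apply]
  rfl

theorem wedgePair_comp {V V' : Type*} [NormedAddCommGroup V] [NormedSpace ℝ V]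
    [NormedAddCommGroup V'] [NormedSpace ℝ V'] (κ : F →L[ℝ] F →L[ℝ] ℝ) {l : ℕ}
    (a : V [⋀^Fin 2]→L[ℝ] F) (γ : V [⋀^Fin l]→L[ℝ] F) (L : V' →L[ℝ] V) :
    (wedgePair κ a γ).compContinuousLinearMap L =
      wedgePair κ (a.compContinuousLinearMap L) (γ.compContinuousLinearMap L) := by
  ext v
  change wedgePair κ a γ (fun i => L (v i)) = _
  rw [wedgePair_apply, wedgePair_apply]
  congr 1
  refine Finset.sum_congr rfl fun i _ => ?_
  congr 1
  refine Finset.sum_congr rfl fun j _ => ?_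
  congr 2
  congr 1
  change a _ = a _
  congr 1
  funext i
  fin_cases i <;> rfl

theorem SmoothFormAt.wedgeOne [FiniteDimensional ℝ E] (κ : F →L[ℝ] F →L[ℝ] ℝ)
    {a : M → E [⋀^Fin 1]→L[ℝ] F} (ha : SmoothFormAt a x) (hβ : SmoothFormAt β x) :
    SmoothFormAt (fun y => wedgeOne κ (ofOneForm (a y)) (β y)) x := by
  have : chartRep (fun y => PrimitiveYM.wedgeOne κ (ofOneForm (a y)) (β y)) x =
      fun z => PrimitiveYM.wedgeOne κ (ofOneForm (chartRep a x z)) (chartRep β x z) :=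
    funext fun z => wedgeOne_comp κ _ _ _
  rw [SmoothFormAt, this]
  exact contDiffAt_wedgeOne κ ha hβ

/-- The Leibniz rule on a manifold. -/
theorem extD_wedgeOne (κ : F →L[ℝ] F →L[ℝ] ℝ)
    {a : M → E [⋀^Fin 1]→L[ℝ] F} (ha : SmoothFormAt a x) (hβ : SmoothFormAt β x) :
    extD (fun y => PrimitiveYM.wedgeOne κ (ofOneForm (a y)) (β y)) x =
      wedgePair κ (extD a x) (β x) - PrimitiveYM.wedgeOne κ (ofOneForm (a x)) (extD β x) := by
  have e : chartRep (fun y => PrimitiveYM.wedgeOne κ (ofOneForm (a y)) (β y)) x =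
      fun z => PrimitiveYM.wedgeOne κ (ofOneForm (chartRep a x z)) (chartRep β x z) :=
    funext fun z => wedgeOne_comp κ _ _ _
  have e2 : ∀ {j : ℕ} (γ : M → E [⋀^Fin j]→L[ℝ] F),
      (chartRep γ x (extChartAt 𝓘(ℝ, E) x x)).compContinuousLinearMap
        (tmap E E (extChartAt 𝓘(ℝ, E) x) x) = γ x := by
    intro j γ
    ext v
    have h := tmap_symm_comp_chart (mem_extChartAt_source (I := 𝓘(ℝ, E)) x)
    change γ _ (fun i => (tmap E E (extChartAt 𝓘(ℝ, E) x).symm (extChartAt 𝓘(ℝ, E) x x) ∘L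
      tmap E E (extChartAt 𝓘(ℝ, E) x) x) (v i)) = _
    rw [h, extChartAt_to_inv]
    rfl
  have h := extDeriv_wedgeOne κ (ha.differentiableAt (by simp)) (hβ.differentiableAt (by simp))
  rw [extD, e, h]
  have e3 : ∀ (p q : E [⋀^Fin (k + 2)]→L[ℝ] ℝ) (L : E →L[ℝ] E),
    (p - q).compContinuousLinearMap L =
      p.compContinuousLinearMap L - q.compContinuousLinearMap L := fun _ _ _ => rfl
  rw [e3, wedgePair_comp, wedgeOne_comp, e2, e2]
  rfl

end Operations
end Tangent

/-! ### Principal bundles and horizontal lifts -/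

section PrincipalBundle
variable {E : Type*} [NormedAddCommGroup E] [NormedSpace ℝ E]
  {M : Type*} [TopologicalSpace M] [ChartedSpace E M] [IsManifold 𝓘(ℝ, E) ∞ M]
  {𝔤 : Type*} [NormedAddCommGroup 𝔤] [NormedSpace ℝ 𝔤]
  {G : Type*} [TopologicalSpace G] [ChartedSpace 𝔤 G] [Group G] [LieGroup 𝓘(ℝ, 𝔤) ∞ G]
  {EP : Type*} [NormedAddCommGroup EP] [NormedSpace ℝ EP]
  {P : Type*} [TopologicalSpace P] [ChartedSpace EP P] [IsManifold 𝓘(ℝ, EP) ∞ P]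
  [MulAction Gᵐᵒᵖ P] {π : P → M}

theorem rightMul_one (p : P) : rightMul (1 : G) p = p := by
  simp [rightMul]

variable (hπ : IsPrincipalBundle E 𝔤 EP G π)
include hπ

theorem IsPrincipalBundle.contMDiff_rightMul (g : G) :
    ContMDiff 𝓘(ℝ, EP) 𝓘(ℝ, EP) ∞ (rightMul g : P → P) :=
  hπ.smooth_action.comp (contMDiff_id.prodMk contMDiff_const)

theorem IsPrincipalBundle.contMDiff_orbit (p : P) :
    ContMDiff 𝓘(ℝ, 𝔤) 𝓘(ℝ, EP) ∞ (fun g : G => rightMul g p) :=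
  hπ.smooth_action.comp (contMDiff_const.prodMk contMDiff_id)

theorem IsPrincipalBundle.mdiff_proj (p : P) : MDifferentiableAt 𝓘(ℝ, EP) 𝓘(ℝ, E) π p :=
  hπ.smooth_proj.contMDiffAt.mdifferentiableAt (by simp)

theorem IsPrincipalBundle.mdiff_rightMul (g : G) (p : P) :
    MDifferentiableAt 𝓘(ℝ, EP) 𝓘(ℝ, EP) (rightMul g : P → P) p :=
  (hπ.contMDiff_rightMul g).contMDiffAt.mdifferentiableAt (by simp)

theorem IsPrincipalBundle.mdiff_orbit (p : P) (g : G) :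
    MDifferentiableAt 𝓘(ℝ, 𝔤) 𝓘(ℝ, EP) (fun g : G => rightMul g p) g :=
  (hπ.contMDiff_orbit p).contMDiffAt.mdifferentiableAt (by simp)

theorem IsPrincipalBundle.proj_rightMul (g : G) (p : P) : π (rightMul g p) = π p :=
  hπ.proj_action p g

theorem IsPrincipalBundle.tmap_proj_rightMul (g : G) (p : P) (v : EP) :
    tmap EP E π (rightMul g p) (tmap EP EP (rightMul g) p v) = tmap EP E π p v := by
  have h := tmap_comp (hπ.mdiff_proj (rightMul g p)) (hπ.mdiff_rightMul g p)
  have e : π ∘ rightMul g = π := funext fun q => hπ.proj_action q g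
  rw [e] at h
  exact (DFunLike.congr_fun h v).symm

theorem IsPrincipalBundle.tmap_proj_fundamental (p : P) (ξ : 𝔤) :
    tmap EP E π p (fundamental G EP p ξ) = 0 := by
  have h1 : MDifferentiableAt 𝓘(ℝ, EP) 𝓘(ℝ, E) π (rightMul (1 : G) p) := hπ.mdiff_proj _
  have h := tmap_comp (f := fun g : G => rightMul g p) h1 (hπ.mdiff_orbit p 1)
  have e : (π ∘ fun g : G => rightMul g p) = fun _ => π p := funext fun g => hπ.proj_action p g
  rw [e, tmap_const] at h
  have := (DFunLike.congr_fun h ξ).symm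
  simp only [rightMul_one] at this
  exact this

theorem IsPrincipalBundle.surjective : Function.Surjective π := by
  intro x
  obtain ⟨U, -, hx, Φ, hs, ht, -, -, hfst, -⟩ := hπ.locally_trivial x
  have h : (x, (1 : G)) ∈ Φ.target := by rw [ht]; exact ⟨hx, trivial⟩
  refine ⟨Φ.symm (x, 1), ?_⟩
  rw [← hfst _ (Φ.map_target h), Φ.right_inv h]

/-- The fibres are the orbits of the structure group. -/
theorem IsPrincipalBundle.exists_rightMul {p q : P} (h : π p = π q) :
    ∃ g : G, rightMul g p = q := by
  obtain ⟨U, -, hx, Φ, hs, ht, -, -, hfst, hmul⟩ := hπ.locally_trivial (π p)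
  have hp : p ∈ Φ.source := by rw [hs]; exact hx
  have hq : q ∈ Φ.source := by rw [hs, Set.mem_preimage, ← h]; exact hx
  refine ⟨(Φ p).2⁻¹ * (Φ q).2, ?_⟩
  have hpg : rightMul ((Φ p).2⁻¹ * (Φ q).2) p ∈ Φ.source := by
    rw [hs, Set.mem_preimage, hπ.proj_action]; exact hx
  apply Φ.injOn hpg hq
  rw [hmul p hp, mul_inv_cancel_left, hfst p hp, h, ← hfst q hq]

/-- Local sections exist through every point. -/
theorem IsPrincipalBundle.exists_section (p : P) : ∃ s : M → P, s (π p) = p ∧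
    (∀ᶠ x in 𝓝 (π p), π (s x) = x) ∧ ContMDiffAt 𝓘(ℝ, E) 𝓘(ℝ, EP) ∞ s (π p) := by
  obtain ⟨U, hU, hx, Φ, hs, ht, -, hsymm, hfst, -⟩ := hπ.locally_trivial (π p)
  have hp : p ∈ Φ.source := by rw [hs]; exact hx
  refine ⟨fun x => Φ.symm (x, (Φ p).2), ?_, ?_, ?_⟩
  · rw [← hfst p hp]
    exact Φ.left_inv hp
  · filter_upwards [hU.mem_nhds hx] with x hx
    have h : (x, (Φ p).2) ∈ Φ.target := by rw [ht]; exact ⟨hx, trivial⟩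
    rw [← hfst _ (Φ.map_target h), Φ.right_inv h]
  · have h : (π p, (Φ p).2) ∈ Φ.target := by rw [ht]; exact ⟨hx, trivial⟩
    have h1 := hsymm.contMDiffAt (Φ.open_target.mem_nhds h)
    exact ContMDiffAt.comp (π p) (g := Φ.symm) (f := fun x => (x, (Φ p).2)) h1
      (contMDiffAt_id.prodMk contMDiffAt_const)

/-- Vertical vectors are values of fundamental vector fields. -/
theorem IsPrincipalBundle.exists_fundamental {p : P} {v : EP} (hv : tmap EP E π p v = 0) :
    ∃ ξ : 𝔤, fundamental G EP p ξ = v := by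
  obtain ⟨U, hU, hx, Φ, hs, ht, hsm, hsymm, hfst, hmul⟩ := hπ.locally_trivial (π p)
  have hp : p ∈ Φ.source := by rw [hs]; exact hx
  set a := (Φ p).2 with ha
  have hT : (π p, a) ∈ Φ.target := by rw [ht]; exact ⟨hx, trivial⟩
  have hΦp : Φ p = (π p, a) := Prod.ext (hfst p hp) rfl
  have hΦ : MDifferentiableAt 𝓘(ℝ, EP) (𝓘(ℝ, E).prod 𝓘(ℝ, 𝔤)) Φ p :=
    (hsm.contMDiffAt (Φ.open_source.mem_nhds hp)).mdifferentiableAt (by simp)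
  have hΨ : MDifferentiableAt (𝓘(ℝ, E).prod 𝓘(ℝ, 𝔤)) 𝓘(ℝ, EP) Φ.symm (π p, a) :=
    (hsymm.contMDiffAt (Φ.open_target.mem_nhds hT)).mdifferentiableAt (by simp)
  have h2 : MDifferentiableAt 𝓘(ℝ, EP) 𝓘(ℝ, 𝔤) (fun q => (Φ q).2) p :=
    mdifferentiableAt_snd.comp p hΦ
  have hpair : MDifferentiableAt 𝓘(ℝ, EP) (𝓘(ℝ, E).prod 𝓘(ℝ, 𝔤)) (fun q => (π q, (Φ q).2)) p :=
    (hπ.mdiff_proj p).prodMk h2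
  have e1 : (Φ.symm ∘ fun q => (π q, (Φ q).2)) =ᶠ[𝓝 p] fun q => q := by
    filter_upwards [Φ.open_source.mem_nhds hp] with q hq
    have : (π q, (Φ q).2) = Φ q := Prod.ext (hfst q hq).symm rfl
    simp only [Function.comp_apply, this]
    exact Φ.left_inv hq
  set w : 𝔤 := tmap EP 𝔤 (fun q => (Φ q).2) p v with hw
  have e2 : mfderiv (𝓘(ℝ, E).prod 𝓘(ℝ, 𝔤)) 𝓘(ℝ, EP) Φ.symm (π p, a) ((0 : E), w) = v := by
    have h3 := mfderiv_comp p (I := 𝓘(ℝ, EP)) (I' := 𝓘(ℝ, E).prod 𝓘(ℝ, 𝔤)) (I'' := 𝓘(ℝ, EP))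
      (g := Φ.symm) (f := fun q => (π q, (Φ q).2)) hΨ hpair
    rw [e1.mfderiv_eq, mfderiv_prodMk (hπ.mdiff_proj p) h2] at h3
    have h4 := (DFunLike.congr_fun h3 v).symm
    rw [show mfderiv 𝓘(ℝ, EP) 𝓘(ℝ, EP) (fun q : P => q) p = ContinuousLinearMap.id ℝ _ from
      mfderiv_id] at h4
    have h5 : ((mfderiv 𝓘(ℝ, EP) 𝓘(ℝ, E) π p).prod
        (mfderiv 𝓘(ℝ, EP) 𝓘(ℝ, 𝔤) (fun q => (Φ q).2) p)) v = ((0 : E), w) := Prod.ext hv rfl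
    exact (congrArg (mfderiv (𝓘(ℝ, E).prod 𝓘(ℝ, 𝔤)) 𝓘(ℝ, EP) Φ.symm (π p, a)) h5).symm.trans h4
  have e3 : mfderiv (𝓘(ℝ, E).prod 𝓘(ℝ, 𝔤)) 𝓘(ℝ, EP) Φ.symm (π p, a) ((0 : E), w) =
      tmap 𝔤 EP (fun c => Φ.symm (π p, c)) a w := by
    refine (mfderiv_prod_eq_add_apply hΨ).trans ?_
    change tmap E EP (fun x => Φ.symm (x, a)) (π p) 0 + tmap 𝔤 EP (fun c => Φ.symm (π p, c)) a w = _
    rw [map_zero, zero_add]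
  have e4 : (fun c => Φ.symm (π p, c)) =
      (fun c : G => rightMul c p) ∘ fun c => a⁻¹ * c := by
    funext c
    have hc : (π p, c) ∈ Φ.target := by rw [ht]; exact ⟨hx, trivial⟩
    have hpg : rightMul (a⁻¹ * c) p ∈ Φ.source := by
      rw [hs, Set.mem_preimage, hπ.proj_action]; exact hx
    apply Φ.injOn (Φ.map_target hc) hpg
    rw [Φ.right_inv hc, hmul p hp, hfst p hp, mul_inv_cancel_left]
  have h6 : MDifferentiableAt 𝓘(ℝ, 𝔤) 𝓘(ℝ, 𝔤) (fun c : G => a⁻¹ * c) a :=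
    (contMDiff_mul_left (I := 𝓘(ℝ, 𝔤)) (n := ∞)).contMDiffAt.mdifferentiableAt (by simp)
  refine ⟨tmap 𝔤 𝔤 (fun c : G => a⁻¹ * c) a w, ?_⟩
  rw [← e2, e3, e4, tmap_comp (hπ.mdiff_orbit p _) h6]
  simp only [inv_mul_cancel]
  rfl

variable {A : P → EP →L[ℝ] 𝔤} (hA : IsConnection G A)
include hA

theorem IsConnection.bijective (p : P) :
    Function.Bijective ((tmap EP E π p).prod (A p)) := by
  constructor
  · rw [injective_iff_map_eq_zero]
    intro v hv
    obtain ⟨ξ, rfl⟩ := hπ.exists_fundamental (congrArg Prod.fst hv : tmap EP E π p v = 0)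
    have : A p (fundamental G EP p ξ) = 0 := congrArg Prod.snd hv
    rw [hA.reproduces] at this
    rw [this]
    exact map_zero (tmap 𝔤 EP (fun g : G => rightMul g p) 1)
  · rintro ⟨u, ξ⟩
    obtain ⟨s, hsp, hs, hsm⟩ := hπ.exists_section p
    have hm := hsm.mdifferentiableAt (n := ∞) (by simp)
    have h1 : MDifferentiableAt 𝓘(ℝ, EP) 𝓘(ℝ, E) π (s (π p)) := hπ.mdiff_proj _
    have h := tmap_comp h1 hm
    rw [tmap_congr (f := π ∘ s) (h := fun x => x) hs, tmap_id, hsp] at h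
    refine ⟨tmap E EP s (π p) u + fundamental G EP p (ξ - A p (tmap E EP s (π p) u)), ?_⟩
    refine Prod.ext ?_ ?_
    · change tmap EP E π p (_ + _) = u
      rw [map_add, hπ.tmap_proj_fundamental, add_zero]
      exact (DFunLike.congr_fun h u).symm
    · change A p (_ + _) = ξ
      rw [map_add, hA.reproduces]
      abel

variable [FiniteDimensional ℝ E] [FiniteDimensional ℝ 𝔤] [FiniteDimensional ℝ EP]

/-- The decomposition `T_p P = T_{π p} M ⊕ 𝔤` given by a connection. -/
def splitEquiv (p : P) : EP ≃L[ℝ] E × 𝔤 :=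
  (LinearEquiv.ofBijective ((tmap EP E π p).prod (A p)).toLinearMap
    (IsConnection.bijective hπ hA p)).toContinuousLinearEquiv

theorem coe_splitEquiv (p : P) :
    (splitEquiv hπ hA p : EP →L[ℝ] E × 𝔤) = (tmap EP E π p).prod (A p) := rfl

theorem horizontalLift_eq (p : P) (u : E) :
    horizontalLift π A p u = (splitEquiv hπ hA p).symm (u, 0) := by
  rw [horizontalLift, ← coe_splitEquiv hπ hA p, ContinuousLinearMap.inverse_equiv]
  rfl

theorem tmap_proj_horizontalLift (p : P) (u : E) :
    tmap EP E π p (horizontalLift π A p u) = u := by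
  rw [horizontalLift_eq hπ hA]
  exact congrArg Prod.fst ((splitEquiv hπ hA p).apply_symm_apply (u, 0))

theorem connection_horizontalLift (p : P) (u : E) : A p (horizontalLift π A p u) = 0 := by
  rw [horizontalLift_eq hπ hA]
  exact congrArg Prod.snd ((splitEquiv hπ hA p).apply_symm_apply (u, 0))

theorem eq_horizontalLift {p : P} {u : E} {v : EP} (h1 : tmap EP E π p v = u) (h2 : A p v = 0) :
    v = horizontalLift π A p u := by
  rw [horizontalLift_eq hπ hA, ContinuousLinearEquiv.eq_symm_apply]
  exact Prod.ext h1 h2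

theorem horizontalLift_rightMul (g : G) (p : P) (u : E) :
    horizontalLift π A (rightMul g p) u =
      tmap EP EP (rightMul g) p (horizontalLift π A p u) := by
  refine (eq_horizontalLift hπ hA ?_ ?_).symm
  · rw [hπ.tmap_proj_rightMul, tmap_proj_horizontalLift hπ hA]
  · rw [hA.equivariant, connection_horizontalLift hπ hA, map_zero]

end PrincipalBundle

/-! ### Coordinate expressions of tangent maps -/

section LocalMap
variable {E : Type*} [NormedAddCommGroup E] [NormedSpace ℝ E]
  {M : Type*} [TopologicalSpace M] [ChartedSpace E M] [IsManifold 𝓘(ℝ, E) ∞ M]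
  {E' : Type*} [NormedAddCommGroup E'] [NormedSpace ℝ E']
  {M' : Type*} [TopologicalSpace M'] [ChartedSpace E' M'] [IsManifold 𝓘(ℝ, E') ∞ M']

theorem fderiv_localMap {f : M → M'} {x : M} {y : M'} {z : E}
    (hz : z ∈ (extChartAt 𝓘(ℝ, E) x).target)
    (hf : MDifferentiableAt 𝓘(ℝ, E) 𝓘(ℝ, E') f ((extChartAt 𝓘(ℝ, E) x).symm z))
    (hy : f ((extChartAt 𝓘(ℝ, E) x).symm z) ∈ (extChartAt 𝓘(ℝ, E') y).source) (v : E) :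
    fderiv ℝ (localMap E E' f x y) z v =
      tmap E' E' (extChartAt 𝓘(ℝ, E') y) (f ((extChartAt 𝓘(ℝ, E) x).symm z))
        (tmap E E' f ((extChartAt 𝓘(ℝ, E) x).symm z)
          (tmap E E (extChartAt 𝓘(ℝ, E) x).symm z v)) := by
  have h1 : MDifferentiableAt 𝓘(ℝ, E) 𝓘(ℝ, E') (f ∘ (extChartAt 𝓘(ℝ, E) x).symm) z :=
    hf.comp z (mdiff_chart_symm hz)
  rw [← tmap_eq_fderiv, localMap,
    tmap_comp (f := f ∘ (extChartAt 𝓘(ℝ, E) x).symm) (mdiff_chart hy) h1,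
    tmap_comp hf (mdiff_chart_symm hz)]
  rfl

end LocalMap

/-! ### Forms with values in `Ad P` -/

section AdForms
variable {E : Type*} [NormedAddCommGroup E] [NormedSpace ℝ E]
  {M : Type*} [TopologicalSpace M] [ChartedSpace E M] [IsManifold 𝓘(ℝ, E) ∞ M]
  {𝔤 : Type*} [NormedAddCommGroup 𝔤] [NormedSpace ℝ 𝔤]
  {G : Type*} [TopologicalSpace G] [ChartedSpace 𝔤 G] [Group G] [LieGroup 𝓘(ℝ, 𝔤) ∞ G]
  {EP : Type*} [NormedAddCommGroup EP] [NormedSpace ℝ EP]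
  {P : Type*} [TopologicalSpace P] [ChartedSpace EP P] [IsManifold 𝓘(ℝ, EP) ∞ P]
  [MulAction Gᵐᵒᵖ P] {π : P → M}
  {F : Type*} [NormedAddCommGroup F] [NormedSpace ℝ F]

/-- The points of the coordinate space of the chart of `P` around `p₀` which correspond to points
over the domain of the chart of `M` around `π p₀`. -/
def IsOver (E EP : Type*) [NormedAddCommGroup E] [NormedSpace ℝ E] [NormedAddCommGroup EP]
    [NormedSpace ℝ EP] [ChartedSpace E M] [ChartedSpace EP P] (π : P → M) (p₀ : P) (z : EP) :
    Prop :=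
  z ∈ (extChartAt 𝓘(ℝ, EP) p₀).target ∧
    π ((extChartAt 𝓘(ℝ, EP) p₀).symm z) ∈ (extChartAt 𝓘(ℝ, E) (π p₀)).source

/-- A family `α p`, `p ∈ P`, of alternating maps on `T_{π p} M`, in coordinates. -/
def locRep (π : P → M) {k : ℕ} (α : P → E [⋀^Fin k]→L[ℝ] F) (p₀ : P) (z : EP) :
    E [⋀^Fin k]→L[ℝ] F :=
  (α ((extChartAt 𝓘(ℝ, EP) p₀).symm z)).compContinuousLinearMap
    (tmap E E (extChartAt 𝓘(ℝ, E) (π p₀)).symm (localMap EP E π p₀ (π p₀) z))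

/-- The horizontal lift of a connection, in coordinates. -/
def locLift (π : P → M) (A : P → EP →L[ℝ] 𝔤) (p₀ : P) (z : EP) : E →L[ℝ] EP :=
  ((fderiv ℝ (localMap EP E π p₀ (π p₀)) z).prod
    (ofOneForm (chartRep (fun p => toOneForm (A p)) p₀ z))).inverse ∘L
      ContinuousLinearMap.inl ℝ E 𝔤

/-- The pull-back to `P` of a family of alternating maps on the spaces `T_{π p} M`. -/
abbrev lift (EP : Type*) [NormedAddCommGroup EP] [NormedSpace ℝ EP] [ChartedSpace EP P]
    (π : P → M) {k : ℕ} (α : P → E [⋀^Fin k]→L[ℝ] F) : P → EP [⋀^Fin k]→L[ℝ] F :=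
  fun p => (α p).compContinuousLinearMap (tmap EP E π p)

theorem localMap_mem {p₀ : P} {z : EP} (hz : IsOver E EP π p₀ z) :
    localMap EP E π p₀ (π p₀) z ∈ (extChartAt 𝓘(ℝ, E) (π p₀)).target :=
  (extChartAt 𝓘(ℝ, E) (π p₀)).map_source hz.2

theorem chart_symm_localMap {p₀ : P} {z : EP} (hz : IsOver E EP π p₀ z) :
    (extChartAt 𝓘(ℝ, E) (π p₀)).symm (localMap EP E π p₀ (π p₀) z) =
      π ((extChartAt 𝓘(ℝ, EP) p₀).symm z) :=
  (extChartAt 𝓘(ℝ, E) (π p₀)).left_inv hz.2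

theorem isOver_self (p₀ : P) : IsOver E EP π p₀ (extChartAt 𝓘(ℝ, EP) p₀ p₀) := by
  refine ⟨mem_extChartAt_target p₀, ?_⟩
  rw [extChartAt_to_inv]
  exact mem_extChartAt_source _

variable (hπ : IsPrincipalBundle E 𝔤 EP G π)
include hπ

theorem eventually_isOver (p₀ : P) :
    ∀ᶠ z in 𝓝 (extChartAt 𝓘(ℝ, EP) p₀ p₀), IsOver E EP π p₀ z := by
  have h1 := mem_extChartAt_source (I := 𝓘(ℝ, EP)) p₀
  have h2 : ∀ᶠ q in 𝓝 p₀, π q ∈ (extChartAt 𝓘(ℝ, E) (π p₀)).source :=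
    hπ.smooth_proj.continuous.continuousAt.preimage_mem_nhds
      ((isOpen_extChartAt_source (π p₀)).mem_nhds (mem_extChartAt_source _))
  exact (eventually_target h1).and ((tendsto_chart_symm h1).eventually h2)

theorem contDiffAt_localMap_proj (p₀ : P) :
    ContDiffAt ℝ ∞ (localMap EP E π p₀ (π p₀)) (extChartAt 𝓘(ℝ, EP) p₀ p₀) :=
  have h0 : IsOver E EP π p₀ _ := isOver_self p₀
  contDiffAt_localMap h0.1 hπ.smooth_proj.contMDiffAt h0.2

theorem chartRep_lift {p₀ : P} {z : EP} (hz : IsOver E EP π p₀ z) {k : ℕ}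
    (α : P → E [⋀^Fin k]→L[ℝ] F) :
    chartRep (lift EP π α) p₀ z =
      (locRep π α p₀ z).compContinuousLinearMap (fderiv ℝ (localMap EP E π p₀ (π p₀)) z) := by
  ext v
  change α _ (fun i => tmap EP E π _ (tmap EP EP _ z (v i))) =
    α _ (fun i => tmap E E _ _ (fderiv ℝ (localMap EP E π p₀ (π p₀)) z (v i)))
  congr 1
  funext i
  rw [fderiv_localMap hz.1 (hπ.mdiff_proj _) hz.2]
  exact (DFunLike.congr_fun (tmap_symm_comp_chart hz.2) _).symm

variable {A : P → EP →L[ℝ] 𝔤} (hA : IsConnection G A)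
variable [FiniteDimensional ℝ E] [FiniteDimensional ℝ 𝔤] [FiniteDimensional ℝ EP]
include hA

/-- The splitting given by a connection, in coordinates. -/
def locSplit {p₀ : P} {z : EP} (hz : IsOver E EP π p₀ z) : EP ≃L[ℝ] E × 𝔤 :=
  ((chartEquiv hz.1).trans (splitEquiv hπ hA ((extChartAt 𝓘(ℝ, EP) p₀).symm z))).trans
    ((chartEquiv (localMap_mem hz)).symm.prodCongr (ContinuousLinearEquiv.refl ℝ 𝔤))

theorem coe_locSplit {p₀ : P} {z : EP} (hz : IsOver E EP π p₀ z) :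
    (locSplit hπ hA hz : EP →L[ℝ] E × 𝔤) = (fderiv ℝ (localMap EP E π p₀ (π p₀)) z).prod
      (ofOneForm (chartRep (fun p => toOneForm (A p)) p₀ z)) := by
  ext1 v
  refine Prod.ext ?_ rfl
  change tmap E E (extChartAt 𝓘(ℝ, E) (π p₀)) ((extChartAt 𝓘(ℝ, E) (π p₀)).symm
    (localMap EP E π p₀ (π p₀) z)) (tmap EP E π _ (tmap EP EP _ z v)) = fderiv ℝ _ z v
  rw [fderiv_localMap hz.1 (hπ.mdiff_proj _) hz.2, chart_symm_localMap hz]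

theorem tmap_locLift {p₀ : P} {z : EP} (hz : IsOver E EP π p₀ z) (u : E) :
    tmap EP EP (extChartAt 𝓘(ℝ, EP) p₀).symm z (locLift π A p₀ z u) =
      horizontalLift π A ((extChartAt 𝓘(ℝ, EP) p₀).symm z)
        (tmap E E (extChartAt 𝓘(ℝ, E) (π p₀)).symm (localMap EP E π p₀ (π p₀) z) u) := by
  rw [locLift, ← coe_locSplit hπ hA hz, ContinuousLinearMap.inverse_equiv,
    horizontalLift_eq hπ hA]
  change chartEquiv hz.1 ((chartEquiv hz.1).symm _) = _
  rw [ContinuousLinearEquiv.apply_symm_apply]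
  rfl

theorem contDiffAt_locLift (p₀ : P) :
    ContDiffAt ℝ ∞ (locLift (E := E) π A p₀) (extChartAt 𝓘(ℝ, EP) p₀ p₀) := by
  have h0 : IsOver E EP π p₀ _ := isOver_self p₀
  have h1 : ContDiffAt ℝ ∞ (fun z => (fderiv ℝ (localMap EP E π p₀ (π p₀)) z).prod
      (ofOneForm (chartRep (fun p => toOneForm (A p)) p₀ z))) (extChartAt 𝓘(ℝ, EP) p₀ p₀) := by
    refine
      (ContinuousLinearMap.prodₗᵢ ℝ (𝕜 := ℝ) (E := EP) (F := E) (G := 𝔤)).contDiff.contDiffAt.comp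
      _ (ContDiffAt.prodMk ((contDiffAt_localMap_proj hπ p₀).fderiv_right (m := ∞) (by simp)) ?_)
    exact (ofOneFormCLM (V := EP) (F := 𝔤)).contDiff.contDiffAt.comp _
      (isSmoothForm_iff.1 hA.smooth p₀)
  have h2 : ContDiffAt ℝ ∞ (ContinuousLinearMap.inverse (R := ℝ) (M := EP) (M₂ := E × 𝔤))
      ((fderiv ℝ (localMap EP E π p₀ (π p₀)) (extChartAt 𝓘(ℝ, EP) p₀ p₀)).prod
      (ofOneForm (chartRep (fun p => toOneForm (A p)) p₀ (extChartAt 𝓘(ℝ, EP) p₀ p₀)))) := by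
    rw [← coe_locSplit hπ hA h0]
    exact contDiffAt_map_inverse _
  have h3 : ContDiffAt ℝ ∞ (fun z => ((fderiv ℝ (localMap EP E π p₀ (π p₀)) z).prod
      (ofOneForm (chartRep (fun p => toOneForm (A p)) p₀ z))).inverse)
      (extChartAt 𝓘(ℝ, EP) p₀ p₀) :=
    ContDiffAt.comp (g := ContinuousLinearMap.inverse) (extChartAt 𝓘(ℝ, EP) p₀ p₀) h2 h1
  exact h3.clm_comp (contDiffAt_const (c := ContinuousLinearMap.inl ℝ E 𝔤))

theorem locRep_eq {p₀ : P} {z : EP} (hz : IsOver E EP π p₀ z) {k : ℕ}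
    (α : P → E [⋀^Fin k]→L[ℝ] F) :
    locRep π α p₀ z =
      (chartRep (lift EP π α) p₀ z).compContinuousLinearMap (locLift π A p₀ z) := by
  ext v
  change α _ (fun i => tmap E E _ _ (v i)) =
    α _ (fun i => tmap EP E π _ (tmap EP EP _ z (locLift π A p₀ z (v i))))
  congr 1
  funext i
  rw [tmap_locLift hπ hA hz, tmap_proj_horizontalLift hπ hA]

/-- Smoothness of the lift to `P` of a form along `π` is smoothness of its coordinate expression.
The expression is recovered from the lift by the horizontal lift of a connection, which is smooth.
-/
theorem smoothFormAt_lift_iff [FiniteDimensional ℝ F] {p₀ : P} {k : ℕ}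
    {α : P → E [⋀^Fin k]→L[ℝ] F} :
    SmoothFormAt (lift EP π α) p₀ ↔
      ContDiffAt ℝ ∞ (locRep π α p₀) (extChartAt 𝓘(ℝ, EP) p₀ p₀) := by
  constructor
  · intro h
    refine ContDiffAt.congr_of_eventuallyEq
      (contDiffAt_compContinuousLinearMap h (contDiffAt_locLift (E := E) hπ hA p₀)) ?_
    filter_upwards [eventually_isOver hπ p₀] with z hz
    exact locRep_eq hπ hA hz α
  · intro h
    refine ContDiffAt.congr_of_eventuallyEq (contDiffAt_compContinuousLinearMap h
      ((contDiffAt_localMap_proj hπ p₀).fderiv_right (m := ∞) (by simp))) ?_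
    filter_upwards [eventually_isOver hπ p₀] with z hz
    exact chartRep_lift hπ hz α

/-- A smooth equivariant form on `P`, restricted to horizontal vectors, is a form on `M` with
values in `Ad P`. -/
theorem isAdForm_horizontal {k : ℕ} {Θ : P → EP [⋀^Fin k]→L[ℝ] 𝔤} (hΘ : IsSmoothForm Θ)
    (heq : ∀ (g : G) (p : P), pullback EP (rightMul g) Θ p =
      (Ad g⁻¹ : 𝔤 →L[ℝ] 𝔤).compContinuousAlternatingMap (Θ p)) :
    IsAdForm (EP := EP) G π
      (fun p => (Θ p).compContinuousLinearMap (horizontalLift (E := E) π A p)) := by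
  constructor
  · rw [isSmoothForm_iff] at hΘ ⊢
    intro p₀
    refine (smoothFormAt_lift_iff hπ hA).2 (ContDiffAt.congr_of_eventuallyEq
      (contDiffAt_compContinuousLinearMap (hΘ p₀) (contDiffAt_locLift (E := E) hπ hA p₀)) ?_)
    filter_upwards [eventually_isOver hπ p₀] with z hz
    ext v
    change Θ _ (fun i => horizontalLift π A _ (tmap E E _ _ (v i))) =
      Θ _ (fun i => tmap EP EP _ z (locLift π A p₀ z (v i)))
    congr 1
    funext i
    exact (tmap_locLift hπ hA hz _).symm
  · intro g p
    ext v
    have h := DFunLike.congr_fun (heq g p) (fun i => horizontalLift π A p (v i))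
    change Θ _ (fun i => tmap EP EP (rightMul g) p (horizontalLift π A p (v i))) = _ at h
    change Θ _ (fun i => horizontalLift π A (rightMul g p) (v i)) = _
    simp only [horizontalLift_rightMul hπ hA]
    exact h

omit hA [FiniteDimensional ℝ E] in
theorem pullback_extD {k : ℕ} {Θ : P → EP [⋀^Fin k]→L[ℝ] 𝔤} (hΘ : IsSmoothForm Θ)
    (heq : ∀ (g : G) (p : P), pullback EP (rightMul g) Θ p =
      (Ad g⁻¹ : 𝔤 →L[ℝ] 𝔤).compContinuousAlternatingMap (Θ p)) (g : G) (p : P) :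
    pullback EP (rightMul g) (extD Θ) p =
      (Ad g⁻¹ : 𝔤 →L[ℝ] 𝔤).compContinuousAlternatingMap (extD Θ p) := by
  rw [isSmoothForm_iff] at hΘ
  rw [← extD_postcomp _ (hΘ p), ← funext (heq g)]
  exact (extD_pullback (hΘ _) (hπ.contMDiff_rightMul g).contMDiffAt).symm

theorem isAdForm_curvature : IsAdForm (E := E) (EP := EP) G π (curvature π A) := by
  refine isAdForm_horizontal hπ hA (IsSmoothForm.extD hA.smooth)
    (pullback_extD hπ hA.smooth fun g p => ?_)
  ext v
  exact hA.equivariant g p (v 0)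

omit hA [FiniteDimensional ℝ E] [FiniteDimensional ℝ EP] [FiniteDimensional ℝ 𝔤] in
theorem IsAdForm.pullback_lift {k : ℕ} {α : P → E [⋀^Fin k]→L[ℝ] 𝔤}
    (hα : IsAdForm (EP := EP) G π α) (g : G) (p : P) : pullback EP (rightMul g) (lift EP π α) p =
      (Ad g⁻¹ : 𝔤 →L[ℝ] 𝔤).compContinuousAlternatingMap (lift EP π α p) := by
  ext v
  change α (rightMul g p) (fun i => tmap EP E π _ (tmap EP EP (rightMul g) p (v i))) = _
  simp only [hπ.tmap_proj_rightMul, hα.equivariant]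
  rfl

theorem IsAdForm.covD {k : ℕ} {α : P → E [⋀^Fin k]→L[ℝ] 𝔤} (hα : IsAdForm (EP := EP) G π α) :
    IsAdForm (EP := EP) G π (covD π A α) :=
  isAdForm_horizontal hπ hA (IsSmoothForm.extD hα.smooth)
    (pullback_extD hπ hα.smooth (hα.pullback_lift hπ))

omit hA hπ [LieGroup 𝓘(ℝ, 𝔤) ∞ G] [IsManifold 𝓘(ℝ, E) ∞ M] [FiniteDimensional ℝ E] in
theorem IsAdForm.add {k : ℕ} {α β : P → E [⋀^Fin k]→L[ℝ] 𝔤} (hα : IsAdForm (EP := EP) G π α)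
    (hβ : IsAdForm (EP := EP) G π β) : IsAdForm (EP := EP) G π (α + β) := by
  constructor
  · have h1 := isSmoothForm_iff.1 hα.smooth
    have h2 := isSmoothForm_iff.1 hβ.smooth
    exact isSmoothForm_iff.2 fun p => (h1 p).add (h2 p)
  · intro g p
    ext v
    change α _ v + β _ v = Ad g⁻¹ (α p v + β p v)
    rw [hα.equivariant, hβ.equivariant, map_add]
    rfl

omit hA hπ [LieGroup 𝓘(ℝ, 𝔤) ∞ G] [IsManifold 𝓘(ℝ, E) ∞ M] [FiniteDimensional ℝ E] in
theorem IsAdForm.const_smul {k : ℕ} (c : ℝ) {α : P → E [⋀^Fin k]→L[ℝ] 𝔤}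
    (hα : IsAdForm (EP := EP) G π α) : IsAdForm (EP := EP) G π (c • α) := by
  constructor
  · have h1 := isSmoothForm_iff.1 hα.smooth
    exact isSmoothForm_iff.2 fun p => (h1 p).const_smul c
  · intro g p
    ext v
    change c • α _ v = Ad g⁻¹ (c • α p v)
    rw [hα.equivariant, map_smul]
    rfl

/-- The curvature form vanishes on a vertical and a horizontal vector. -/
theorem extD_connection_fundamental (p : P) (ξ : 𝔤) (u : E) :
    extD (fun q => toOneForm (A q)) p ![fundamental G EP p ξ, horizontalLift π A p u] = 0 := by
  set ψ := extChartAt 𝓘(ℝ, EP) p with hψ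
  set χ := extChartAt 𝓘(ℝ, 𝔤) (1 : G) with hχ
  -- In the coordinates `(z, w)` of `P × G`, pulled back by the action, both vectors extend to
  -- constant vector fields.
  set f : EP × 𝔤 → P := fun q => rightMul (χ.symm q.2) (ψ.symm q.1) with hf
  set z₀ := ψ p with hz₀
  set w₀ := χ 1 with hw₀
  have hψp : ψ.symm z₀ = p := extChartAt_to_inv p
  have hχ1 : χ.symm w₀ = 1 := extChartAt_to_inv (1 : G)
  have hz₀t : z₀ ∈ ψ.target := mem_extChartAt_target p
  have hw₀t : w₀ ∈ χ.target := mem_extChartAt_target (1 : G)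
  have hfsm : ∀ z ∈ ψ.target, ∀ w ∈ χ.target,
      ContMDiffAt 𝓘(ℝ, EP × 𝔤) 𝓘(ℝ, EP) ∞ f (z, w) := by
    intro z hz w hw
    refine hπ.smooth_action.contMDiffAt.comp (z, w) (ContMDiffAt.prodMk ?_ ?_)
    · exact ContMDiffAt.comp (z, w) (g := ψ.symm) (f := Prod.fst) (contMDiffAt_chart_symm hz)
        contDiff_fst.contDiffAt.contMDiffAt
    · exact ContMDiffAt.comp (z, w) (g := χ.symm) (f := Prod.snd) (contMDiffAt_chart_symm hw)
        contDiff_snd.contDiffAt.contMDiffAt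
  have hfmd : ∀ z ∈ ψ.target, ∀ w ∈ χ.target,
      MDifferentiableAt 𝓘(ℝ, EP × 𝔤) 𝓘(ℝ, EP) f (z, w) := fun z hz w hw =>
    (hfsm z hz w hw).mdifferentiableAt (by simp)
  have hf1 : ∀ z ∈ ψ.target, ∀ w ∈ χ.target, ∀ x : EP, tmap (EP × 𝔤) EP f (z, w) (x, 0) =
      tmap EP EP (rightMul (χ.symm w)) (ψ.symm z) (tmap EP EP ψ.symm z x) := by
    intro z hz w hw x
    have h := tmap_comp (f := fun z : EP => (z, w)) (h := f) (x := z) (hfmd z hz w hw)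
      ((hasFDerivAt_prodMk_left z w).differentiableAt.mdifferentiableAt)
    have e : f ∘ (fun z : EP => (z, w)) = rightMul (χ.symm w) ∘ ψ.symm := rfl
    rw [e, tmap_comp (hπ.mdiff_rightMul _ _) (mdiff_chart_symm hz), tmap_eq_fderiv,
      (hasFDerivAt_prodMk_left z w).fderiv] at h
    exact (DFunLike.congr_fun h x).symm
  have hf2 : ∀ z ∈ ψ.target, ∀ y : 𝔤, tmap (EP × 𝔤) EP f (z, w₀) (0, y) =
      fundamental G EP (ψ.symm z) (tmap 𝔤 𝔤 χ.symm w₀ y) := by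
    intro z hz y
    have h := tmap_comp (f := fun w : 𝔤 => (z, w)) (h := f) (x := w₀) (hfmd z hz w₀ hw₀t)
      ((hasFDerivAt_prodMk_right z w₀).differentiableAt.mdifferentiableAt)
    have e : f ∘ (fun w : 𝔤 => (z, w)) = (fun g : G => rightMul g (ψ.symm z)) ∘ χ.symm := rfl
    rw [e, tmap_comp (hπ.mdiff_orbit _ _) (mdiff_chart_symm hw₀t), tmap_eq_fderiv (fun w => (z, w)),
      (hasFDerivAt_prodMk_right z w₀).fderiv, hχ1] at h
    exact (DFunLike.congr_fun h y).symm
  have hA' := isSmoothForm_iff.1 hA.smooth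
  set B : EP × 𝔤 → (EP × 𝔤) [⋀^Fin 1]→L[ℝ] 𝔤 :=
    pullback (EP × 𝔤) f (fun q => toOneForm (A q)) with hB
  have hBv : ∀ q v, B q ![v] = A (f q) (tmap (EP × 𝔤) EP f q v) := fun q v => rfl
  have hf0 := hfsm z₀ hz₀t w₀ hw₀t
  have hfz : f (z₀, w₀) = p := by
    change rightMul (χ.symm w₀) (ψ.symm z₀) = p
    rw [hψp, hχ1, rightMul_one]
  have hBd : DifferentiableAt ℝ B (z₀, w₀) :=
    (smoothFormAt_self_iff.1 ((hA' _).pullback hf0)).differentiableAt (by simp)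
  set x : EP := tmap EP EP ψ p (horizontalLift π A p u) with hx
  set y : 𝔤 := tmap 𝔤 𝔤 χ 1 ξ with hy
  have hx' : tmap EP EP ψ.symm z₀ x = horizontalLift π A p u :=
    DFunLike.congr_fun (tmap_symm_comp_chart (mem_extChartAt_source (I := 𝓘(ℝ, EP)) p)) _
  have hy' : tmap 𝔤 𝔤 χ.symm w₀ y = ξ :=
    DFunLike.congr_fun (tmap_symm_comp_chart (mem_extChartAt_source (I := 𝓘(ℝ, 𝔤)) (1 : G))) _
  have hpull : extDeriv B (z₀, w₀) ![(0, y), (x, 0)] =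
      extD (fun q => toOneForm (A q)) p ![fundamental G EP p ξ, horizontalLift π A p u] := by
    rw [← extD_self, hB, extD_pullback (hA' _) hf0, hfz]
    change extD _ p (fun i => tmap (EP × 𝔤) EP f (z₀, w₀) (![((0 : EP), y), (x, (0 : 𝔤))] i)) = _
    congr 1
    funext i
    fin_cases i
    · change tmap (EP × 𝔤) EP f (z₀, w₀) (0, y) = fundamental G EP p ξ
      rw [hf2 _ hz₀t, hy', hψp]
    · change tmap (EP × 𝔤) EP f (z₀, w₀) (x, 0) = horizontalLift π A p u
      rw [hf1 _ hz₀t _ hw₀t, hx', hχ1, hψp]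
      have : (rightMul (1 : G) : P → P) = fun q => q := funext fun q => rightMul_one q
      rw [this, tmap_id]
      rfl
  have hd : ∀ v, DifferentiableAt ℝ (fun q => B q ![v]) (z₀, w₀) := fun v =>
    (ContinuousAlternatingMap.apply ℝ (EP × 𝔤) 𝔤 ![v]).differentiableAt.comp _ hBd
  have h1 : fderiv ℝ (fun q => B q ![(x, 0)]) (z₀, w₀) (0, y) = 0 := by
    have h := (hd (x, 0)).hasFDerivAt.comp w₀ (hasFDerivAt_prodMk_right z₀ w₀)
    have e : ((fun q => B q ![(x, 0)]) ∘ fun w => (z₀, w)) =ᶠ[𝓝 w₀] fun _ => (0 : 𝔤) := by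
      filter_upwards [(isOpen_extChartAt_target (1 : G)).mem_nhds hw₀t] with w hw
      change A (f (z₀, w)) (tmap (EP × 𝔤) EP f (z₀, w) (x, 0)) = 0
      rw [hf1 _ hz₀t _ hw, hx']
      change A (rightMul (χ.symm w) (ψ.symm z₀)) _ = 0
      rw [hA.equivariant, hψp, connection_horizontalLift hπ hA, map_zero]
    have h' := h.fderiv
    rw [e.fderiv_eq, fderiv_fun_const] at h'
    exact (DFunLike.congr_fun h' y).symm
  have h2 : fderiv ℝ (fun q => B q ![(0, y)]) (z₀, w₀) (x, 0) = 0 := by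
    have h := HasFDerivAt.comp z₀ (f := fun z => (z, w₀)) (hd (0, y)).hasFDerivAt
      (hasFDerivAt_prodMk_left z₀ w₀)
    have e : ((fun q => B q ![(0, y)]) ∘ fun z => (z, w₀)) =ᶠ[𝓝 z₀] fun _ => ξ := by
      filter_upwards [(isOpen_extChartAt_target p).mem_nhds hz₀t] with z hz
      change A (f (z, w₀)) (tmap (EP × 𝔤) EP f (z, w₀) (0, y)) = ξ
      rw [hf2 _ hz, hy']
      change A (rightMul (χ.symm w₀) (ψ.symm z)) _ = ξ
      rw [hχ1, rightMul_one, hA.reproduces]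
    have h' := h.fderiv
    rw [e.fderiv_eq, fderiv_fun_const] at h'
    exact (DFunLike.congr_fun h' x).symm
  rw [← hpull, extDeriv_apply hBd, Fin.sum_univ_two]
  have e1 : (0 : Fin 2).removeNth ![((0 : EP), y), (x, (0 : 𝔤))] = ![(x, 0)] := by
    funext i; fin_cases i; rfl
  have e2 : (1 : Fin 2).removeNth ![((0 : EP), y), (x, (0 : 𝔤))] = ![(0, y)] := by
    funext i; fin_cases i; rfl
  rw [e1, e2]
  change _ • fderiv ℝ (fun q => B q ![(x, 0)]) (z₀, w₀) (0, y) +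
    _ • fderiv ℝ (fun q => B q ![(0, y)]) (z₀, w₀) (x, 0) = 0
  rw [h1, h2, smul_zero, smul_zero, add_zero]

end AdForms

/-! ### The curvature of a varied connection -/

section Variation
variable {E : Type*} [NormedAddCommGroup E] [NormedSpace ℝ E] [FiniteDimensional ℝ E]
  {M : Type*} [TopologicalSpace M] [ChartedSpace E M] [IsManifold 𝓘(ℝ, E) ∞ M]
  {𝔤 : Type*} [NormedAddCommGroup 𝔤] [NormedSpace ℝ 𝔤] [FiniteDimensional ℝ 𝔤]
  {G : Type*} [TopologicalSpace G] [ChartedSpace 𝔤 G] [Group G] [LieGroup 𝓘(ℝ, 𝔤) ∞ G]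
  {EP : Type*} [NormedAddCommGroup EP] [NormedSpace ℝ EP] [FiniteDimensional ℝ EP]
  {P : Type*} [TopologicalSpace P] [ChartedSpace EP P] [IsManifold 𝓘(ℝ, EP) ∞ P]
  [MulAction Gᵐᵒᵖ P] {π : P → M} (hπ : IsPrincipalBundle E 𝔤 EP G π)
  {A : P → EP →L[ℝ] 𝔤} (hA : IsConnection G A)
  {η : P → E [⋀^Fin 1]→L[ℝ] 𝔤} (hη : IsAdForm (EP := EP) G π η)

theorem toOneForm_vary (t : ℝ) : (fun p => toOneForm (vary π A η t p)) =
    (fun p => toOneForm (A p)) + t • lift EP π η := by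
  funext p
  ext v
  change A p (v 0) + t • ofOneForm (η p) (tmap EP E π p (v 0)) = A p (v 0) + t • η p _
  rw [ofOneForm_apply]
  congr 3
  funext i
  fin_cases i
  rfl

include hπ hA hη

/-- The connections form an affine space over `Ω¹(M, Ad P)`. -/
theorem isConnection_vary (t : ℝ) : IsConnection G (vary π A η t) := by
  refine ⟨?_, fun g p v => ?_, fun p ξ => ?_⟩
  · rw [toOneForm_vary]
    exact isSmoothForm_iff.2 fun p => (isSmoothForm_iff.1 hA.smooth p).add
      ((isSmoothForm_iff.1 hη.smooth p).const_smul t)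
  · change A _ _ + t • ofOneForm (η (rightMul g p)) (tmap EP E π _ (tmap EP EP (rightMul g) p v)) =
      Ad g⁻¹ (A p v + t • ofOneForm (η p) (tmap EP E π p v))
    rw [hA.equivariant, map_add, map_smul, hπ.tmap_proj_rightMul, ofOneForm_apply, ofOneForm_apply,
      hη.equivariant]
    rfl
  · change A p _ + t • ofOneForm (η p) (tmap EP E π p (fundamental G EP p ξ)) = ξ
    rw [hπ.tmap_proj_fundamental, hA.reproduces, map_zero, smul_zero, add_zero]

theorem horizontalLift_vary (t : ℝ) (p : P) (u : E) :
    horizontalLift π (vary π A η t) p u =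
      horizontalLift π A p u - t • fundamental G EP p (ofOneForm (η p) u) := by
  refine (eq_horizontalLift hπ (isConnection_vary hπ hA hη t) ?_ ?_).symm
  · rw [map_sub, map_smul, hπ.tmap_proj_fundamental, tmap_proj_horizontalLift hπ hA, smul_zero,
      sub_zero]
  · change A p _ + t • ofOneForm (η p) (tmap EP E π p _) = 0
    rw [map_sub, map_sub, map_smul, map_smul, hπ.tmap_proj_fundamental,
      tmap_proj_horizontalLift hπ hA, connection_horizontalLift hπ hA, hA.reproduces, smul_zero,
      sub_zero, zero_sub, neg_add_cancel]

/-- The curvature of `A + t η` is a polynomial in `t` with linear term `d_A η`. -/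
theorem exists_curvature_vary : ∃ R S : P → E [⋀^Fin 2]→L[ℝ] 𝔤,
    IsAdForm (EP := EP) G π R ∧ IsAdForm (EP := EP) G π S ∧
    ∀ t, curvature π (vary π A η t) =
      curvature π A + t • covD π A η + t ^ 2 • R + t ^ 3 • S := by
  -- the coefficients of the polynomial, evaluated on two vectors
  let a : P → EP [⋀^Fin 2]→L[ℝ] 𝔤 := extD fun q => toOneForm (A q)
  let c : P → EP [⋀^Fin 2]→L[ℝ] 𝔤 := extD (lift EP π η)
  let h : P → E → EP := fun p u => horizontalLift π A p u
  let f : P → E → EP := fun p u => fundamental G EP p (ofOneForm (η p) u)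
  let r : P → E → E → 𝔤 := fun p u v =>
    a p ![f p u, f p v] - c p ![f p u, h p v] - c p ![h p u, f p v]
  let s : P → E → E → 𝔤 := fun p u v => c p ![f p u, f p v]
  have key : ∀ t p u v, curvature π (vary π A η t) p ![u, v] =
      curvature π A p ![u, v] + t • covD π A η p ![u, v] + t ^ 2 • r p u v + t ^ 3 • s p u v := by
    intro t p u v
    have e0 : ∀ (B : P → EP →L[ℝ] 𝔤) (ν : EP [⋀^Fin 2]→L[ℝ] 𝔤),
        ν.compContinuousLinearMap (horizontalLift π B p) ![u, v] =
          lin2 ν (horizontalLift π B p u) (horizontalLift π B p v) := by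
      intro B ν
      rw [lin2_apply]
      change ν _ = ν _
      congr 1
      funext i
      fin_cases i <;> rfl
    have e1 : extD (fun q => toOneForm (vary π A η t q)) p = a p + t • c p := by
      rw [toOneForm_vary, extD_add (isSmoothForm_iff.1 hA.smooth p)
        ((isSmoothForm_iff.1 hη.smooth p).const_smul t), extD_const_smul]
    have e2 : ∀ x y : EP, lin2 (a p + t • c p) x y = lin2 (a p) x y + t • lin2 (c p) x y := by
      intro x y
      simp only [lin2_apply]
      rfl
    have v1 : lin2 (a p) (f p u) (h p v) = 0 := by
      rw [lin2_apply]
      exact extD_connection_fundamental hπ hA p _ v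
    have v2 : lin2 (a p) (h p u) (f p v) = 0 := by
      rw [lin2_apply, twoForm_swap, neg_eq_zero]
      exact extD_connection_fundamental hπ hA p _ u
    rw [curvature, e0, e1, horizontalLift_vary hπ hA hη, horizontalLift_vary hπ hA hη, curvature,
      e0, covD, e0]
    change lin2 (a p + t • c p) (h p u - t • f p u) (h p v - t • f p v) =
      lin2 (a p) (h p u) (h p v) + t • lin2 (c p) (h p u) (h p v) +
      t ^ 2 • (a p ![f p u, f p v] - c p ![f p u, h p v] - c p ![h p u, f p v]) +
      t ^ 3 • c p ![f p u, f p v]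
    simp only [← lin2_apply, e2, map_sub, map_smul, _root_.sub_apply, _root_.smul_apply, v1, v2]
    module
  have hF := isAdForm_curvature hπ hA
  have hD := hη.covD hπ hA
  -- the coefficients are determined by the curvatures at `t = ±1`, hence they are forms with values
  -- in `Ad P`
  have hF1 := isAdForm_curvature hπ (isConnection_vary hπ hA hη 1)
  have hF2 := isAdForm_curvature hπ (isConnection_vary hπ hA hη (-1))
  refine ⟨(2 : ℝ)⁻¹ • (curvature π (vary π A η 1) + curvature π (vary π A η (-1))) +
      (-1 : ℝ) • curvature π A,
    (2 : ℝ)⁻¹ • (curvature π (vary π A η 1) + (-1 : ℝ) • curvature π (vary π A η (-1))) +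
      (-1 : ℝ) • covD π A η,
    ((hF1.add hF2).const_smul _).add (hF.const_smul _),
    ((hF1.add (hF2.const_smul _)).const_smul _).add (hD.const_smul _), fun t => ?_⟩
  funext p
  ext v
  have hv : v = ![v 0, v 1] := by funext i; fin_cases i <;> rfl
  rw [hv]
  change curvature π (vary π A η t) p ![v 0, v 1] = curvature π A p _ + t • covD π A η p _ +
    t ^ 2 • ((2 : ℝ)⁻¹ • (curvature π (vary π A η 1) p _ + curvature π (vary π A η (-1)) p _) +
      (-1 : ℝ) • curvature π A p _) +
    t ^ 3 • ((2 : ℝ)⁻¹ • (curvature π (vary π A η 1) p _ +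
      (-1 : ℝ) • curvature π (vary π A η (-1)) p _) + (-1 : ℝ) • covD π A η p _)
  rw [key t, key 1, key (-1)]
  module

end Variation

/-! ### The metric in coordinates -/

section Metric

/-- A family of linear maps of finite-dimensional spaces is smooth if its values are. -/
theorem contDiffAt_clm {X V F : Type*} [NormedAddCommGroup X] [NormedSpace ℝ X]
    [NormedAddCommGroup V] [NormedSpace ℝ V] [FiniteDimensional ℝ V] [NormedAddCommGroup F]
    [NormedSpace ℝ F] {r : WithTop ℕ∞} {f : X → V →L[ℝ] F} {x : X}
    (h : ∀ v, ContDiffAt ℝ r (fun y => f y v) x) : ContDiffAt ℝ r f x := by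
  let d := Module.finrank ℝ V
  have hd : d = Module.finrank ℝ (Fin d → ℝ) := (Module.finrank_fin_fun ℝ).symm
  let e₁ := ContinuousLinearEquiv.ofFinrankEq hd
  let e₂ := (e₁.arrowCongr (1 : F ≃L[ℝ] F)).trans (ContinuousLinearEquiv.piRing (Fin d))
  rw [← Function.id_comp f, ← e₂.symm_comp_self]
  exact e₂.symm.contDiff.contDiffAt.comp x (contDiffAt_pi.mpr fun i => h _)

variable {m : ℕ} {M : Type*} [TopologicalSpace M] [ChartedSpace (EuclideanSpace ℝ (Fin m)) M]
  [IsManifold (𝓡 m) ∞ M]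
local notation "𝔼" => EuclideanSpace ℝ (Fin m)

theorem isInner_metricAt (g : RiemMetric m M) (x : M) : IsInner (metricAt g x) :=
  ⟨g.symm x, g.pos x⟩

/-- The metric in the coordinates of the chart around `x₀`. -/
def metricRep (g : RiemMetric m M) (x₀ : M) (y : EuclideanSpace ℝ (Fin m)) :
    EuclideanSpace ℝ (Fin m) →L[ℝ] EuclideanSpace ℝ (Fin m) →L[ℝ] ℝ :=
  pullInner (metricAt g ((extChartAt (𝓡 m) x₀).symm y)) (tmap 𝔼 𝔼 (extChartAt (𝓡 m) x₀).symm y)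

theorem isInner_metricRep (g : RiemMetric m M) {x₀ : M} {y : 𝔼}
    (hy : y ∈ (extChartAt (𝓡 m) x₀).target) : IsInner (metricRep g x₀ y) :=
  (isInner_metricAt g _).comp (chartEquiv hy)

theorem contDiffAt_metricRep (g : RiemMetric m M) {x₀ : M} {y : 𝔼}
    (hy : y ∈ (extChartAt (𝓡 m) x₀).target) : ContDiffAt ℝ ∞ (metricRep g x₀) y := by
  have hop := (isOpen_extChartAt_target (I := 𝓡 m) x₀)
  have hv : ∀ e : 𝔼, ContMDiffAt 𝓘(ℝ, 𝔼) (𝓡 m).tangent ∞ (fun z : 𝔼 =>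
      (⟨(extChartAt (𝓡 m) x₀).symm z, tmap 𝔼 𝔼 (extChartAt (𝓡 m) x₀).symm z e⟩ :
        TangentBundle (𝓡 m) M)) y := by
    intro e
    have h1 := (contMDiffOn_extChartAt_symm (I := 𝓡 m) (n := ∞) x₀).contMDiffOn_tangentMapWithin
      (m := ∞) (by simp) hop.uniqueMDiffOn
    have h2 : ContMDiffAt 𝓘(ℝ, 𝔼) 𝓘(ℝ, 𝔼).tangent ∞
        (fun z : 𝔼 => (⟨z, e⟩ : TangentBundle 𝓘(ℝ, 𝔼) 𝔼)) y :=
      contMDiffAt_vectorSpace_iff_contDiffAt.2 contDiffAt_const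
    have h3 := h1.contMDiffAt (x := (⟨y, e⟩ : TangentBundle 𝓘(ℝ, 𝔼) 𝔼))
      ((hop.preimage (FiberBundle.continuous_proj 𝔼 (TangentSpace 𝓘(ℝ, 𝔼)))).mem_nhds hy)
    refine (ContMDiffAt.comp y h3 h2).congr_of_eventuallyEq ?_
    filter_upwards [hop.mem_nhds hy] with z hz
    simp only [Function.comp_apply, tangentMapWithin]
    rw [mfderivWithin_of_isOpen hop hz]
    rfl
  have hg : ContMDiffAt 𝓘(ℝ, 𝔼) ((𝓡 m).prod 𝓘(ℝ, 𝔼 →L[ℝ] 𝔼 →L[ℝ] ℝ)) ∞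
      (fun z => Bundle.TotalSpace.mk' (𝔼 →L[ℝ] 𝔼 →L[ℝ] ℝ)
        (E := fun x : M => (TangentSpace (𝓡 m) x →L[ℝ] TangentSpace (𝓡 m) x →L[ℝ] ℝ))
        ((extChartAt (𝓡 m) x₀).symm z) (g.inner ((extChartAt (𝓡 m) x₀).symm z))) y :=
    ContMDiffAt.comp y g.contMDiff.contMDiffAt (contMDiffAt_chart_symm hy)
  have hij : ∀ u v : 𝔼, ContDiffAt ℝ ∞ (fun z => metricRep g x₀ z u v) y := by
    intro u v
    have h := ContMDiffAt.clm_bundle_apply₂ (E₃ := Bundle.Trivial M ℝ) (F₃ := ℝ) hg (hv u) (hv v)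
    exact (((Bundle.contMDiffAt_totalSpace ..).1 h).2).contDiffAt
  have h1 : ContDiffAt ℝ ∞ (fun z => (metricRep g x₀ z)) y := by
    refine contDiffAt_clm fun u => contDiffAt_clm fun v => hij u v
  exact h1

end Metric

/-! ### Composition with linear maps of the values -/

section Postcomp
variable {m : ℕ} {F F' : Type*} [NormedAddCommGroup F] [NormedSpace ℝ F] [NormedAddCommGroup F']
  [NormedSpace ℝ F'] (T : F →L[ℝ] F')
local notation "𝔼" => EuclideanSpace ℝ (Fin m)

theorem contraction_postcomp
    (b : EuclideanSpace ℝ (Fin m) →L[ℝ] EuclideanSpace ℝ (Fin m) →L[ℝ] ℝ)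
    (σ : 𝔼 [⋀^Fin 2]→L[ℝ] ℝ) (α : 𝔼 [⋀^Fin 2]→L[ℝ] F) :
    contraction b σ (T.compContinuousAlternatingMap α) = T (contraction b σ α) := by
  simp [contraction, map_sum]

theorem primitivePart_postcomp {n : ℕ}
    (b : EuclideanSpace ℝ (Fin (2 * n)) →L[ℝ] EuclideanSpace ℝ (Fin (2 * n)) →L[ℝ] ℝ)
    (σ : EuclideanSpace ℝ (Fin (2 * n)) [⋀^Fin 2]→L[ℝ] ℝ)
    (α : EuclideanSpace ℝ (Fin (2 * n)) [⋀^Fin 2]→L[ℝ] F) :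
    primitivePart b σ (T.compContinuousAlternatingMap α) =
      T.compContinuousAlternatingMap (primitivePart b σ α) := by
  ext v
  change T (α v) - σ v • ((n : ℝ)⁻¹ • contraction b σ _) =
    T (α v - σ v • ((n : ℝ)⁻¹ • contraction b σ α))
  rw [contraction_postcomp, map_sub, map_smul, map_smul]

theorem hodgeStar_postcomp
    (b : EuclideanSpace ℝ (Fin m) →L[ℝ] EuclideanSpace ℝ (Fin m) →L[ℝ] ℝ)
    (vol : 𝔼 [⋀^Fin m]→L[ℝ] ℝ) {k l : ℕ} (h : m = l + k) (α : 𝔼 [⋀^Fin k]→L[ℝ] F) :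
    hodgeStar b vol h (T.compContinuousAlternatingMap α) =
      T.compContinuousAlternatingMap (hodgeStar b vol h α) := by
  ext v
  simp [hodgeStar, formSmul_apply, map_sum]

theorem formInner_postcomp
    (b : EuclideanSpace ℝ (Fin m) →L[ℝ] EuclideanSpace ℝ (Fin m) →L[ℝ] ℝ)
    {κ : F →L[ℝ] F →L[ℝ] ℝ} {T : F →L[ℝ] F} (hT : ∀ ξ ζ, κ (T ξ) (T ζ) = κ ξ ζ) {k : ℕ}
    (α β : 𝔼 [⋀^Fin k]→L[ℝ] F) :
    formInner b κ (T.compContinuousAlternatingMap α) (T.compContinuousAlternatingMap β) =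
      formInner b κ α β := by
  simp [formInner, hT]

theorem wedgeOne_postcomp {V : Type*} [NormedAddCommGroup V] [NormedSpace ℝ V]
    {κ : F →L[ℝ] F →L[ℝ] ℝ} {T : F →L[ℝ] F} (hT : ∀ ξ ζ, κ (T ξ) (T ζ) = κ ξ ζ) {l : ℕ}
    (a : V [⋀^Fin 1]→L[ℝ] F) (β : V [⋀^Fin l]→L[ℝ] F) :
    wedgeOne κ (ofOneForm (T.compContinuousAlternatingMap a)) (T.compContinuousAlternatingMap β) =
      wedgeOne κ (ofOneForm a) β := by
  ext v
  rw [wedgeOne_apply, wedgeOne_apply]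
  refine Finset.sum_congr rfl fun i _ => ?_
  rw [ofOneForm_apply, ofOneForm_apply]
  congr 1
  exact hT _ _

end Postcomp

/-! ### Operations on forms with values in `Ad P` -/

section AdOperations
variable {m : ℕ} {M : Type*} [TopologicalSpace M] [ChartedSpace (EuclideanSpace ℝ (Fin m)) M]
  [IsManifold (𝓡 m) ∞ M]
  {𝔤 : Type*} [NormedAddCommGroup 𝔤] [NormedSpace ℝ 𝔤] [FiniteDimensional ℝ 𝔤]
  {G : Type*} [TopologicalSpace G] [ChartedSpace 𝔤 G] [Group G] [LieGroup 𝓘(ℝ, 𝔤) ∞ G]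
  {EP : Type*} [NormedAddCommGroup EP] [NormedSpace ℝ EP] [FiniteDimensional ℝ EP]
  {P : Type*} [TopologicalSpace P] [ChartedSpace EP P] [IsManifold 𝓘(ℝ, EP) ∞ P]
  [MulAction Gᵐᵒᵖ P] {π : P → M}
  {F : Type*} [NormedAddCommGroup F] [NormedSpace ℝ F]
local notation "𝔼" => EuclideanSpace ℝ (Fin m)

theorem metricRep_localMap (g : RiemMetric m M) {p₀ : P} {z : EP} (hz : IsOver 𝔼 EP π p₀ z) :
    metricRep g (π p₀) (localMap EP 𝔼 π p₀ (π p₀) z) =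
      pullInner (metricAt g (π ((extChartAt 𝓘(ℝ, EP) p₀).symm z)))
        (chartEquiv (localMap_mem hz)).toContinuousLinearMap := by
  rw [metricRep, chart_symm_localMap hz]
  rfl

theorem chartRep_localMap {k : ℕ} (β : M → 𝔼 [⋀^Fin k]→L[ℝ] F) {p₀ : P} {z : EP}
    (hz : IsOver 𝔼 EP π p₀ z) :
    chartRep β (π p₀) (localMap EP 𝔼 π p₀ (π p₀) z) =
      (β (π ((extChartAt 𝓘(ℝ, EP) p₀).symm z))).compContinuousLinearMap
        (chartEquiv (localMap_mem hz)).toContinuousLinearMap := by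
  rw [chartRep, pullback, chart_symm_localMap hz]
  rfl

theorem locRep_chartEquiv {k : ℕ} (α : P → 𝔼 [⋀^Fin k]→L[ℝ] F) {p₀ : P} {z : EP}
    (hz : IsOver 𝔼 EP π p₀ z) :
    locRep π α p₀ z = (α ((extChartAt 𝓘(ℝ, EP) p₀).symm z)).compContinuousLinearMap
      (chartEquiv (localMap_mem hz)).toContinuousLinearMap := rfl

variable (hπ : IsPrincipalBundle (EuclideanSpace ℝ (Fin m)) 𝔤 EP G π)
include hπ

theorem contDiffAt_metricRep_localMap (g : RiemMetric m M) (p₀ : P) :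
    ContDiffAt ℝ ∞ (fun z => metricRep g (π p₀) (localMap EP 𝔼 π p₀ (π p₀) z))
      (extChartAt 𝓘(ℝ, EP) p₀ p₀) :=
  ContDiffAt.comp (g := metricRep g (π p₀)) _
    (contDiffAt_metricRep g (localMap_mem (isOver_self p₀)))
    (contDiffAt_localMap_proj hπ p₀)

theorem contDiffAt_chartRep_localMap [FiniteDimensional ℝ F] {k : ℕ}
    {β : M → 𝔼 [⋀^Fin k]→L[ℝ] F} (hβ : IsSmoothForm β)
    (p₀ : P) : ContDiffAt ℝ ∞ (fun z => chartRep β (π p₀) (localMap EP 𝔼 π p₀ (π p₀) z))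
      (extChartAt 𝓘(ℝ, EP) p₀ p₀) :=
  ContDiffAt.comp _ (((isSmoothForm_iff.1 hβ) _).contDiffAt_chartRep
    (localMap_mem (isOver_self p₀))) (contDiffAt_localMap_proj hπ p₀)

variable {A : P → EP →L[ℝ] 𝔤} (hA : IsConnection G A)
include hA

theorem IsAdForm.contDiffAt_locRep {k : ℕ} {α : P → 𝔼 [⋀^Fin k]→L[ℝ] 𝔤}
    (hα : IsAdForm (EP := EP) G π α) (p₀ : P) :
    ContDiffAt ℝ ∞ (locRep π α p₀) (extChartAt 𝓘(ℝ, EP) p₀ p₀) :=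
  (smoothFormAt_lift_iff hπ hA).1 (isSmoothForm_iff.1 hα.smooth p₀)

/-- The pointwise inner product of two forms with values in `Ad P` is continuous on `P`. -/
theorem continuous_formInner (g : RiemMetric m M) (κ : 𝔤 →L[ℝ] 𝔤 →L[ℝ] ℝ) {k : ℕ}
    {α β : P → 𝔼 [⋀^Fin k]→L[ℝ] 𝔤} (hα : IsAdForm (EP := EP) G π α)
    (hβ : IsAdForm (EP := EP) G π β) :
    Continuous fun p => formInner (metricAt g (π p)) κ (α p) (β p) := by
  refine continuous_iff_continuousAt.2 fun p₀ => ?_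
  have h0 : IsOver 𝔼 EP π p₀ _ := isOver_self p₀
  have h := (contDiffAt_formInner (contDiffAt_metricRep_localMap hπ g p₀)
    (isInner_metricRep g (localMap_mem h0)) κ (hα.contDiffAt_locRep hπ hA p₀)
    (hβ.contDiffAt_locRep hπ hA p₀)).continuousAt
  have hc : ContinuousAt (extChartAt 𝓘(ℝ, EP) p₀) p₀ := continuousAt_extChartAt p₀
  refine (ContinuousAt.comp h hc).congr ?_
  filter_upwards [hc.eventually (eventually_isOver hπ p₀),
    (isOpen_extChartAt_source (I := 𝓘(ℝ, EP)) p₀).mem_nhds (mem_extChartAt_source p₀)] with p hp hp'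
  rw [Function.comp_apply, metricRep_localMap g hp, locRep_chartEquiv _ hp, locRep_chartEquiv _ hp,
    formInner_comp _ (isInner_metricAt g _), (extChartAt 𝓘(ℝ, EP) p₀).left_inv hp']

end AdOperations

section AdOperationsEven
variable {n : ℕ} {M : Type*} [TopologicalSpace M]
  [ChartedSpace (EuclideanSpace ℝ (Fin (2 * n))) M]
  [IsManifold (𝓡 (2 * n)) ∞ M]
  {𝔤 : Type*} [NormedAddCommGroup 𝔤] [NormedSpace ℝ 𝔤] [FiniteDimensional ℝ 𝔤]
  {G : Type*} [TopologicalSpace G] [ChartedSpace 𝔤 G] [Group G] [LieGroup 𝓘(ℝ, 𝔤) ∞ G]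
  {EP : Type*} [NormedAddCommGroup EP] [NormedSpace ℝ EP] [FiniteDimensional ℝ EP]
  {P : Type*} [TopologicalSpace P] [ChartedSpace EP P] [IsManifold 𝓘(ℝ, EP) ∞ P]
  [MulAction Gᵐᵒᵖ P] {π : P → M}
local notation "𝔼" => EuclideanSpace ℝ (Fin (2 * n))
variable (hπ : IsPrincipalBundle (EuclideanSpace ℝ (Fin (2 * n))) 𝔤 EP G π)
  {A : P → EP →L[ℝ] 𝔤} (hA : IsConnection G A)
  {σ : M → EuclideanSpace ℝ (Fin (2 * n)) [⋀^Fin 2]→L[ℝ] ℝ} (hσ : IsSmoothForm σ)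
  (g : RiemMetric (2 * n) M)
include hπ hA hσ

theorem IsAdForm.primitivePart {α : P → 𝔼 [⋀^Fin 2]→L[ℝ] 𝔤} (hα : IsAdForm (EP := EP) G π α) :
    IsAdForm (EP := EP) G π fun p => primitivePart (metricAt g (π p)) (σ (π p)) (α p) := by
  refine ⟨isSmoothForm_iff.2 fun p₀ => (smoothFormAt_lift_iff hπ hA).2 ?_, fun a p => ?_⟩
  · refine (contDiffAt_primitivePart (contDiffAt_metricRep_localMap hπ g p₀)
      (isInner_metricRep g (localMap_mem (isOver_self p₀)))
      (contDiffAt_chartRep_localMap hπ hσ p₀)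
      (hα.contDiffAt_locRep hπ hA p₀)).congr_of_eventuallyEq ?_
    filter_upwards [eventually_isOver hπ p₀] with z hz
    rw [metricRep_localMap g hz, chartRep_localMap σ hz, locRep_chartEquiv _ hz,
      locRep_chartEquiv _ hz, primitivePart_comp (isInner_metricAt g _)]
  · rw [hπ.proj_rightMul, hα.equivariant, primitivePart_postcomp]

theorem IsAdForm.starAd {k l : ℕ} (h : 2 * n = l + k) {α : P → 𝔼 [⋀^Fin k]→L[ℝ] 𝔤}
    (hα : IsAdForm (EP := EP) G π α) : IsAdForm (EP := EP) G π (starAd σ g π h α) := by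
  refine ⟨isSmoothForm_iff.2 fun p₀ => (smoothFormAt_lift_iff hπ hA).2 ?_, fun a p => ?_⟩
  · refine (contDiffAt_hodgeStar (contDiffAt_metricRep_localMap hπ g p₀)
      (isInner_metricRep g (localMap_mem (isOver_self p₀)))
      (contDiffAt_liouville (contDiffAt_chartRep_localMap hπ hσ p₀) n) h
      (hα.contDiffAt_locRep hπ hA p₀)).congr_of_eventuallyEq ?_
    filter_upwards [eventually_isOver hπ p₀] with z hz
    rw [metricRep_localMap g hz, chartRep_localMap σ hz, locRep_chartEquiv _ hz,
      locRep_chartEquiv _ hz, liouville_comp, hodgeStar_comp _ (isInner_metricAt g _)]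
    rfl
  · rw [PrimitiveYM.starAd, hπ.proj_rightMul, hα.equivariant, hodgeStar_postcomp]
    rfl

theorem isAdForm_primitiveCurvature : IsAdForm (EP := EP) G π (primitiveCurvature σ g π A) :=
  IsAdForm.primitivePart hπ hA hσ g (isAdForm_curvature hπ hA)

theorem IsAdForm.negStarDStar (hn : 2 ≤ n) {α : P → 𝔼 [⋀^Fin 2]→L[ℝ] 𝔤}
    (hα : IsAdForm (EP := EP) G π α) : IsAdForm (EP := EP) G π (negStarDStar hn σ g π A α) := by
  have h := (((hα.starAd hπ hA hσ g (k := 2) (l := 2 * n - 2) (by omega)).covD hπ hA).starAd hπ hA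
    hσ g (k := 2 * n - 2 + 1) (l := 1) (by omega)).const_smul (-1)
  rw [neg_one_smul] at h
  exact h

end AdOperationsEven

/-! ### Forms on `M` from invariant forms on `P` -/

section Descent
variable {E : Type*} [NormedAddCommGroup E] [NormedSpace ℝ E] [FiniteDimensional ℝ E]
  {M : Type*} [TopologicalSpace M] [ChartedSpace E M] [IsManifold 𝓘(ℝ, E) ∞ M]
  {𝔤 : Type*} [NormedAddCommGroup 𝔤] [NormedSpace ℝ 𝔤] [FiniteDimensional ℝ 𝔤]
  {G : Type*} [TopologicalSpace G] [ChartedSpace 𝔤 G] [Group G] [LieGroup 𝓘(ℝ, 𝔤) ∞ G]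
  {EP : Type*} [NormedAddCommGroup EP] [NormedSpace ℝ EP] [FiniteDimensional ℝ EP]
  {P : Type*} [TopologicalSpace P] [ChartedSpace EP P] [IsManifold 𝓘(ℝ, EP) ∞ P]
  [MulAction Gᵐᵒᵖ P] {π : P → M} (hπ : IsPrincipalBundle E 𝔤 EP G π)
include hπ

theorem descend_apply {f : P → ℝ} (hf : ∀ (g : G) p, f (rightMul g p) = f p) (p : P) :
    descend π f (π p) = f p := by
  have h : ∃ q, π q = π p := ⟨p, rfl⟩
  rw [descend, dif_pos h]
  obtain ⟨g, hg⟩ := hπ.exists_rightMul h.choose_spec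
  rw [← hf g, hg]

theorem continuous_descend {f : P → ℝ} (hf : ∀ (g : G) p, f (rightMul g p) = f p)
    (hc : Continuous f) : Continuous (descend π f) := by
  refine continuous_iff_continuousAt.2 fun x => ?_
  obtain ⟨p, rfl⟩ := hπ.surjective x
  obtain ⟨s, hsp, hs, hsm⟩ := hπ.exists_section p
  refine (ContinuousAt.comp (f := s) (g := f) hc.continuousAt hsm.continuousAt).congr ?_
  filter_upwards [hs] with y hy
  have := descend_apply hπ hf (s y)
  rw [hy] at this
  exact this.symm

omit hπ [TopologicalSpace M] [TopologicalSpace P] [FiniteDimensional ℝ E] [ChartedSpace E M]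
  [IsManifold 𝓘(ℝ, E) ∞ M] [FiniteDimensional ℝ EP] [ChartedSpace EP P] [NormedSpace ℝ EP]
  [NormedAddCommGroup EP] [IsManifold 𝓘(ℝ, EP) ∞ P] in
open Classical in
/-- A family of real-valued forms on the spaces `T_{π p} M` which is constant on the fibres, as a
form on `M`. -/
def descendForm (π : P → M) {k : ℕ} (Θ : P → E [⋀^Fin k]→L[ℝ] ℝ) (x : M) : E [⋀^Fin k]→L[ℝ] ℝ :=
  if h : ∃ p, π p = x then Θ h.choose else 0

variable {k : ℕ} {Θ : P → E [⋀^Fin k]→L[ℝ] ℝ} (hΘ : ∀ (g : G) p, Θ (rightMul g p) = Θ p)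
include hΘ

theorem descendForm_apply (p : P) : descendForm π Θ (π p) = Θ p := by
  have h : ∃ q, π q = π p := ⟨p, rfl⟩
  rw [descendForm, dif_pos h]
  obtain ⟨g, hg⟩ := hπ.exists_rightMul h.choose_spec
  rw [← hΘ g, hg]

theorem pullback_descendForm : pullback EP π (descendForm π Θ) = lift EP π Θ := by
  funext p
  rw [pullback, descendForm_apply hπ hΘ]

theorem isSmoothForm_descendForm
    (hs : IsSmoothForm (lift EP π Θ)) : IsSmoothForm (descendForm π Θ) := by
  rw [isSmoothForm_iff] at hs ⊢
  intro x
  obtain ⟨p, rfl⟩ := hπ.surjective x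
  obtain ⟨s, hsp, hsec, hsm⟩ := hπ.exists_section p
  have h : descendForm π Θ =ᶠ[𝓝 (π p)] pullback E s (lift EP π Θ) := by
    have hev : ∀ᶠ x in 𝓝 (π p), ∀ᶠ y in 𝓝 x, π (s y) = y := hsec.eventually_nhds
    have hsm' : ∀ᶠ x in 𝓝 (π p), ContMDiffAt 𝓘(ℝ, E) 𝓘(ℝ, EP) 1 s x :=
      contMDiffAt_iff_contMDiffAt_nhds (by simp) |>.1 (hsm.of_le (by simp))
    filter_upwards [hev, hsm'] with x hx hx'
    have h1 := tmap_comp (hπ.mdiff_proj (s x)) (hx'.mdifferentiableAt (by simp))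
    rw [tmap_congr (f := π ∘ s) (h := fun x => x) hx, tmap_id] at h1
    have h2 := descendForm_apply hπ hΘ (s x)
    rw [hx.self_of_nhds] at h2
    rw [h2]
    ext v
    change Θ (s x) v = Θ (s x) (fun i => (tmap EP E π (s x) ∘L tmap E EP s x) (v i))
    rw [← h1]
    rfl
  exact SmoothFormAt.congr ((hs _).pullback hsm) h

/-- The exterior derivative of a form on `M` is computed on `P`, on horizontal vectors. -/
theorem extD_descendForm {A : P → EP →L[ℝ] 𝔤} (hA : IsConnection G A)
    (hs : IsSmoothForm (lift EP π Θ)) (p : P) :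
    extD (descendForm π Θ) (π p) =
      (extD (lift EP π Θ) p).compContinuousLinearMap (horizontalLift π A p) := by
  have h := extD_pullback (isSmoothForm_iff.1 (isSmoothForm_descendForm hπ hΘ hs) (π p))
    (hπ.smooth_proj.contMDiffAt (x := p))
  rw [pullback_descendForm hπ hΘ] at h
  rw [h]
  ext v
  change extD _ _ v = extD _ _ (fun i => tmap EP E π p (horizontalLift π A p (v i)))
  simp only [tmap_proj_horizontalLift hπ hA]

end Descent

/-! ### The Riemannian volume -/

section Volume
open MeasureTheory

variable {m : ℕ}
local notation "𝔼" => EuclideanSpace ℝ (Fin m)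

theorem det_gram_pullInner (b : EuclideanSpace ℝ (Fin m) →L[ℝ] EuclideanSpace ℝ (Fin m) →L[ℝ] ℝ)
    (L : EuclideanSpace ℝ (Fin m) →L[ℝ] EuclideanSpace ℝ (Fin m)) :
    (gram (pullInner b L)).det = L.det ^ 2 * (gram b).det := by
  let C : Matrix (Fin m) (Fin m) ℝ := Matrix.of fun i k => L (stdVec i) k
  have h1 : gram (pullInner b L) = C * gram b * C.transpose := by
    ext i j
    change b (L (stdVec i)) (L (stdVec j)) = _
    conv_lhs => rw [← sum_stdVec (L (stdVec i)), ← sum_stdVec (L (stdVec j))]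
    simp only [map_sum, map_smul, sum_apply, smul_apply, smul_eq_mul, Matrix.mul_apply,
      Matrix.transpose_apply, Finset.sum_mul, C, Matrix.of_apply, gram]
    refine Finset.sum_congr rfl fun k _ => ?_
    rw [Finset.mul_sum]
    exact Finset.sum_congr rfl fun l _ => by ring
  have h2 : C.det = L.det := by
    rw [ContinuousLinearMap.det,
      ← LinearMap.det_toMatrix (EuclideanSpace.basisFun (Fin m) ℝ).toBasis, ← Matrix.det_transpose]
    rfl
  rw [h1, Matrix.det_mul, Matrix.det_mul, Matrix.det_transpose, h2]
  ring

theorem det_gram_pos {b : EuclideanSpace ℝ (Fin m) →L[ℝ] EuclideanSpace ℝ (Fin m) →L[ℝ] ℝ}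
    (hb : IsInner b) : 0 < (gram b).det := by
  refine Matrix.PosDef.det_pos (Matrix.posDef_iff_dotProduct_mulVec.2 ⟨?_, fun v hv => ?_⟩)
  · ext i j
    exact hb.symm _ _
  · have h1 : b (∑ i, v i • stdVec i) (∑ i, v i • stdVec i) = star v ⬝ᵥ (gram b).mulVec v := by
      simp only [map_sum, map_smul, sum_apply, smul_apply, smul_eq_mul, dotProduct, Matrix.mulVec,
        gram, Matrix.of_apply, Finset.mul_sum, star_trivial]
      rw [Finset.sum_comm]
      exact Finset.sum_congr rfl fun x _ => Finset.sum_congr rfl fun y _ => by ring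
    rw [← h1]
    refine hb.pos _ fun h0 => hv ?_
    have h2 := sum_stdVec (WithLp.toLp 2 v)
    simp only at h2
    rw [h0] at h2
    funext i
    exact (congrArg (fun w : 𝔼 => w i) h2).symm

variable {M : Type*} [TopologicalSpace M] [ChartedSpace (EuclideanSpace ℝ (Fin m)) M]
  [IsManifold (𝓡 m) ∞ M]

/-- The density `√det(g_{ij})` of the Riemannian volume in the chart around `x₀`. -/
def volDensity (g : RiemMetric m M) (x₀ : M) (y : EuclideanSpace ℝ (Fin m)) : ℝ :=
  Real.sqrt (gram (metricRep g x₀ y)).det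

variable (g : RiemMetric m M)

theorem volDensity_pos {x₀ : M} {y : 𝔼} (hy : y ∈ (extChartAt (𝓡 m) x₀).target) :
    0 < volDensity g x₀ y :=
  Real.sqrt_pos.2 (det_gram_pos (isInner_metricRep g hy))

theorem continuousOn_volDensity (x₀ : M) :
    ContinuousOn (volDensity g x₀) (extChartAt (𝓡 m) x₀).target := fun _ hy =>
  (Real.continuous_sqrt.continuousAt.comp (contDiffAt_det fun i j =>
    contDiffAt_gram (contDiffAt_metricRep g hy) i j).continuousAt).continuousWithinAt

/-- The transformation rule of the density under a change of charts. -/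
theorem volDensity_localMap {x₀ x₁ : M} {y : 𝔼} (hy : y ∈ (extChartAt (𝓡 m) x₀).target)
    (hy' : (extChartAt (𝓡 m) x₀).symm y ∈ (extChartAt (𝓡 m) x₁).source) :
    volDensity g x₀ y = |(fderiv ℝ (localMap 𝔼 𝔼 (fun x : M => x) x₀ x₁) y).det| *
      volDensity g x₁ (localMap 𝔼 𝔼 (fun x : M => x) x₀ x₁ y) := by
  have h1 : metricRep g x₀ y = pullInner (metricRep g x₁ (localMap 𝔼 𝔼 (fun x : M => x) x₀ x₁ y))
      (fderiv ℝ (localMap 𝔼 𝔼 (fun x : M => x) x₀ x₁) y) := by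
    have hz : extChartAt (𝓡 m) x₁ ((extChartAt (𝓡 m) x₀).symm y) ∈ (extChartAt (𝓡 m) x₁).target :=
      (extChartAt (𝓡 m) x₁).map_source hy'
    have h2 : ∀ v, tmap 𝔼 𝔼 (extChartAt (𝓡 m) x₁).symm
        (extChartAt (𝓡 m) x₁ ((extChartAt (𝓡 m) x₀).symm y))
        (fderiv ℝ (localMap 𝔼 𝔼 (fun x : M => x) x₀ x₁) y v) =
        tmap 𝔼 𝔼 (extChartAt (𝓡 m) x₀).symm y v := by
      intro v
      rw [fderiv_localMap (f := fun x : M => x) hy mdifferentiableAt_id hy', tmap_id]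
      exact congrArg (fun L : 𝔼 →L[ℝ] 𝔼 => L (tmap 𝔼 𝔼 (extChartAt (𝓡 m) x₀).symm y v))
        (tmap_symm_comp_chart hy')
    refine ContinuousLinearMap.ext fun u => ContinuousLinearMap.ext fun v => ?_
    change metricAt g _ (tmap 𝔼 𝔼 _ _ u) (tmap 𝔼 𝔼 _ _ v) = metricAt g ((extChartAt (𝓡 m) x₁).symm
      (extChartAt (𝓡 m) x₁ ((extChartAt (𝓡 m) x₀).symm y)))
      (tmap 𝔼 𝔼 _ (extChartAt (𝓡 m) x₁ ((extChartAt (𝓡 m) x₀).symm y)) (fderiv ℝ _ y u))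
      (tmap 𝔼 𝔼 _ (extChartAt (𝓡 m) x₁ ((extChartAt (𝓡 m) x₀).symm y)) (fderiv ℝ _ y v))
    rw [h2, h2, (extChartAt (𝓡 m) x₁).left_inv hy']
  rw [volDensity, h1, det_gram_pullInner, Real.sqrt_mul (sq_nonneg _), Real.sqrt_sq_eq_abs]
  rfl

variable [MeasurableSpace M] [BorelSpace M]

theorem aemeasurable_chart_symm (x₀ : M) : AEMeasurable (extChartAt (𝓡 m) x₀).symm
    ((volume.restrict (extChartAt (𝓡 m) x₀).target).withDensity fun y =>
      ENNReal.ofReal (volDensity g x₀ y)) :=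
  ((continuousOn_extChartAt_symm x₀).aemeasurable
    (isOpen_extChartAt_target x₀).measurableSet).mono_ac (withDensity_absolutelyContinuous _ _)

theorem chartVolume_apply (x₀ : M) {s : Set M} (hs : MeasurableSet s) :
    chartVolume g x₀ s = ∫⁻ y in (extChartAt (𝓡 m) x₀).symm ⁻¹' s ∩ (extChartAt (𝓡 m) x₀).target,
      ENNReal.ofReal (volDensity g x₀ y) := by
  refine (Measure.map_apply_of_aemeasurable (aemeasurable_chart_symm g x₀) hs).trans ?_
  rw [withDensity_apply', Measure.restrict_restrict' (isOpen_extChartAt_target x₀).measurableSet]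

theorem measurableSet_chart_symm_preimage (x₀ : M) {s : Set M} (hs : MeasurableSet s) :
    MeasurableSet ((extChartAt (𝓡 m) x₀).symm ⁻¹' s ∩ (extChartAt (𝓡 m) x₀).target) := by
  have h := (isOpen_extChartAt_target (I := 𝓡 m) x₀).measurableSet.subtype_image
    ((continuousOn_extChartAt_symm (I := 𝓡 m) x₀).domRestrict.measurable hs)
  convert h using 1
  ext y
  simp [and_comm]

/-- Change of variables: the chart volumes agree on overlaps. -/
theorem chartVolume_eq {x₀ x₁ : M} {s : Set M} (hs : MeasurableSet s)
    (h0 : s ⊆ (extChartAt (𝓡 m) x₀).source) (h1 : s ⊆ (extChartAt (𝓡 m) x₁).source) :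
    chartVolume g x₀ s = chartVolume g x₁ s := by
  rw [chartVolume_apply g x₀ hs, chartVolume_apply g x₁ hs]
  set T := (extChartAt (𝓡 m) x₀).symm ⁻¹' s ∩ (extChartAt (𝓡 m) x₀).target with hT
  have himg : (extChartAt (𝓡 m) x₁).symm ⁻¹' s ∩ (extChartAt (𝓡 m) x₁).target =
      localMap 𝔼 𝔼 (fun x : M => x) x₀ x₁ '' T := by
    ext z
    constructor
    · rintro ⟨hz, hz'⟩
      refine ⟨extChartAt (𝓡 m) x₀ ((extChartAt (𝓡 m) x₁).symm z), ⟨?_, ?_⟩, ?_⟩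
      · change (extChartAt (𝓡 m) x₀).symm (extChartAt (𝓡 m) x₀ _) ∈ s
        rw [(extChartAt (𝓡 m) x₀).left_inv (h0 hz)]
        exact hz
      · exact (extChartAt (𝓡 m) x₀).map_source (h0 hz)
      · change extChartAt (𝓡 m) x₁ ((extChartAt (𝓡 m) x₀).symm (extChartAt (𝓡 m) x₀ _)) = z
        rw [(extChartAt (𝓡 m) x₀).left_inv (h0 hz), (extChartAt (𝓡 m) x₁).right_inv hz']
    · rintro ⟨y, ⟨hy, hy'⟩, rfl⟩
      refine ⟨?_, (extChartAt (𝓡 m) x₁).map_source (h1 hy)⟩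
      change (extChartAt (𝓡 m) x₁).symm (extChartAt (𝓡 m) x₁ ((extChartAt (𝓡 m) x₀).symm y)) ∈ s
      rw [(extChartAt (𝓡 m) x₁).left_inv (h1 hy)]
      exact hy
  have hTm : MeasurableSet T := measurableSet_chart_symm_preimage x₀ hs
  rw [himg, lintegral_image_eq_lintegral_abs_det_fderiv_mul volume hTm
    (f' := fderiv ℝ (localMap 𝔼 𝔼 (fun x : M => x) x₀ x₁))]
  · refine setLIntegral_congr_fun hTm fun y hy => ?_
    rw [volDensity_localMap g hy.2 (h1 hy.1), ENNReal.ofReal_mul (abs_nonneg _)]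
  · intro y hy
    exact ((contDiffAt_localMap hy.2 contMDiffAt_id (h1 hy.1)).differentiableAt
      (by simp)).hasFDerivAt.hasFDerivWithinAt
  · intro y hy z hz hyz
    have h2 := (extChartAt (𝓡 m) x₁).injOn (h1 hy.1) (h1 hz.1) hyz
    exact (extChartAt (𝓡 m) x₀).symm.injOn hy.2 hz.2 h2

variable [T2Space M] [SigmaCompactSpace M]

theorem chartPartition_subordinate (x : M) :
    tsupport (chartPartition m M x) ⊆ (extChartAt (𝓡 m) x).source := by
  rw [extChartAt_source]
  exact (SmoothPartitionOfUnity.exists_isSubordinate_chartAt_source (𝓡 m) M).choose_spec x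

/-- On a compact subset only finitely many functions of the partition of unity are not zero. -/
theorem exists_finset_chartPartition {K : Set M} (hK : IsCompact K) : ∃ t : Finset M,
    (∀ x ∉ t, ∀ y ∈ K, chartPartition m M x y = 0) ∧
      ∀ y ∈ K, ∑ x ∈ t, chartPartition m M x y = 1 := by
  have hfin := (chartPartition m M).locallyFinite.finite_nonempty_inter_compact hK
  have h0 : ∀ x ∉ hfin.toFinset, ∀ y ∈ K, chartPartition m M x y = 0 := by
    intro x hx y hy
    by_contra hne
    exact hx (hfin.mem_toFinset.2 ⟨y, hne, hy⟩)
  refine ⟨hfin.toFinset, h0, fun y hy => ?_⟩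
  rw [← (chartPartition m M).sum_eq_one (Set.mem_univ y)]
  refine (finsum_eq_sum_of_support_subset _ fun x hx => ?_).symm
  by_contra hx'
  exact hx (h0 x hx' y hy)

/-- On a compact subset of a chart domain the Riemannian volume is the volume of that chart. -/
theorem riemannianVolume_apply_of_subset {x₀ : M} {K s : Set M} (hK : IsCompact K)
    (hKx : K ⊆ (extChartAt (𝓡 m) x₀).source) (hs : MeasurableSet s) (hsK : s ⊆ K) :
    riemannianVolume g s = chartVolume g x₀ s := by
  obtain ⟨t, ht0, ht1⟩ := exists_finset_chartPartition (m := m) hK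
  have hmeas : ∀ x, Measurable fun y => ENNReal.ofReal (chartPartition m M x y) := fun x =>
    ENNReal.measurable_ofReal.comp (chartPartition m M x).contMDiff.continuous.measurable
  have h1 : ∀ x, ((chartVolume g x).withDensity fun y => ENNReal.ofReal (chartPartition m M x y)) s
      = ∫⁻ y in s, ENNReal.ofReal (chartPartition m M x y) ∂(chartVolume g x₀) := by
    intro x
    have hsx : MeasurableSet (s ∩ (extChartAt (𝓡 m) x).source) :=
      hs.inter (isOpen_extChartAt_source x).measurableSet
    have h2 : ∀ μ : Measure M, ∫⁻ y in s, ENNReal.ofReal (chartPartition m M x y) ∂μ =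
        ∫⁻ y in s ∩ (extChartAt (𝓡 m) x).source, ENNReal.ofReal (chartPartition m M x y) ∂μ := by
      intro μ
      rw [Set.inter_comm, ← Measure.restrict_restrict (isOpen_extChartAt_source x).measurableSet]
      refine (setLIntegral_eq_of_support_subset fun y hy => ?_).symm
      refine chartPartition_subordinate x (subset_tsupport _ fun h0 => hy ?_)
      simp only [h0, ENNReal.ofReal_zero]
    rw [withDensity_apply _ hs, h2, h2]
    congr 1
    refine Measure.ext fun u hu => ?_
    rw [Measure.restrict_apply hu, Measure.restrict_apply hu]
    exact chartVolume_eq g (hu.inter hsx) (fun y hy => hy.2.2) (fun y hy => hKx (hsK hy.2.1))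
  rw [riemannianVolume, Measure.sum_apply _ hs, tsum_congr h1, tsum_eq_sum (s := t),
    ← lintegral_finsetSum _ fun x _ => hmeas x]
  · rw [setLIntegral_congr_fun (g := fun _ => 1) hs, setLIntegral_one]
    intro y hy
    simp only
    rw [← ENNReal.ofReal_sum_of_nonneg fun x _ => (chartPartition m M).nonneg x y,
      ht1 y (hsK hy), ENNReal.ofReal_one]
  · intro x hx
    rw [setLIntegral_congr_fun (g := fun _ => 0) hs, lintegral_zero]
    intro y hy
    simp only
    rw [ht0 x hx y (hsK hy), ENNReal.ofReal_zero]

/-- The Riemannian volume, defined by a partition of unity, is given on a compact subset of a chart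
domain by the density of that chart. -/
theorem restrict_riemannianVolume {x₀ : M} {K : Set M} (hK : IsCompact K)
    (hKx : K ⊆ (extChartAt (𝓡 m) x₀).source) :
    (riemannianVolume g).restrict K = (chartVolume g x₀).restrict K := by
  refine Measure.ext fun u hu => ?_
  rw [Measure.restrict_apply hu, Measure.restrict_apply hu]
  exact riemannianVolume_apply_of_subset g hK hKx (hu.inter hK.measurableSet) Set.inter_subset_right

theorem chart_symm_preimage_eq_image {x₀ : M} {K : Set M}
    (hKx : K ⊆ (extChartAt (𝓡 m) x₀).source) :
    (extChartAt (𝓡 m) x₀).symm ⁻¹' K ∩ (extChartAt (𝓡 m) x₀).target = extChartAt (𝓡 m) x₀ '' K := by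
  ext y
  constructor
  · rintro ⟨hy, hy'⟩
    exact ⟨_, hy, (extChartAt (𝓡 m) x₀).right_inv hy'⟩
  · rintro ⟨x, hx, rfl⟩
    refine ⟨?_, (extChartAt (𝓡 m) x₀).map_source (hKx hx)⟩
    change (extChartAt (𝓡 m) x₀).symm _ ∈ K
    rwa [(extChartAt (𝓡 m) x₀).left_inv (hKx hx)]

theorem exists_compact_nhds_chart {x : M} {U : Set M} (hU : U ∈ 𝓝 x) : ∃ K ∈ 𝓝 x, IsCompact K ∧
    K ⊆ U ∧ K ⊆ (extChartAt (𝓡 m) x).source := by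
  have : LocallyCompactSpace M := Manifold.locallyCompact_of_finiteDimensional (𝓡 m)
  obtain ⟨K, hK, hKs, hKc⟩ := local_compact_nhds (Filter.inter_mem hU
    (extChartAt_source_mem_nhds (I := 𝓡 m) x))
  exact ⟨K, hK, hKc, fun y hy => (hKs hy).1, fun y hy => (hKs hy).2⟩

theorem isCompact_image_chart {x₀ : M} {K : Set M} (hK : IsCompact K)
    (hKx : K ⊆ (extChartAt (𝓡 m) x₀).source) : IsCompact (extChartAt (𝓡 m) x₀ '' K) :=
  hK.image_of_continuousOn ((continuousOn_extChartAt x₀).mono hKx)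

instance isLocallyFiniteMeasure_riemannianVolume :
    IsLocallyFiniteMeasure (riemannianVolume g) := by
  refine ⟨fun x => ?_⟩
  obtain ⟨K, hK, hKc, -, hKx⟩ := exists_compact_nhds_chart (m := m) (x := x) Filter.univ_mem
  refine ⟨K, hK, ?_⟩
  rw [riemannianVolume_apply_of_subset g hKc hKx hKc.measurableSet subset_rfl,
    chartVolume_apply g x hKc.measurableSet, chart_symm_preimage_eq_image hKx]
  have hc := isCompact_image_chart hKc hKx
  have hsub : extChartAt (𝓡 m) x '' K ⊆ (extChartAt (𝓡 m) x).target := by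
    rintro _ ⟨y, hy, rfl⟩
    exact (extChartAt (𝓡 m) x).map_source (hKx hy)
  have hint : IntegrableOn (volDensity g x) (extChartAt (𝓡 m) x '' K) :=
    ((continuousOn_volDensity g x).mono hsub).integrableOn_compact hc
  exact hint.lintegral_lt_top

instance isOpenPosMeasure_riemannianVolume : (riemannianVolume g).IsOpenPosMeasure := by
  refine ⟨fun U hU ⟨x, hx⟩ h0 => ?_⟩
  obtain ⟨K, hK, hKc, hKU, hKx⟩ := exists_compact_nhds_chart (m := m) (hU.mem_nhds hx)
  have h1 := measure_mono_null hKU h0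
  rw [riemannianVolume_apply_of_subset g hKc hKx hKc.measurableSet subset_rfl,
    chartVolume_apply g x hKc.measurableSet] at h1
  set T := (extChartAt (𝓡 m) x).symm ⁻¹' K ∩ (extChartAt (𝓡 m) x).target with hT
  have hTm : MeasurableSet T := measurableSet_chart_symm_preimage x hKc.measurableSet
  have hTn : T ∈ 𝓝 (extChartAt (𝓡 m) x x) :=
    Filter.inter_mem (tendsto_chart_symm (mem_extChartAt_source x) hK)
      (extChartAt_target_mem_nhds x)
  have hpos : 0 < volume T := Measure.measure_pos_of_mem_nhds _ hTn
  have hcont : AEMeasurable (fun y => ENNReal.ofReal (volDensity g x y)) (volume.restrict T) :=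
    (((continuousOn_volDensity g x).mono Set.inter_subset_right).aemeasurable hTm).ennreal_ofReal
  rw [lintegral_eq_zero_iff' hcont] at h1
  have h2 : ∀ᵐ y ∂(volume.restrict T), False := by
    filter_upwards [h1, ae_restrict_mem hTm] with y hy hyT
    have h3 := volDensity_pos g hyT.2
    rw [Pi.zero_apply, ENNReal.ofReal_eq_zero] at hy
    exact absurd hy (not_le.2 h3)
  rw [Filter.eventually_false_iff_eq_bot, ae_eq_bot, Measure.restrict_eq_zero] at h2
  exact hpos.ne' h2

end Volume

/-! ### Stokes' theorem -/

section Stokes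
open MeasureTheory

/-- Stokes' theorem in `E`: the integral of an exterior derivative with compact support is zero. -/
theorem integral_extDeriv_eq_zero {E : Type*} [NormedAddCommGroup E] [NormedSpace ℝ E]
    [FiniteDimensional ℝ E] [MeasurableSpace E] [BorelSpace E] (μ : Measure E)
    [μ.IsAddHaarMeasure] {k : ℕ} {u : E → E [⋀^Fin k]→L[ℝ] ℝ} (hu : ContDiff ℝ ∞ u)
    (hc : HasCompactSupport u) (e : Fin (k + 1) → E) : ∫ y, extDeriv u y e ∂μ = 0 := by
  have hd : ∀ (v : Fin k → E) (w : E), Integrable (fun y => fderiv ℝ (fun z => u z v) y w) μ ∧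
      ∫ y, fderiv ℝ (fun z => u z v) y w ∂μ = 0 := by
    intro v w
    have h1 : ContDiff ℝ ∞ fun z => u z v := contDiff_iff_contDiffAt.2 fun z =>
      contDiffAt_alternating_apply_const hu.contDiffAt v
    have h2 : HasCompactSupport fun z => u z v :=
      hc.comp_left (g := fun β : E [⋀^Fin k]→L[ℝ] ℝ => β v) rfl
    have h3 : Continuous fun y => fderiv ℝ (fun z => u z v) y w :=
      (h1.continuous_fderiv (by simp)).clm_apply continuous_const
    have h4 : HasCompactSupport fun y => fderiv ℝ (fun z => u z v) y w :=
      (h2.fderiv (𝕜 := ℝ)).comp_left (g := fun L : E →L[ℝ] ℝ => L w) rfl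
    have h5 := h3.integrable_of_hasCompactSupport (μ := μ) h4
    refine ⟨h5, ?_⟩
    have h6 := integral_mul_fderiv_eq_neg_fderiv_mul_of_integrable (μ := μ)
      (f := fun _ : E => (1 : ℝ)) (g := fun z => u z v) (v := w) (by simp) (by simpa using h5)
      (by simpa using h1.continuous.integrable_of_hasCompactSupport (μ := μ) h2)
      (fun x _ => differentiableAt_const _)
      (fun x _ => (h1.differentiable (by simp)).differentiableAt)
    simpa using h6
  have he : ∀ y, extDeriv u y e = ∑ i : Fin (k + 1), (-1) ^ (i : ℕ) *
      fderiv ℝ (fun z => u z (i.removeNth e)) y (e i) := by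
    intro y
    rw [extDeriv_apply (hu.differentiable (by simp)).differentiableAt]
    simp
  simp_rw [he]
  rw [integral_finsetSum _ fun i _ => (hd _ _).1.const_mul _]
  refine Finset.sum_eq_zero fun i _ => ?_
  rw [integral_const_mul, (hd _ _).2, mul_zero]

variable {m : ℕ} {M : Type*} [TopologicalSpace M] [ChartedSpace (EuclideanSpace ℝ (Fin m)) M]
  [IsManifold (𝓡 m) ∞ M]
local notation "𝔼" => EuclideanSpace ℝ (Fin m)

/-- `V` is, up to sign, the volume form of the metric `g`:
`V(u₁, …, uₘ)² = det g(uᵢ, uⱼ)`. -/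
def IsVolumeForm (g : RiemMetric m M) (V : M → EuclideanSpace ℝ (Fin m) [⋀^Fin m]→L[ℝ] ℝ) : Prop :=
  IsSmoothForm V ∧
    ∀ x u, V x u ^ 2 = (Matrix.of fun i j => metricAt g x (u i) (u j)).det

/-- The function `f` with `β = f V`, for a form `β` of top degree. -/
def topRatio (V β : M → EuclideanSpace ℝ (Fin m) [⋀^Fin m]→L[ℝ] ℝ) (x : M) : ℝ :=
  β x stdVec / V x stdVec

variable {g : RiemMetric m M} {V : M → EuclideanSpace ℝ (Fin m) [⋀^Fin m]→L[ℝ] ℝ}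

theorem IsVolumeForm.ne_zero (hV : IsVolumeForm g V) (x : M) : V x stdVec ≠ 0 := by
  intro h0
  have h := hV.2 x stdVec
  rw [h0, zero_pow two_ne_zero] at h
  exact (det_gram_pos (isInner_metricAt g x)).ne h

theorem IsVolumeForm.eq_topRatio_smul (hV : IsVolumeForm g V)
    (β : M → EuclideanSpace ℝ (Fin m) [⋀^Fin m]→L[ℝ] ℝ) (x : M) : β x = topRatio V β x • V x := by
  refine ext_frame rfl ((isFrame_recip (isInner_metricAt g x)).swap (isInner_metricAt g x)) ?_
  change β x stdVec = β x stdVec / V x stdVec * V x stdVec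
  rw [div_mul_cancel₀ _ (hV.ne_zero x)]

theorem IsVolumeForm.chartRep_sq (hV : IsVolumeForm g V) (x₀ : M) (y : 𝔼) :
    chartRep V x₀ y stdVec ^ 2 = (gram (metricRep g x₀ y)).det :=
  hV.2 _ _

theorem IsVolumeForm.chartRep_ne_zero (hV : IsVolumeForm g V) {x₀ : M} {y : 𝔼}
    (hy : y ∈ (extChartAt (𝓡 m) x₀).target) : chartRep V x₀ y stdVec ≠ 0 := by
  intro h0
  have h := hV.chartRep_sq x₀ y
  rw [h0, zero_pow two_ne_zero] at h
  exact (det_gram_pos (isInner_metricRep g hy)).ne h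

theorem topRatio_eq_chartRep (hV : IsVolumeForm g V)
    (β : M → EuclideanSpace ℝ (Fin m) [⋀^Fin m]→L[ℝ] ℝ) (x₀ : M) (y : 𝔼) :
    chartRep β x₀ y stdVec = topRatio V β ((extChartAt (𝓡 m) x₀).symm y) *
      chartRep V x₀ y stdVec := by
  conv_lhs => rw [chartRep, pullback, hV.eq_topRatio_smul β]
  rfl

theorem continuous_topRatio (hV : IsVolumeForm g V)
    {β : M → EuclideanSpace ℝ (Fin m) [⋀^Fin m]→L[ℝ] ℝ} (hβ : IsSmoothForm β) :
    Continuous (topRatio V β) := by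
  refine continuous_iff_continuousAt.2 fun x₀ => ?_
  have hy := mem_extChartAt_target (I := 𝓡 m) x₀
  have hc : ∀ {α : M → EuclideanSpace ℝ (Fin m) [⋀^Fin m]→L[ℝ] ℝ}, IsSmoothForm α →
      ContinuousAt (fun y => chartRep α x₀ y stdVec) (extChartAt (𝓡 m) x₀ x₀) := fun hα =>
    (contDiffAt_alternating_apply_const ((hα x₀).contDiffAt
      ((isOpen_extChartAt_target x₀).mem_nhds hy)) _).continuousAt
  have h1 := ((hc hβ).div (hc hV.1) (hV.chartRep_ne_zero hy)).comp
    (continuousAt_extChartAt (I := 𝓡 m) x₀)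
  refine h1.congr ?_
  filter_upwards [extChartAt_source_mem_nhds (I := 𝓡 m) x₀] with x hx
  have hx' := (extChartAt (𝓡 m) x₀).map_source hx
  simp only [Function.comp_apply, Pi.div_apply]
  rw [topRatio_eq_chartRep hV β x₀, (extChartAt (𝓡 m) x₀).left_inv hx,
    mul_div_cancel_right₀ _ (hV.chartRep_ne_zero hx')]

variable [MeasurableSpace M] [BorelSpace M] [T2Space M] [SigmaCompactSpace M]

theorem integral_riemannianVolume_of_subset (g : RiemMetric m M) {x₀ : M} {K : Set M}
    (hK : IsCompact K) (hKx : K ⊆ (extChartAt (𝓡 m) x₀).source) {f : M → ℝ} (hf : Continuous f)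
    (hfK : ∀ x ∉ K, f x = 0) :
    ∫ x, f x ∂(riemannianVolume g) = ∫ y in (extChartAt (𝓡 m) x₀).target,
      volDensity g x₀ y * f ((extChartAt (𝓡 m) x₀).symm y) := by
  rw [← setIntegral_eq_integral_of_forall_compl_eq_zero hfK, restrict_riemannianVolume g hK hKx,
    setIntegral_eq_integral_of_forall_compl_eq_zero hfK]
  refine (integral_map (aemeasurable_chart_symm g x₀)
    hf.measurable.aestronglyMeasurable).trans ?_
  rw [integral_withDensity_eq_integral_toReal_smul₀]
  · refine setIntegral_congr_fun (isOpen_extChartAt_target x₀).measurableSet fun y hy => ?_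
    simp only [smul_eq_mul]
    rw [ENNReal.toReal_ofReal (volDensity_pos g hy).le]
  · exact ((continuousOn_volDensity g x₀).aemeasurable
      (isOpen_extChartAt_target x₀).measurableSet).ennreal_ofReal
  · exact Filter.Eventually.of_forall fun _ => ENNReal.ofReal_lt_top

theorem extD_eq_zero_of_notMem {r : ℕ} {θ : M → EuclideanSpace ℝ (Fin m) [⋀^Fin r]→L[ℝ] ℝ}
    {K : Set M} (hK : IsClosed K) (hθK : ∀ x ∉ K, θ x = 0) {x : M} (hx : x ∉ K) :
    extD θ x = 0 := by
  have h : θ =ᶠ[𝓝 x] fun _ => 0 := by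
    filter_upwards [hK.isOpen_compl.mem_nhds hx] with y hy using hθK y hy
  rw [extD_congr h]
  exact extD_zero

/-- Stokes' theorem for a form which is supported in a chart domain. The sign of the coordinate
representation of `V` makes up for the chart possibly reversing the orientation given by `V`. -/
theorem integral_topRatio_extD_of_subset {r : ℕ} (hm : r + 1 = m) (hV : IsVolumeForm g V)
    {θ : M → EuclideanSpace ℝ (Fin m) [⋀^Fin r]→L[ℝ] ℝ} (hθ : IsSmoothForm θ) {x₀ : M} {K : Set M}
    (hK : IsCompact K) (hKx : K ⊆ (extChartAt (𝓡 m) x₀).source) (hθK : ∀ x ∉ K, θ x = 0) :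
    ∫ x, topRatio V (fun x => castDegree hm (extD θ x)) x ∂(riemannianVolume g) = 0 := by
  subst hm
  change ∫ x, topRatio V (extD θ) x ∂(riemannianVolume g) = 0
  have hop := isOpen_extChartAt_target (I := 𝓡 (r + 1)) x₀
  rw [integral_riemannianVolume_of_subset g hK hKx (continuous_topRatio hV hθ.extD) fun x hx => by
    rw [topRatio, extD_eq_zero_of_notMem hK.isClosed hθK hx]
    exact zero_div _]
  let T := (extChartAt (𝓡 (r + 1)) x₀).target
  -- `s` is the orientation of the chart relative to `V`, and `u` is `s θ` in coordinates, extended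
  -- by zero; since `s` is locally constant, `u` is smooth and `du` is `s dθ`
  let s : EuclideanSpace ℝ (Fin (r + 1)) → ℝ := fun y => SignType.sign (chartRep V x₀ y stdVec)
  let u : EuclideanSpace ℝ (Fin (r + 1)) → EuclideanSpace ℝ (Fin (r + 1)) [⋀^Fin r]→L[ℝ] ℝ :=
    T.indicator fun y => s y • chartRep θ x₀ y
  have hu0 : ∀ y ∉ extChartAt (𝓡 (r + 1)) x₀ '' K, u y = 0 := by
    intro y hy
    by_cases hyT : y ∈ T
    · have h1 : (extChartAt (𝓡 (r + 1)) x₀).symm y ∉ K := fun h =>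
        hy ⟨_, h, (extChartAt (𝓡 (r + 1)) x₀).right_inv hyT⟩
      simp only [u, Set.indicator_of_mem hyT, chartRep, pullback, hθK _ h1]
      exact smul_zero _
    · exact Set.indicator_of_notMem hyT _
  have hcpt := isCompact_image_chart hK hKx
  have huT : ∀ y ∈ T, u =ᶠ[𝓝 y] fun z => s y • chartRep θ x₀ z := by
    intro y hy
    have hc : ContinuousAt (fun z => chartRep V x₀ z stdVec) y :=
      (contDiffAt_alternating_apply_const ((hV.1 x₀).contDiffAt (hop.mem_nhds hy)) _).continuousAt
    have hs : ∀ᶠ z in 𝓝 y, s z = s y := by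
      rcases lt_or_gt_of_ne (hV.chartRep_ne_zero hy) with h | h
      · filter_upwards [hc.eventually_lt_const h] with z hz
        simp only [s, sign_neg h, sign_neg hz]
      · filter_upwards [hc.eventually_const_lt h] with z hz
        simp only [s, sign_pos h, sign_pos hz]
    filter_upwards [hs, hop.mem_nhds hy] with z hz hzT
    simp only [u, Set.indicator_of_mem (show z ∈ T from hzT), hz]
  have hu : ContDiff ℝ ∞ u := by
    refine contDiff_iff_contDiffAt.2 fun y => ?_
    by_cases hyT : y ∈ T
    · exact (((hθ x₀).contDiffAt (hop.mem_nhds hyT)).const_smul (s y)).congr_of_eventuallyEq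
        (huT y hyT)
    · have hy : y ∉ extChartAt (𝓡 (r + 1)) x₀ '' K := by
        rintro ⟨x, hx, rfl⟩
        exact hyT ((extChartAt (𝓡 (r + 1)) x₀).map_source (hKx hx))
      refine (contDiffAt_const (c := 0)).congr_of_eventuallyEq ?_
      filter_upwards [hcpt.isClosed.isOpen_compl.mem_nhds hy] with z hz using hu0 z hz
  have hcs : HasCompactSupport u := HasCompactSupport.intro hcpt hu0
  rw [← integral_extDeriv_eq_zero volume hu hcs stdVec,
    ← setIntegral_eq_integral_of_forall_compl_eq_zero (f := fun y => extDeriv u y stdVec) (s := T)]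
  · refine setIntegral_congr_fun hop.measurableSet fun y hy => ?_
    have h1 : extDeriv u y = s y • chartRep (extD θ) x₀ y := by
      rw [← extDeriv_chartRep hy (isSmoothForm_iff.1 hθ _), ← extDeriv_smul]
      exact (huT y hy).extDeriv_eq
    have h2 : volDensity g x₀ y = s y * chartRep V x₀ y stdVec := by
      rw [volDensity, ← hV.chartRep_sq, Real.sqrt_sq_eq_abs]
      exact (sign_mul_self _).symm
    rw [h1]
    change _ = s y * chartRep (extD θ) x₀ y stdVec
    rw [topRatio_eq_chartRep hV, h2]
    ring
  · intro y hy
    have hy : y ∉ extChartAt (𝓡 (r + 1)) x₀ '' K := by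
      rintro ⟨x, hx, rfl⟩
      exact hy ((extChartAt (𝓡 (r + 1)) x₀).map_source (hKx hx))
    have h1 : u =ᶠ[𝓝 y] fun _ => 0 := by
      filter_upwards [hcpt.isClosed.isOpen_compl.mem_nhds hy] with z hz using hu0 z hz
    rw [h1.extDeriv_eq]
    simp [extDeriv, ContinuousAlternatingMap.alternatizeUncurryFin_apply]

/-- Stokes' theorem for a form with compact support. -/
theorem integral_topRatio_extD {r : ℕ} (hm : r + 1 = m) (hV : IsVolumeForm g V)
    {θ : M → EuclideanSpace ℝ (Fin m) [⋀^Fin r]→L[ℝ] ℝ} (hθ : IsSmoothForm θ) {K : Set M}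
    (hK : IsCompact K) (hθK : ∀ x ∉ K, θ x = 0) :
    ∫ x, topRatio V (fun x => castDegree hm (extD θ x)) x ∂(riemannianVolume g) = 0 := by
  subst hm
  change ∫ x, topRatio V (extD θ) x ∂(riemannianVolume g) = 0
  obtain ⟨t, -, ht1⟩ := exists_finset_chartPartition (m := r + 1) hK
  let ψ : M → M → EuclideanSpace ℝ (Fin (r + 1)) [⋀^Fin r]→L[ℝ] ℝ :=
    fun i x => chartPartition (r + 1) M i x • θ x
  have hψ : ∀ i, IsSmoothForm (ψ i) := fun i => isSmoothForm_iff.2 fun x =>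
    SmoothFormAt.smul (chartPartition (r + 1) M i).contMDiff.contMDiffAt (isSmoothForm_iff.1 hθ x)
  have hsum : ∀ t : Finset M, IsSmoothForm (∑ i ∈ t, ψ i) ∧
      ∀ x, extD (∑ i ∈ t, ψ i) x = ∑ i ∈ t, extD (ψ i) x := by
    intro t
    induction t using Finset.cons_induction with
    | empty =>
      simp only [Finset.sum_empty]
      exact ⟨isSmoothForm_iff.2 fun x => SmoothFormAt.zero, fun x => extD_zero⟩
    | cons a t ha ih =>
      simp only [Finset.sum_cons]
      refine ⟨isSmoothForm_iff.2 fun x =>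
        (isSmoothForm_iff.1 (hψ a) x).add (isSmoothForm_iff.1 ih.1 x), fun x => ?_⟩
      rw [extD_add (isSmoothForm_iff.1 (hψ a) x) (isSmoothForm_iff.1 ih.1 x), ih.2]
  have hθt : θ = ∑ i ∈ t, ψ i := by
    funext x
    rw [Finset.sum_apply]
    by_cases hx : x ∈ K
    · simp only [ψ, ← Finset.sum_smul, ht1 x hx, one_smul]
    · simp only [ψ, hθK x hx, smul_zero, Finset.sum_const_zero]
  have hψK : ∀ i, ∀ x ∉ tsupport (chartPartition (r + 1) M i) ∩ K, ψ i x = 0 := by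
    intro i x hx
    by_cases hxK : x ∈ K
    · have h0 : chartPartition (r + 1) M i x = 0 := by
        by_contra hne
        exact hx ⟨subset_tsupport _ hne, hxK⟩
      simp only [ψ, h0, zero_smul]
    · simp only [ψ, hθK x hxK, smul_zero]
  have hKi : ∀ i, IsCompact (tsupport (chartPartition (r + 1) M i) ∩ K) := fun i =>
    hK.inter_left (isClosed_tsupport _)
  have hfun : topRatio V (extD θ) = fun x => ∑ i ∈ t, topRatio V (extD (ψ i)) x := by
    funext x
    simp only [topRatio]
    rw [← Finset.sum_div]
    congr 1
    conv_lhs => rw [hθt, (hsum t).2]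
    exact ContinuousAlternatingMap.sum_apply ..
  rw [hfun, integral_finsetSum]
  · exact Finset.sum_eq_zero fun i _ => integral_topRatio_extD_of_subset rfl hV (hψ i) (hKi i)
      (Set.inter_subset_left.trans (chartPartition_subordinate i)) (hψK i)
  · intro i _
    refine (continuous_topRatio hV (hψ i).extD).integrable_of_hasCompactSupport
      (HasCompactSupport.intro (hKi i) fun x hx => ?_)
    rw [topRatio, extD_eq_zero_of_notMem (hKi i).isClosed (hψK i) hx]
    exact zero_div _

end Stokes

/-! ### The divergence identity -/

section Green
open MeasureTheory

theorem castDegree_sub_smul {V : Type*} [NormedAddCommGroup V] [NormedSpace ℝ V] {m m' : ℕ}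
    (h : m = m') (h' : m' = m) (c d : ℝ) (β : V [⋀^Fin m]→L[ℝ] ℝ) :
    castDegree h' (c • castDegree h β - d • castDegree h β) = (c - d) • β := by
  subst h
  exact (sub_smul c d β).symm

/-- The decomposition into the primitive part and a multiple of `σ` is orthogonal: the inner product
with a primitive form only depends on the primitive part. -/
theorem formInner_primitivePart {n : ℕ} {F : Type*} [NormedAddCommGroup F] [NormedSpace ℝ F]
    {b : EuclideanSpace ℝ (Fin (2 * n)) →L[ℝ] EuclideanSpace ℝ (Fin (2 * n)) →L[ℝ] ℝ}
    (hb : IsInner b) {σ : EuclideanSpace ℝ (Fin (2 * n)) [⋀^Fin 2]→L[ℝ] ℝ} (κ : F →L[ℝ] F →L[ℝ] ℝ)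
    (ν : EuclideanSpace ℝ (Fin (2 * n)) [⋀^Fin 2]→L[ℝ] F)
    {β : EuclideanSpace ℝ (Fin (2 * n)) [⋀^Fin 2]→L[ℝ] F} (hβ : contraction b σ β = 0) :
    formInner b κ (primitivePart b σ ν) β = formInner b κ ν β := by
  have h := formInner_add_left (b := b) κ (primitivePart b σ ν)
    (formSmul σ ((n : ℝ)⁻¹ • contraction b σ ν)) β
  rw [formInner_formSmul κ hb, hβ, map_zero, add_zero, primitivePart, sub_add_cancel] at h
  exact h.symm

variable {n : ℕ} {M : Type*} [TopologicalSpace M]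
  [ChartedSpace (EuclideanSpace ℝ (Fin (2 * n))) M]
  [IsManifold (𝓡 (2 * n)) ∞ M]
  {𝔤 : Type*} [NormedAddCommGroup 𝔤] [NormedSpace ℝ 𝔤] [FiniteDimensional ℝ 𝔤]
  {G : Type*} [TopologicalSpace G] [ChartedSpace 𝔤 G] [Group G] [LieGroup 𝓘(ℝ, 𝔤) ∞ G]
  {EP : Type*} [NormedAddCommGroup EP] [NormedSpace ℝ EP] [FiniteDimensional ℝ EP]
  {P : Type*} [TopologicalSpace P] [ChartedSpace EP P] [IsManifold 𝓘(ℝ, EP) ∞ P]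
  [MulAction Gᵐᵒᵖ P] {π : P → M}
  {σ : M → EuclideanSpace ℝ (Fin (2 * n)) [⋀^Fin 2]→L[ℝ] ℝ} {g : RiemMetric (2 * n) M}
  {A : P → EP →L[ℝ] 𝔤} {κ : 𝔤 →L[ℝ] 𝔤 →L[ℝ] ℝ}
local notation "𝔼" => EuclideanSpace ℝ (Fin (2 * n))

theorem IsCompatible.exists_isUnitaryTriple (hg : IsCompatible g σ) (x : M) :
    ∃ J, IsUnitaryTriple (metricAt g x) (σ x) J := by
  obtain ⟨J, h1, h2⟩ := hg
  exact ⟨J x, isInner_metricAt g x, h1 x, h2 x⟩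

/-- For a compatible metric, `ωⁿ / n!` is the Riemannian volume form. -/
theorem isVolumeForm_liouville (hσ : IsSymplectic σ) (hg : IsCompatible g σ) :
    IsVolumeForm g fun x => liouville (σ x) n := by
  refine ⟨fun x₀ y hy => ?_, fun x u => ?_⟩
  · have h : chartRep (fun x => liouville (σ x) n) x₀ = fun y => liouville (chartRep σ x₀ y) n :=
      funext fun y => (liouville_comp _ _ _).symm
    rw [h]
    exact (contDiffAt_liouville ((hσ.smooth x₀).contDiffAt
      ((isOpen_extChartAt_target x₀).mem_nhds hy)) n).contDiffWithinAt
  · obtain ⟨J, hJ⟩ := hg.exists_isUnitaryTriple x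
    obtain ⟨v, hv, hv'⟩ := hJ.exists_frame (n := n) (by simp)
    exact sq_eq_det_gram hJ.inner (by simp) hv hv' u

variable (hπ : IsPrincipalBundle (EuclideanSpace ℝ (Fin (2 * n))) 𝔤 EP G π) (hA : IsConnection G A)
  (hσ : IsSymplectic σ) (hg : IsCompatible g σ) (hκ : IsAdInvariantInner G κ)

include hκ in
theorem formInner_rightMul (hπ : IsPrincipalBundle (EuclideanSpace ℝ (Fin (2 * n))) 𝔤 EP G π)
    (g : RiemMetric (2 * n) M) {k : ℕ} {α β : P → 𝔼 [⋀^Fin k]→L[ℝ] 𝔤}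
    (hα : IsAdForm (EP := EP) G π α) (hβ : IsAdForm (EP := EP) G π β) (a : G) (p : P) :
    formInner (metricAt g (π (rightMul a p))) κ (α (rightMul a p)) (β (rightMul a p)) =
      formInner (metricAt g (π p)) κ (α p) (β p) := by
  rw [hα.equivariant, hβ.equivariant, hπ.proj_rightMul, formInner_postcomp _ (hκ.invariant _)]

include hπ hA hκ in
theorem continuous_descend_formInner (g : RiemMetric (2 * n) M) {k : ℕ}
    {α β : P → 𝔼 [⋀^Fin k]→L[ℝ] 𝔤} (hα : IsAdForm (EP := EP) G π α)
    (hβ : IsAdForm (EP := EP) G π β) :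
    Continuous (descend π fun p => formInner (metricAt g (π p)) κ (α p) (β p)) :=
  continuous_descend hπ (formInner_rightMul hκ hπ g hα hβ) (continuous_formInner hπ hA g κ hα hβ)

/-- The `(2n-1)`-form `κ(η ∧ *α)` on `M`. -/
def greenForm (hn : 2 ≤ n) (κ : 𝔤 →L[ℝ] 𝔤 →L[ℝ] ℝ)
    (σ : M → EuclideanSpace ℝ (Fin (2 * n)) [⋀^Fin 2]→L[ℝ] ℝ)
    (g : RiemMetric (2 * n) M) (π : P → M)
    (η : P → EuclideanSpace ℝ (Fin (2 * n)) [⋀^Fin 1]→L[ℝ] 𝔤)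
    (α : P → EuclideanSpace ℝ (Fin (2 * n)) [⋀^Fin 2]→L[ℝ] 𝔤) (p : P) :
    EuclideanSpace ℝ (Fin (2 * n)) [⋀^Fin (2 * n - 2 + 1)]→L[ℝ] ℝ :=
  wedgeOne κ (ofOneForm (η p)) (starAd σ g π (k := 2) (l := 2 * n - 2) (by omega) α p)

section Identity
variable (hn : 2 ≤ n) {η : P → EuclideanSpace ℝ (Fin (2 * n)) [⋀^Fin 1]→L[ℝ] 𝔤}
  {α : P → EuclideanSpace ℝ (Fin (2 * n)) [⋀^Fin 2]→L[ℝ] 𝔤} (hη : IsAdForm (EP := EP) G π η)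
  (hα : IsAdForm (EP := EP) G π α)
include hπ hA hσ hκ hη hα

theorem greenForm_rightMul (a : G) (p : P) :
    greenForm hn κ σ g π η α (rightMul a p) = greenForm hn κ σ g π η α p := by
  rw [greenForm, hη.equivariant,
    (hα.starAd hπ hA hσ.smooth g (k := 2) (l := 2 * n - 2) (by omega)).equivariant,
    wedgeOne_postcomp (hκ.invariant _)]
  rfl

omit hκ in
theorem lift_greenForm : lift EP π (greenForm hn κ σ g π η α) = fun p =>
    wedgeOne κ (ofOneForm (lift EP π η p))
      (lift EP π (starAd σ g π (k := 2) (l := 2 * n - 2) (by omega) α) p) :=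
  funext fun _ => wedgeOne_comp ..

omit hκ in
theorem isSmoothForm_lift_greenForm : IsSmoothForm (lift EP π (greenForm hn κ σ g π η α)) := by
  rw [lift_greenForm hπ hA hσ hn hη hα]
  exact isSmoothForm_iff.2 fun p => SmoothFormAt.wedgeOne κ (isSmoothForm_iff.1 hη.smooth p)
    (isSmoothForm_iff.1 (hα.starAd hπ hA hσ.smooth g (k := 2) (l := 2 * n - 2) (by omega)).smooth p)

include hg in
/-- The divergence identity `d κ(η ∧ *α) = (⟨d_A η, α⟩ - ⟨η, -*d_A*α⟩) vol`. -/
theorem extD_greenForm (h : 2 * n - 2 + 1 + 1 = 2 * n) (p : P) :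
    castDegree h (extD (descendForm π (greenForm hn κ σ g π η α)) (π p)) =
      (formInner (metricAt g (π p)) κ (covD π A η p) (α p) -
        formInner (metricAt g (π p)) κ (η p) (negStarDStar hn σ g π A α p)) •
      liouville (σ (π p)) n := by
  have hs := hα.starAd hπ hA hσ.smooth g (k := 2) (l := 2 * n - 2) (by omega)
  obtain ⟨J, hJ⟩ := hg.exists_isUnitaryTriple (π p)
  obtain ⟨v, hv, hv'⟩ := hJ.exists_frame (n := n) (by simp)
  have h1 : extD (descendForm π (greenForm hn κ σ g π η α)) (π p) =
      wedgePair κ (covD π A η p) (starAd σ g π (k := 2) (l := 2 * n - 2) (by omega) α p) -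
      wedgeOne κ (ofOneForm (η p))
        (covD π A (starAd σ g π (k := 2) (l := 2 * n - 2) (by omega) α) p) := by
    rw [extD_descendForm hπ (greenForm_rightMul hπ hA hσ hκ hn hη hα) hA
      (isSmoothForm_lift_greenForm hπ hA hσ hn hη hα), lift_greenForm hπ hA hσ hn hη hα,
      extD_wedgeOne κ (isSmoothForm_iff.1 hη.smooth p) (isSmoothForm_iff.1 hs.smooth p)]
    have e0 : ∀ {k : ℕ} (γ : P → 𝔼 [⋀^Fin k]→L[ℝ] 𝔤),
        (lift EP π γ p).compContinuousLinearMap (horizontalLift π A p) = γ p := by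
      intro k γ
      ext w
      change γ p (fun i => tmap EP 𝔼 π p (horizontalLift π A p (w i))) = γ p w
      simp only [tmap_proj_horizontalLift hπ hA]
    have e1 := wedgePair_comp κ (extD (lift EP π η) p)
      (lift EP π (starAd σ g π (k := 2) (l := 2 * n - 2) (by omega) α) p)
      (horizontalLift π A p : 𝔼 →L[ℝ] EP)
    have e2 := wedgeOne_comp κ (lift EP π η p)
      (extD (lift EP π (starAd σ g π (k := 2) (l := 2 * n - 2) (by omega) α)) p)
      (horizontalLift π A p : 𝔼 →L[ℝ] EP)
    rw [e0] at e1 e2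
    rw [covD, covD, ← e1, ← e2]
    rfl
  have hw : 2 * n = 2 * n - 2 + 1 + 1 := h.symm
  have h2 := wedgePair_hodgeStar (b := metricAt g (π p)) (l := 2 * n - 2) hw κ hκ.symm
    (liouville (σ (π p)) n) (covD π A η p) (α p)
  have hframe : ∀ (w : Fin (2 * n - 2 + 1 + 1) → 𝔼),
      (∀ i, w i = v (Fin.cast h i)) → IsFrame (metricAt g (π p)) w w ∧
      castDegree hw (liouville (σ (π p)) n) w ^ 2 = 1 := by
    intro w hw'
    refine ⟨isFrame_of_orthonormal (by simp [h]) fun i j => ?_, ?_⟩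
    · rw [hw', hw', hv]
      simp [Fin.ext_iff]
    · rw [castDegree_apply]
      simpa [hw'] using hv'
  obtain ⟨hf1, hf2⟩ := hframe (fun i => v (Fin.cast h i)) fun _ => rfl
  have h3 := wedgeOne_eq_hodgeStar hJ.inner (l := 2 * n - 2 + 1) (by omega) ⟨n - 1, by omega⟩ hf1
    (liouville (σ (π p)) n) hf2 κ (η p)
    (covD π A (starAd σ g π (k := 2) (l := 2 * n - 2) (by omega) α) p)
  have h4 : formInner (metricAt g (π p)) κ (η p) (negStarDStar hn σ g π A α p) =
      -formInner (metricAt g (π p)) κ (η p) (hodgeStar (metricAt g (π p)) (liouville (σ (π p)) n)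
        (by omega) (covD π A (starAd σ g π (k := 2) (l := 2 * n - 2) (by omega) α) p)) := by
    rw [← neg_one_mul, ← formInner_smul_right, neg_one_smul]
    rfl
  rw [h1, starAd, h2, h3, ← h4, formInner_comm hJ.inner hκ.symm (α p)]
  exact castDegree_sub_smul hw h _ _ _

end Identity
end Green

/-! ### Integration by parts and the first variation -/

section Variational
open MeasureTheory

variable {n : ℕ} {M : Type*} [TopologicalSpace M]
  [ChartedSpace (EuclideanSpace ℝ (Fin (2 * n))) M]
  [IsManifold (𝓡 (2 * n)) ∞ M] [T2Space M] [SigmaCompactSpace M] [MeasurableSpace M] [BorelSpace M]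
  {𝔤 : Type*} [NormedAddCommGroup 𝔤] [NormedSpace ℝ 𝔤] [FiniteDimensional ℝ 𝔤]
  {G : Type*} [TopologicalSpace G] [ChartedSpace 𝔤 G] [Group G] [LieGroup 𝓘(ℝ, 𝔤) ∞ G]
  {EP : Type*} [NormedAddCommGroup EP] [NormedSpace ℝ EP] [FiniteDimensional ℝ EP]
  {P : Type*} [TopologicalSpace P] [ChartedSpace EP P] [IsManifold 𝓘(ℝ, EP) ∞ P]
  [MulAction Gᵐᵒᵖ P] {π : P → M}
  {σ : M → EuclideanSpace ℝ (Fin (2 * n)) [⋀^Fin 2]→L[ℝ] ℝ} {g : RiemMetric (2 * n) M}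
  {A : P → EP →L[ℝ] 𝔤} {κ : 𝔤 →L[ℝ] 𝔤 →L[ℝ] ℝ}
local notation "𝔼" => EuclideanSpace ℝ (Fin (2 * n))
variable (hπ : IsPrincipalBundle (EuclideanSpace ℝ (Fin (2 * n))) 𝔤 EP G π) (hA : IsConnection G A)
  (hσ : IsSymplectic σ) (hg : IsCompatible g σ) (hκ : IsAdInvariantInner G κ)
include hπ hA hκ

theorem descend_formInner_apply (g : RiemMetric (2 * n) M) {k : ℕ}
    {α β : P → 𝔼 [⋀^Fin k]→L[ℝ] 𝔤} (hα : IsAdForm (EP := EP) G π α)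
    (hβ : IsAdForm (EP := EP) G π β) (p : P) :
    descend π (fun p => formInner (metricAt g (π p)) κ (α p) (β p)) (π p) =
      formInner (metricAt g (π p)) κ (α p) (β p) :=
  descend_apply hπ (formInner_rightMul hκ hπ g hα hβ) p

omit hA hκ in
theorem descend_congr {f f' : P → ℝ} (x : M) (h : ∀ p, π p = x → f p = f' p) :
    descend π f x = descend π f' x := by
  obtain ⟨p, hp⟩ := hπ.surjective x
  have hx : ∃ p, π p = x := ⟨p, hp⟩
  rw [descend, descend, dif_pos hx, dif_pos hx, h _ hx.choose_spec]

/-- The pointwise inner product of two forms, one of which has compact support, is integrable. -/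
theorem integrable_descend_formInner (g : RiemMetric (2 * n) M) {k : ℕ}
    {α β : P → 𝔼 [⋀^Fin k]→L[ℝ] 𝔤} (hα : IsAdForm (EP := EP) G π α)
    (hβ : IsAdForm (EP := EP) G π β) {K : Set M} (hK : IsCompact K)
    (h0 : ∀ p, π p ∉ K → formInner (metricAt g (π p)) κ (α p) (β p) = 0) :
    Integrable (descend π fun p => formInner (metricAt g (π p)) κ (α p) (β p))
      (riemannianVolume g) := by
  refine (continuous_descend_formInner hπ hA hκ g hα hβ).integrable_of_hasCompactSupport
    (HasCompactSupport.intro hK fun x hx => ?_)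
  obtain ⟨p, rfl⟩ := hπ.surjective x
  rw [descend_formInner_apply hπ hA hκ g hα hβ, h0 p hx]

omit hA hκ [SigmaCompactSpace M] [MeasurableSpace M] [BorelSpace M] in
theorem covD_eq_zero {k : ℕ} {η : P → 𝔼 [⋀^Fin k]→L[ℝ] 𝔤} {K : Set M}
    (hK : IsCompact K) (hηK : ∀ p, π p ∉ K → η p = 0) {p : P} (hp : π p ∉ K) :
    covD π A η p = 0 := by
  have h : lift EP π η =ᶠ[𝓝 p] 0 := by
    filter_upwards [(hK.isClosed.isOpen_compl.preimage hπ.smooth_proj.continuous).mem_nhds hp]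
      with q hq
    change (η q).compContinuousLinearMap _ = 0
    rw [hηK q hq]
    rfl
  rw [covD, show extD (fun q => (η q).compContinuousLinearMap (tmap EP 𝔼 π q)) p = 0 from
    (extD_congr h).trans extD_zero]
  rfl

omit hπ hA hκ in
theorem formInner_zero_left {m : ℕ}
    (b : EuclideanSpace ℝ (Fin m) →L[ℝ] EuclideanSpace ℝ (Fin m) →L[ℝ] ℝ)
    {k : ℕ} (β : EuclideanSpace ℝ (Fin m) [⋀^Fin k]→L[ℝ] 𝔤) : formInner b κ 0 β = 0 := by
  simp [formInner]

include hσ hg in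
/-- Integration by parts: `⟨d_A η, α⟩ = ⟨η, -*d_A*α⟩` for `η` with compact support. -/
theorem l2Inner_covD (hn : 2 ≤ n) {η : P → 𝔼 [⋀^Fin 1]→L[ℝ] 𝔤}
    {α : P → 𝔼 [⋀^Fin 2]→L[ℝ] 𝔤} (hη : IsAdForm (EP := EP) G π η)
    (hα : IsAdForm (EP := EP) G π α) {K : Set M} (hK : IsCompact K)
    (hηK : ∀ p, π p ∉ K → η p = 0) :
    l2Inner g κ π Set.univ (covD π A η) α =
      l2Inner g κ π Set.univ η (negStarDStar hn σ g π A α) := by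
  have hD := hη.covD hπ hA
  have hN := hα.negStarDStar hπ hA hσ.smooth g hn
  have hi1 := integrable_descend_formInner hπ hA hκ g hD hα hK fun p hp => by
    rw [covD_eq_zero hπ hK hηK hp, formInner_zero_left]
  have hi2 := integrable_descend_formInner hπ hA hκ g hη hN hK fun p hp => by
    rw [hηK p hp, formInner_zero_left]
  have hdeg : 2 * n - 2 + 1 + 1 = 2 * n := by omega
  have hθK : ∀ x ∉ K, descendForm π (greenForm hn κ σ g π η α) x = 0 := by
    intro x hx
    obtain ⟨p, rfl⟩ := hπ.surjective x
    rw [descendForm_apply hπ (greenForm_rightMul hπ hA hσ hκ hn hη hα), greenForm, hηK p hx]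
    ext v
    rw [wedgeOne_apply]
    simp [ofOneForm_apply]
  have hV := isVolumeForm_liouville hσ hg
  have h := integral_topRatio_extD hdeg hV (isSmoothForm_descendForm hπ
    (greenForm_rightMul hπ hA hσ hκ hn hη hα) (isSmoothForm_lift_greenForm hπ hA hσ hn hη hα))
    hK hθK
  rw [l2Inner, l2Inner, Measure.restrict_univ, ← sub_eq_zero, ← integral_sub hi1 hi2, ← h]
  congr 1
  funext x
  obtain ⟨p, rfl⟩ := hπ.surjective x
  rw [descend_formInner_apply hπ hA hκ g hD hα, descend_formInner_apply hπ hA hκ g hη hN, topRatio,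
    extD_greenForm hπ hA hσ hg hκ hn hη hα, ContinuousAlternatingMap.smul_apply, smul_eq_mul,
    mul_div_cancel_right₀ _ (hV.ne_zero _)]

/-- The `L²` inner product with a form that vanishes outside `K` is an integral over `K`. -/
theorem l2Inner_eq_univ {k : ℕ} {α β : P → 𝔼 [⋀^Fin k]→L[ℝ] 𝔤}
    (hα : IsAdForm (EP := EP) G π α) (hβ : IsAdForm (EP := EP) G π β) {K : Set M}
    (hαK : ∀ p, π p ∉ K → α p = 0) : l2Inner g κ π K α β = l2Inner g κ π Set.univ α β := by
  rw [l2Inner, l2Inner, Measure.restrict_univ]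
  refine setIntegral_eq_integral_of_forall_compl_eq_zero fun x hx => ?_
  obtain ⟨p, rfl⟩ := hπ.surjective x
  rw [descend_formInner_apply hπ hA hκ g hα hβ, hαK p hx, formInner_zero_left]

omit hπ hA hκ [BorelSpace M] [ChartedSpace EP P] [NormedSpace ℝ EP] [NormedAddCommGroup EP]
  [FiniteDimensional ℝ EP] [IsManifold 𝓘(ℝ, EP) ∞ P] [TopologicalSpace P] [MulAction Gᵐᵒᵖ P]
  [FiniteDimensional ℝ 𝔤] in
theorem l2Inner_zero_right {k : ℕ} (K : Set M) (α : P → 𝔼 [⋀^Fin k]→L[ℝ] 𝔤) :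
    l2Inner g κ π K α 0 = 0 := by
  have h : descend π (fun p => formInner (metricAt g (π p)) κ (α p)
      ((0 : P → 𝔼 [⋀^Fin k]→L[ℝ] 𝔤) p)) = fun _ => 0 := by
    funext x
    simp [descend, formInner]
  rw [l2Inner, h, integral_zero]

omit hπ hA hκ in
theorem primitivePart_add
    {b : EuclideanSpace ℝ (Fin (2 * n)) →L[ℝ] EuclideanSpace ℝ (Fin (2 * n)) →L[ℝ] ℝ}
    {τ : 𝔼 [⋀^Fin 2]→L[ℝ] ℝ}
    (α β : 𝔼 [⋀^Fin 2]→L[ℝ] 𝔤) :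
    primitivePart b τ (α + β) = primitivePart b τ α + primitivePart b τ β := by
  ext v
  simp [primitivePart, formSmul_apply, contraction_add]
  abel

omit hπ hA hκ in
theorem primitivePart_smul
    {b : EuclideanSpace ℝ (Fin (2 * n)) →L[ℝ] EuclideanSpace ℝ (Fin (2 * n)) →L[ℝ] ℝ}
    {τ : 𝔼 [⋀^Fin 2]→L[ℝ] ℝ}
    (c : ℝ) (α : 𝔼 [⋀^Fin 2]→L[ℝ] 𝔤) :
    primitivePart b τ (c • α) = c • primitivePart b τ α := by
  ext v
  simp [primitivePart, formSmul_apply, contraction_smul, smul_sub, smul_smul, mul_comm]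
  rw [mul_assoc]

include hσ hg in
/-- The first variation of the primitive Yang–Mills functional. The integrand is a polynomial in
`t`, and the primitive part of `d_A η` may be replaced by `d_A η` in its linear coefficient `2 ⟨(d_A
η)_p, F_p⟩`. -/
theorem hasDerivAt_primitiveYangMills (hn : n ≠ 0) {η : P → 𝔼 [⋀^Fin 1]→L[ℝ] 𝔤}
    (hη : IsAdForm (EP := EP) G π η) {K : Set M} (hK : IsCompact K) :
    HasDerivAt (fun t : ℝ => primitiveYangMills σ g κ π K (vary π A η t))
      (2 * l2Inner g κ π K (covD π A η) (primitiveCurvature σ g π A)) 0 := by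
  obtain ⟨R, S, hR, hS, hRS⟩ := exists_curvature_vary hπ hA hη
  let pr : (P → 𝔼 [⋀^Fin 2]→L[ℝ] 𝔤) → P → 𝔼 [⋀^Fin 2]→L[ℝ] 𝔤 :=
    fun α p => primitivePart (metricAt g (π p)) (σ (π p)) (α p)
  have hpr : ∀ {α : P → 𝔼 [⋀^Fin 2]→L[ℝ] 𝔤}, IsAdForm (EP := EP) G π α →
      IsAdForm (EP := EP) G π (pr α) := fun hα => hα.primitivePart hπ hA hσ.smooth g
  -- the coefficients of the primitive part of the curvature of `A + t η`
  let q : Fin 4 → P → 𝔼 [⋀^Fin 2]→L[ℝ] 𝔤 :=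
    ![pr (curvature π A), pr (covD π A η), pr R, pr S]
  have hq : ∀ i, IsAdForm (EP := EP) G π (q i) := by
    intro i
    fin_cases i
    · exact hpr (isAdForm_curvature hπ hA)
    · exact hpr (hη.covD hπ hA)
    · exact hpr hR
    · exact hpr hS
  let D : Fin 4 → Fin 4 → M → ℝ := fun i j =>
    descend π fun p => formInner (metricAt g (π p)) κ (q i p) (q j p)
  have hD : ∀ i j, IntegrableOn (D i j) K (riemannianVolume g) := fun i j =>
    (continuous_descend_formInner hπ hA hκ g (hq i) (hq j)).continuousOn.integrableOn_compact hK
  have hpoly : (fun t : ℝ => primitiveYangMills σ g κ π K (vary π A η t)) = fun t =>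
      ∑ i : Fin 4, ∑ j : Fin 4, t ^ (i + j : ℕ) * l2Inner g κ π K (q i) (q j) := by
    funext t
    have hpt : ∀ x, descend π (fun p => formInner (metricAt g (π p)) κ
        (primitiveCurvature σ g π (vary π A η t) p)
        (primitiveCurvature σ g π (vary π A η t) p)) x =
        ∑ i : Fin 4, ∑ j : Fin 4, t ^ (i + j : ℕ) * D i j x := by
      intro x
      obtain ⟨p, rfl⟩ := hπ.surjective x
      have hP := isAdForm_primitiveCurvature hπ (isConnection_vary hπ hA hη t) hσ.smooth g
      simp only [D, descend_formInner_apply hπ hA hκ g (hq _) (hq _)]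
      rw [descend_formInner_apply hπ hA hκ g hP hP]
      have hpv : primitiveCurvature σ g π (vary π A η t) p =
          q 0 p + t • q 1 p + t ^ 2 • q 2 p + t ^ 3 • q 3 p := by
        change primitivePart _ _ (curvature π (vary π A η t) p) = _
        rw [hRS t]
        let d : P → 𝔼 [⋀^Fin 2]→L[ℝ] 𝔤 := covD π A η
        change primitivePart _ _ (curvature π A p + t • d p + t ^ 2 • R p + t ^ 3 • S p) = _
        simp only [primitivePart_add, primitivePart_smul]
        rfl
      rw [hpv]
      simp only [formInner_add_left, formInner_add_right, formInner_smul_left, formInner_smul_right,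
        Fin.sum_univ_four]
      simp
      ring
    rw [primitiveYangMills, l2Inner]
    simp only [hpt]
    rw [integral_finsetSum _ fun i _ => integrable_finsetSum _ fun j _ => (hD i j).const_mul _]
    refine Finset.sum_congr rfl fun i _ => ?_
    rw [integral_finsetSum _ fun j _ => (hD i j).const_mul _]
    exact Finset.sum_congr rfl fun j _ => integral_const_mul _ _
  have hF0 : ∀ p, contraction (metricAt g (π p)) (σ (π p)) (primitiveCurvature σ g π A p) = 0 := by
    intro p
    obtain ⟨J, hJ⟩ := hg.exists_isUnitaryTriple (π p)
    exact ((eq_primitivePart_iff hn hJ.inner.symm hJ.inner.pos hJ.sq hJ.compat _ _).1 rfl).1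
  have h10 : l2Inner g κ π K (q 1) (q 0) =
      l2Inner g κ π K (covD π A η) (primitiveCurvature σ g π A) := by
    rw [l2Inner, l2Inner]
    congr 1
    funext x
    exact descend_congr hπ x fun p _ =>
      formInner_primitivePart (isInner_metricAt g _) κ _ (hF0 p)
  have h01 : l2Inner g κ π K (q 0) (q 1) = l2Inner g κ π K (q 1) (q 0) := by
    rw [l2Inner, l2Inner]
    congr 1
    funext x
    exact descend_congr hπ x fun p _ => formInner_comm (isInner_metricAt g _) hκ.symm _ _
  rw [hpoly]
  have hder := HasDerivAt.fun_sum (u := Finset.univ) fun (i : Fin 4) _ =>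
    HasDerivAt.fun_sum (u := Finset.univ) fun (j : Fin 4) _ =>
    (hasDerivAt_pow (i + j : ℕ) (0 : ℝ)).mul_const (l2Inner g κ π K (q i) (q j))
  refine hder.congr_deriv ?_
  simp [Fin.sum_univ_four, h01, h10]
  ring

include hσ hg in
/-- A form `β` is zero if it is `L²`-orthogonal to all forms with compact support: test with `χ β`
for a bump function `χ`. -/
theorem eq_zero_of_forall_l2Inner_eq_zero {β : P → 𝔼 [⋀^Fin 1]→L[ℝ] 𝔤}
    (hβ : IsAdForm (EP := EP) G π β)
    (h : ∀ (η : P → 𝔼 [⋀^Fin 1]→L[ℝ] 𝔤) (K : Set M), IsAdForm (EP := EP) G π η → IsCompact K →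
      (∀ p, π p ∉ K → η p = 0) → l2Inner g κ π Set.univ η β = 0) : β = 0 := by
  funext p₀
  by_contra hne
  obtain ⟨χ⟩ : Nonempty (SmoothBumpFunction (𝓡 (2 * n)) (π p₀)) := inferInstance
  have hχ : ContMDiff (𝓡 (2 * n)) 𝓘(ℝ, ℝ) ∞ χ := χ.contMDiff
  let η : P → 𝔼 [⋀^Fin 1]→L[ℝ] 𝔤 := fun p => χ (π p) • β p
  have hη : IsAdForm (EP := EP) G π η := by
    refine ⟨isSmoothForm_iff.2 fun p => ?_, fun a p => ?_⟩
    · exact SmoothFormAt.smul (f := χ ∘ π) ((hχ.comp hπ.smooth_proj).contMDiffAt)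
        (isSmoothForm_iff.1 hβ.smooth p)
    · simp only [η]
      rw [hπ.proj_rightMul, hβ.equivariant]
      ext v
      exact (map_smul (Ad a⁻¹ : 𝔤 →L[ℝ] 𝔤) _ _).symm
  have hηK : ∀ p, π p ∉ tsupport χ → η p = 0 := by
    intro p hp
    simp only [η]
    rw [image_eq_zero_of_notMem_tsupport hp, zero_smul]
  have hval : ∀ p, descend π (fun p => formInner (metricAt g (π p)) κ (η p) (β p)) (π p) =
      χ (π p) * formInner (metricAt g (π p)) κ (β p) (β p) := by
    intro p
    rw [descend_formInner_apply hπ hA hκ g hη hβ, formInner_smul_left]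
  have hpos : ∀ p, 0 ≤ formInner (metricAt g (π p)) κ (β p) (β p) ∧
      (formInner (metricAt g (π p)) κ (β p) (β p) = 0 → β p = 0) := by
    intro p
    obtain ⟨J, hJ⟩ := hg.exists_isUnitaryTriple (π p)
    obtain ⟨v, hv, -⟩ := hJ.exists_frame (n := n) (by simp)
    exact formInner_one_nonneg_and_definite hJ.inner (isFrame_of_orthonormal (by simp) hv) hκ.pos _
  have hint := h η (tsupport χ) hη χ.hasCompactSupport hηK
  rw [l2Inner, Measure.restrict_univ] at hint
  refine (Continuous.integral_pos_of_hasCompactSupport_nonneg_nonzero (x := π p₀)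
    (continuous_descend_formInner hπ hA hκ g hη hβ)
    (HasCompactSupport.intro χ.hasCompactSupport fun x hx => ?_) (fun x => ?_) ?_).ne' hint
  · obtain ⟨p, rfl⟩ := hπ.surjective x
    rw [hval, image_eq_zero_of_notMem_tsupport hx, zero_mul]
  · obtain ⟨p, rfl⟩ := hπ.surjective x
    rw [hval]
    exact mul_nonneg χ.nonneg (hpos p).1
  · rw [hval, χ.eq_one, one_mul]
    exact fun h0 => hne ((hpos p₀).2 h0)

end Variational

end PrimitiveYM

end

theorem mainTheorem7
    {n : ℕ} (hn : 2 ≤ n)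
    {M : Type*} [TopologicalSpace M] [ChartedSpace (EuclideanSpace ℝ (Fin (2 * n))) M]
    [IsManifold (𝓡 (2 * n)) ∞ M] [T2Space M] [SigmaCompactSpace M]
    [MeasurableSpace M] [BorelSpace M]
    {𝔤 : Type*} [NormedAddCommGroup 𝔤] [NormedSpace ℝ 𝔤] [FiniteDimensional ℝ 𝔤]
    {G : Type*} [TopologicalSpace G] [ChartedSpace 𝔤 G] [Group G] [LieGroup 𝓘(ℝ, 𝔤) ∞ G]
    {EP : Type*} [NormedAddCommGroup EP] [NormedSpace ℝ EP] [FiniteDimensional ℝ EP]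
    {P : Type*} [TopologicalSpace P] [ChartedSpace EP P] [IsManifold 𝓘(ℝ, EP) ∞ P]
    [MulAction Gᵐᵒᵖ P]
    (π : P → M) (hπ : IsPrincipalBundle (EuclideanSpace ℝ (Fin (2 * n))) 𝔤 EP G π)
    (κ : 𝔤 →L[ℝ] 𝔤 →L[ℝ] ℝ) (hκ : IsAdInvariantInner G κ)
    (σ : M → EuclideanSpace ℝ (Fin (2 * n)) [⋀^Fin 2]→L[ℝ] ℝ) (hσ : IsSymplectic σ)
    (g : RiemMetric (2 * n) M) (hg : IsCompatible g σ)
    (A : P → EP →L[ℝ] 𝔤) (hA : IsConnection G A) :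
    IsAdjointDerivative G g κ π A (primitiveCurvature σ g π A)
        (negStarDStar hn σ g π A (primitiveCurvature σ g π A)) ∧
      (IsPrimitiveYangMills G σ g κ π A ↔
        negStarDStar hn σ g π A (primitiveCurvature σ g π A) = 0) := by
  have hF := isAdForm_primitiveCurvature hπ hA hσ.smooth g
  have hD := hF.negStarDStar hπ hA hσ.smooth g hn
  have hadj : IsAdjointDerivative G g κ π A (primitiveCurvature σ g π A)
      (negStarDStar hn σ g π A (primitiveCurvature σ g π A)) :=
    ⟨hD, fun η K hη hK hηK => l2Inner_covD hπ hA hσ hg hκ hn hη hF hK hηK⟩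
  -- the first variation in the direction `η` is `2 ⟨η, -*d_A*F_p⟩`
  have hder : ∀ (η : P → EuclideanSpace ℝ (Fin (2 * n)) [⋀^Fin 1]→L[ℝ] 𝔤) (K : Set M),
      IsAdForm (EP := EP) G π η → IsCompact K → (∀ p, π p ∉ K → η p = 0) →
      HasDerivAt (fun t : ℝ => primitiveYangMills σ g κ π K (vary π A η t))
        (2 * l2Inner g κ π Set.univ η
          (negStarDStar hn σ g π A (primitiveCurvature σ g π A))) 0 := by
    intro η K hη hK hηK
    have h := hasDerivAt_primitiveYangMills hπ hA hσ hg hκ (by omega) hη hK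
    rwa [l2Inner_eq_univ hπ hA hκ (hη.covD hπ hA) hF fun p hp => covD_eq_zero hπ hK hηK hp,
      hadj.2 η K hη hK hηK] at h
  refine ⟨hadj, fun hcrit => ?_, fun hzero η K hη hK hηK => ?_⟩
  · refine eq_zero_of_forall_l2Inner_eq_zero hπ hA hσ hg hκ hD fun η K hη hK hηK => ?_
    have h := (hder η K hη hK hηK).unique (hcrit η K hη hK hηK)
    linarith
  · have h := hder η K hη hK hηK
    rwa [hzero, l2Inner_zero_right, mul_zero] at h
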